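/- Let $\mathcal H$ be a complex Hilbert space with a complex conjugation $\mathcal C$ (an anti-linear isometric involution); write $\overline A=\mathcal C A\mathcal C$ and $A^t=(\overline A)^*$ for bounded $A$. A symmetry operator is a unitary $S=\overline S$ with $S^2=\mathbf 1$ (even) or $S^2=-\mathbf 1$ (odd) all of whose eigenspaces have the same dimension (so $\pm\mathbf 1$ are even symmetry operators). For a Fredholm operator $T$ put $\mathrm{Ind}(T)=\dim\mathrm{Ker}\,T-\dim\mathrm{Ker}\,T^*$ and $\mathrm{Ind}_2(T)=\dim\mathrm{Ker}\,T \bmod 2$. Let $S,\Sigma$ (and $\widehat S$ for odd $j$) be commuting symmetry operators. An index pairing of class $(j,d)$, $j\in\{0,\dots,7\}$, $d\in\{2,4,6,8\}$, consists of an orthogonal projection $P$ and a unitary $F$ such that $T=PFP+\mathbf 1-P$ is Fredholm, $[S,F]=0$, $[\Sigma,P]=0$, $[\widehat S,F]=0$ for odd $j$, and the following hold. Columns: $d=2$: $\Sigma^*F^t\Sigma=F$, $\Sigma^2=\mathbf 1$; $d=4$: $\Sigma^*\overline F\Sigma=F$, $\Sigma^2=-\mathbf 1$; $d=6$: $\Sigma^*F^t\Sigma=F$,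 $\Sigma^2=-\mathbf 1$; $d=8$: $\Sigma^*\overline F\Sigma=F$, $\Sigma^2=\mathbf 1$. Rows: say that $P$ is of kind R or Q with respect to a symmetry operator $\Theta$ if $\Theta^*\overline P\Theta=P$ with $\Theta$ even or odd respectively, and of kind O or S if $\Theta^*\overline P\Theta=\mathbf 1-P$ with $\Theta$ even or odd respectively. The kind with respect to $S$ is R for $j=0,1$, O for $j=2,3$, Q for $j=4,5$, S for $j=6,7$; the kind with respect to $\widehat S$ is O, Q, S, R for $j=1,3,5,7$ respectively. Then the index pairing is of the type given in the table $$\begin{array}{c|cccc} j & d=2 & d=4 & d=6 & d=8\\ \hline 0 & 0 & \mathrm R\text{-}2\mathbb Z & \mathrm R\text{-}\mathbb Z_2 & \mathbb Z\\ 1 & 0&0&0&\mathrm O\text{-}\mathbb Z_2\\ 2 & \mathbb Z & 0 & \mathrm O\text{-}2\mathbb Z & \mathrm O\text{-}\mathbb Z_2\\ 3 & \mathrm Q\text{-}\mathbb Z_2&0&0&0\\ 4 & \mathrm Q\text{-}\mathbb Z_2 & \mathbb Z & 0 & \mathrm Q\text{-}2\mathbb Z\\ 5 & 0&\mathrm S\text{-}\mathbb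 Z_2&0&0\\ 6 & \mathrm S\text{-}2\mathbb Z & \mathrm S\text{-}\mathbb Z_2 & \mathbb Z & 0\\ 7 & 0&0&\mathrm R\text{-}\mathbb Z_2&0\end{array}$$ in the following sense. A homotopy is a norm-continuous path $t\mapsto(P_t,F_t)$, $t\in[0,1]$, of index pairings of class $(j,d)$ with fixed symmetry operators, and $T_t=P_tF_tP_t+\mathbf 1-P_t$. - $\mathbb Z$: the integer $\mathrm{Ind}(T)$ is constant along homotopies. - $2\mathbb Z$: $\mathrm{Ind}(T)$ and $\dim\mathrm{Ker}\,T$ are even, and $\mathrm{Ind}(T)$ is constant along homotopies. - $\mathbb Z_2$: $\mathrm{Ind}(T)=0$ and $\mathrm{Ind}_2(T)$ is constant along homotopies. - $0$: $\mathrm{Ind}(T)=0$, and there is an augmented Hilbert space $\mathcal H\oplus\mathbb C^n$ with augmented conjugation and augmented commuting symmetry operators $S\oplus S'$, $\Sigma\oplus\Sigma'$ (and $\widehat S\oplus\widehat S'$ for odd $j$), of the same parities, a projection $P'$ on $\mathbb C^n$, and a homotopy of index pairings of class $(j,d)$ on $\mathcal H\oplus\mathbb C^n$ which starts at $(P\oplus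 P',F\oplus\mathbf 1)$, whose operator is $T\oplus\mathbf 1$, and ends at a pairing with $\mathrm{Ind}_2=0$. The prefix R, Q, S, O is the kind of the projection $P$ with respect to $S$ for even $j$ and with respect to $\widehat S$ for odd $j$. -/

import Mathlib

/-! Index pairings of projections and unitaries with real and quaternionic symmetries. -/

open Module

noncomputable section

namespace IndexPairing

universe u

section Conjugation

/-- A complex conjugation on a complex Hilbert space: an anti-linear isometric involution. -/
structure Conjugation (H : Type u) [NormedAddCommGroup H] [InnerProductSpace ℂ H] where
  toIsometry : H →ₛₗᵢ[starRingEnd ℂ] H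
  involutive : ∀ x, toIsometry (toIsometry x) = x

variable {H : Type u} [NormedAddCommGroup H] [InnerProductSpace ℂ H]

/-- The complex conjugate `C A C` of a bounded operator `A`. -/
def Conjugation.bar (C : Conjugation H) (A : H →L[ℂ] H) : H →L[ℂ] H :=
  C.toIsometry.toContinuousLinearMap.comp (A.comp C.toIsometry.toContinuousLinearMap)

/-- The transpose of a bounded operator: the adjoint of its complex conjugate. -/
def Conjugation.transpose [CompleteSpace H] (C : Conjugation H) (A : H →L[ℂ] H) : H →L[ℂ] H :=
  star (C.bar A)

/-- A symmetry operator: a real unitary squaring to `ε 1` (even for `ε = 1`, odd for `ε = -1`),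
all of whose (nonzero) eigenspaces have the same Hilbert space dimension. -/
structure IsSymmetryOperator [CompleteSpace H] (C : Conjugation H) (ε : ℤˣ) (S : H →L[ℂ] H) :
    Prop where
  real : C.bar S = S
  unitary : S ∈ unitary (H →L[ℂ] H)
  sq : S * S = (ε : ℤ) • (1 : H →L[ℂ] H)
  eigenspaces : ∀ μ ν : ℂ, End.HasEigenvalue (S : H →ₗ[ℂ] H) μ →
    End.HasEigenvalue (S : H →ₗ[ℂ] H) ν →
    Nonempty (End.eigenspace (S : H →ₗ[ℂ] H) μ ≃ₗᵢ[ℂ] End.eigenspace (S : H →ₗ[ℂ] H) ν)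

end Conjugation

section Types

/-- The four kinds of symmetry of a projection: even real `R`, odd real (quaternionic) `Q`,
odd Lagrangian `S`, even Lagrangian `O`. -/
inductive Kind
  | R
  | Q
  | S
  | O

/-- Parity of the symmetry operator belonging to a kind. -/
def Kind.sign : Kind → ℤˣ
  | .R => 1
  | .Q => -1
  | .S => -1
  | .O => 1

/-- The columns of the table. -/
inductive Column
  | d2
  | d4
  | d6
  | d8

/-- Parity of the symmetry operator `Σ` in each column. -/
def Column.sign : Column → ℤˣ
  | .d2 => 1
  | .d4 => -1
  | .d6 => -1
  | .d8 => 1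

/-- The kind of symmetry that `S` imposes on the projection in row `j`. -/
def rowKind : Fin 8 → Kind
  | 0 => .R
  | 1 => .R
  | 2 => .O
  | 3 => .O
  | 4 => .Q
  | 5 => .Q
  | 6 => .S
  | 7 => .S

/-- The kind of symmetry that the second operator `Ŝ` imposes on the projection in row `j`; it is
absent in the even rows. -/
def rowKindHat : Fin 8 → Option Kind
  | 0 => none
  | 1 => some .O
  | 2 => none
  | 3 => some .Q
  | 4 => none
  | 5 => some .S
  | 6 => none
  | 7 => some .R

/-- The possible entries of the table. -/
inductive Entry
  | zero
  | Z
  | twoZ (k : Kind)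
  | Z2 (k : Kind)

/-- The table of index types. -/
def table : Fin 8 → Column → Entry
  | 0, .d2 => .zero
  | 0, .d4 => .twoZ .R
  | 0, .d6 => .Z2 .R
  | 0, .d8 => .Z
  | 1, .d2 => .zero
  | 1, .d4 => .zero
  | 1, .d6 => .zero
  | 1, .d8 => .Z2 .O
  | 2, .d2 => .Z
  | 2, .d4 => .zero
  | 2, .d6 => .twoZ .O
  | 2, .d8 => .Z2 .O
  | 3, .d2 => .Z2 .Q
  | 3, .d4 => .zero
  | 3, .d6 => .zero
  | 3, .d8 => .zero
  | 4, .d2 => .Z2 .Q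
  | 4, .d4 => .Z
  | 4, .d6 => .zero
  | 4, .d8 => .twoZ .Q
  | 5, .d2 => .zero
  | 5, .d4 => .Z2 .S
  | 5, .d6 => .zero
  | 5, .d8 => .zero
  | 6, .d2 => .twoZ .S
  | 6, .d4 => .Z2 .S
  | 6, .d6 => .Z
  | 6, .d8 => .zero
  | 7, .d2 => .zero
  | 7, .d4 => .zero
  | 7, .d6 => .Z2 .R
  | 7, .d8 => .zero

end Types

section Pairings

/-- The three operators `S`, `Ŝ`, `Σ`; the operator `Ŝ` plays no role in the even rows. -/
structure Symmetries (H : Type u) [NormedAddCommGroup H] [InnerProductSpace ℂ H] where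
  S : H →L[ℂ] H
  Shat : H →L[ℂ] H
  Sigma : H →L[ℂ] H

variable {H : Type u} [NormedAddCommGroup H] [InnerProductSpace ℂ H] [CompleteSpace H]

/-- The relation imposed on a projection `P` by a symmetry operator `S` of the given kind. -/
def Kind.Relation (C : Conjugation H) (S P : H →L[ℂ] H) : Kind → Prop
  | .R => star S * C.bar P * S = P
  | .Q => star S * C.bar P * S = P
  | .S => star S * C.bar P * S = 1 - P
  | .O => star S * C.bar P * S = 1 - P

/-- The relation imposed on the unitary `F` by `Σ` in each column. -/
def Column.Relation (C : Conjugation H) (Sigma F : H →L[ℂ] H) : Column → Prop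
  | .d2 => star Sigma * C.transpose F * Sigma = F
  | .d4 => star Sigma * C.bar F * Sigma = F
  | .d6 => star Sigma * C.transpose F * Sigma = F
  | .d8 => star Sigma * C.bar F * Sigma = F

/-- The operators are commuting symmetry operators of the parities required in row `j` and
column `d`. -/
structure Symmetries.Admissible (s : Symmetries H) (C : Conjugation H) (j : Fin 8) (d : Column) :
    Prop where
  symm_S : IsSymmetryOperator C (rowKind j).sign s.S
  symm_Sigma : IsSymmetryOperator C d.sign s.Sigma
  comm : Commute s.S s.Sigma
  symm_Shat : ∀ k ∈ rowKindHat j, IsSymmetryOperator C k.sign s.Shat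
  comm_hat : ∀ k ∈ rowKindHat j, Commute s.S s.Shat ∧ Commute s.Shat s.Sigma

/-- The operator `P F P + 1 - P`. -/
def pairingOp (P F : H →L[ℂ] H) : H →L[ℂ] H := P * F * P + 1 - P

/-- `(P, F)` is an index pairing with the symmetries `s` in row `j` and column `d`: `P` is an
orthogonal projection, `F` is unitary, all symmetry relations of the cell hold, and
`P F P + 1 - P` is Fredholm. -/
structure IsPairing (C : Conjugation H) (s : Symmetries H) (j : Fin 8) (d : Column)
    (P F : H →L[ℂ] H) : Prop where
  projection : IsStarProjection P
  unitary : F ∈ unitary (H →L[ℂ] H)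
  rel_S : (rowKind j).Relation C s.S P
  rel_Shat : ∀ k ∈ rowKindHat j, k.Relation C s.Shat P
  rel_Sigma : d.Relation C s.Sigma F
  comm_S_F : Commute s.S F
  comm_Shat_F : ∀ k ∈ rowKindHat j, Commute s.Shat F
  comm_Sigma_P : Commute s.Sigma P
  fredholm : (pairingOp P F).IsFredholm

/-- A norm-continuous path of index pairings with fixed symmetries. -/
structure IsPath (C : Conjugation H) (s : Symmetries H) (j : Fin 8) (d : Column)
    (P F : unitInterval → H →L[ℂ] H) : Prop where
  continuous_P : Continuous P
  continuous_F : Continuous F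
  pairing : ∀ t, IsPairing C s j d (P t) (F t)

/-- The Noether index `dim Ker T - dim Ker T*`. -/
def noetherIndex (T : H →L[ℂ] H) : ℤ :=
  (finrank ℂ T.ker : ℤ) - (finrank ℂ (star T).ker : ℤ)

/-- The `ℤ₂`-index `dim Ker T mod 2`. -/
def index2 (T : H →L[ℂ] H) : ZMod 2 := (finrank ℂ T.ker : ZMod 2)

/-- A quantity attached to operators `T` is constant along every path of index pairings that
starts at `(P, F)`. -/
def IsHomotopyInvariantAt {α : Type*} (f : (H →L[ℂ] H) → α) (C : Conjugation H)
    (s : Symmetries H) (j : Fin 8) (d : Column) (P F : H →L[ℂ] H) : Prop :=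
  ∀ Pt Ft : unitInterval → H →L[ℂ] H, IsPath C s j d Pt Ft → Pt 0 = P → Ft 0 = F →
    ∀ t, f (pairingOp (Pt t) (Ft t)) = f (pairingOp P F)

/-- `P` is of kind `k` (`R`, `Q`, `S` or `O`) with respect to `S` or `Ŝ`. -/
def HasKind (C : Conjugation H) (s : Symmetries H) (j : Fin 8) (P : H →L[ℂ] H) (k : Kind) : Prop :=
  (rowKind j = k ∧ IsSymmetryOperator C k.sign s.S ∧ k.Relation C s.S P) ∨
    (rowKindHat j = some k ∧ IsSymmetryOperator C k.sign s.Shat ∧ k.Relation C s.Shat P)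

end Pairings

section Augmentation

variable {H : Type u} [NormedAddCommGroup H] [InnerProductSpace ℂ H]

/-- Entrywise complex conjugation on `ℂⁿ`. -/
def stdConj (n : ℕ) : Conjugation (EuclideanSpace ℂ (Fin n)) where
  toIsometry :=
    { toFun := fun x => WithLp.toLp 2 (fun i => starRingEnd ℂ (x i))
      map_add' := fun x y => by ext i; simp
      map_smul' := fun c x => by ext i; simp
      norm_map' := fun x => by simp [EuclideanSpace.norm_eq] }
  involutive := fun x => by ext i; simp

/-- The augmented Hilbert space `H ⊕ ℂⁿ` (orthogonal direct sum). -/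
abbrev Augmented (H : Type u) (n : ℕ) : Type u := WithLp 2 (H × EuclideanSpace ℂ (Fin n))

/-- The conjugation of `H` extended to `H ⊕ ℂⁿ` by the entrywise conjugation. -/
def Conjugation.augment (C : Conjugation H) (n : ℕ) : Conjugation (Augmented H n) where
  toIsometry :=
    { toFun := fun x => WithLp.toLp 2 (C.toIsometry x.fst, (stdConj n).toIsometry x.snd)
      map_add' := fun x y => by
        simp only [WithLp.add_fst, WithLp.add_snd, map_add]
        rfl
      map_smul' := fun c x => by
        simp only [WithLp.smul_fst, WithLp.smul_snd, map_smulₛₗ]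
        rfl
      norm_map' := fun x => by
        simp [WithLp.prod_norm_eq_of_L2] }
  involutive := fun x => by
    have h1 := C.involutive x.fst
    have h2 := (stdConj n).involutive x.snd
    change WithLp.toLp 2 (C.toIsometry (C.toIsometry x.fst),
      (stdConj n).toIsometry ((stdConj n).toIsometry x.snd)) = x
    rw [h1, h2]
    rfl

/-- The operator `A ⊕ B` on `H ⊕ ℂⁿ`. -/
def directSum {n : ℕ} (A : H →L[ℂ] H)
    (B : EuclideanSpace ℂ (Fin n) →L[ℂ] EuclideanSpace ℂ (Fin n)) :
    Augmented H n →L[ℂ] Augmented H n :=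
  ((WithLp.prodContinuousLinearEquiv 2 ℂ H (EuclideanSpace ℂ (Fin n))).symm :
      (H × EuclideanSpace ℂ (Fin n)) →L[ℂ] Augmented H n).comp
    ((A.prodMap B).comp
      ((WithLp.prodContinuousLinearEquiv 2 ℂ H (EuclideanSpace ℂ (Fin n))) :
        Augmented H n →L[ℂ] (H × EuclideanSpace ℂ (Fin n))))

/-- Direct sum of two families of symmetry operators. -/
def Symmetries.augment {n : ℕ} (s : Symmetries H)
    (s' : Symmetries (EuclideanSpace ℂ (Fin n))) : Symmetries (Augmented H n) where
  S := directSum s.S s'.S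
  Shat := directSum s.Shat s'.Shat
  Sigma := directSum s.Sigma s'.Sigma

variable [CompleteSpace H]

/-- After adding a finite-dimensional summand on which the pairing is `(P', 1)`, so that the
operator `P F P + 1 - P` is only extended by an identity, a norm-continuous path of index pairings
with the given symmetries leads to a pairing with trivial `ℤ₂`-index. -/
def IsTrivializable (C : Conjugation H) (s : Symmetries H) (j : Fin 8) (d : Column)
    (P F : H →L[ℂ] H) : Prop :=
  ∃ (n : ℕ) (s' : Symmetries (EuclideanSpace ℂ (Fin n)))
    (P' : EuclideanSpace ℂ (Fin n) →L[ℂ] EuclideanSpace ℂ (Fin n))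
    (Pt Ft : unitInterval → Augmented H n →L[ℂ] Augmented H n),
    s'.Admissible (stdConj n) j d ∧
    (s.augment s').Admissible (C.augment n) j d ∧
    IsPath (C.augment n) (s.augment s') j d Pt Ft ∧
    Pt 0 = directSum P P' ∧ Ft 0 = directSum F 1 ∧
    index2 (pairingOp (Pt 1) (Ft 1)) = 0

/-- What it means for the index pairing `(P, F)` to be of the type named by a table entry. -/
def HasIndexType (C : Conjugation H) (s : Symmetries H) (j : Fin 8) (d : Column)
    (P F : H →L[ℂ] H) : Entry → Prop
  | .zero =>
      noetherIndex (pairingOp P F) = 0 ∧ IsTrivializable C s j d P F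
  | .Z =>
      IsHomotopyInvariantAt noetherIndex C s j d P F
  | .twoZ k =>
      HasKind C s j P k ∧
      Even (noetherIndex (pairingOp P F)) ∧
      Even (finrank ℂ (pairingOp P F).ker) ∧
      IsHomotopyInvariantAt noetherIndex C s j d P F
  | .Z2 k =>
      HasKind C s j P k ∧
      noetherIndex (pairingOp P F) = 0 ∧
      IsHomotopyInvariantAt index2 C s j d P F

end Augmentation

end IndexPairing

end

/-! Let K = S Σ C. It is antiunitary with K² = ±1, the sign being the product of the parities of S
and Σ. It preserves P in the kinds R, Q and exchanges P with 1 - P in the kinds O, S; it commutes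
with F in the columns 4, 8 and turns F into F* in the columns 2, 6. In the even rows these
alternatives and the sign of K² determine the table. If P is preserved and F transposed, then K T =
T* K; if P is flipped and F preserved, then F K carries Ker T to Ker T*. Both force Ind T = 0. In
the two other combinations K, respectively F* K, acts antilinearly on Ker T with square K². For K² =
-1 this is a quaternionic structure, so Ker T and likewise Ker T* have even dimension, which gives
2ℤ; for K² = 1 only ℤ remains. In the odd rows the same is applied to S and to Ŝ; the ℤ₂ entries
come from Ŝ.

Homotopy invariance is local. By `ContinuousLinearMap.IsFredholm.exists_schur`, a Lyapunov–Schmidt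
reduction, the kernel of A near T has the dimension of the kernel of a linear map s from Ker T to
Ker T*; hence the index is locally constant. For ℤ₂ there are two mechanisms, both resting on the
even rank of alternating forms. If K T = T* K and K² = -1, the form ⟨K m, s n⟩ on Ker T is
alternating. If P is flipped, F is preserved and K² = 1, then ran P and ran F*(1 - P)F are
Lagrangian for the real structure K, their intersection is Ker T, and the parity of the intersection
of a Fredholm pair of Lagrangians is locally constant (`eventually_finrank_inf_range_eq`).

For the entries 0 a path to an even-dimensional kernel is needed. The kernel shrinks as soon as the
derivative of T has a nonzero matrix element between Ker T and Ker T*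
(`ContinuousLinearMap.IsFredholm.eventually_finrank_ker_lt`). The paths are F W or W P W*, where W
is the Cayley transform of a skew-adjoint generator compatible with the symmetries. In the odd rows
either one operator already makes Ker T even-dimensional, or a multiple of S Ŝ is a generator. In
the even rows a finite-rank generator is built from a kernel vector x. It moves F if ⟨x,x⟩² +
⟨Sx,x⟩² ≠ 0, which is automatic for S² = 1; for (6,8) one has Σ² = 1 instead, and P is moved.

There remains (4,6), where S² = Σ² = -1. The obstruction is that Ker T lies in a single eigenspace
of S. A plane is then added, a kernel vector is rotated into it by a large angle, and a deformation
of P removes exactly one dimension (`exists_joinedIn_even_of_eigenvector`). -/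

namespace IndexPairing

noncomputable section

/-! ### Fredholm operators as the operators invertible modulo finite rank. -/

section FredholmOperators

variable {H : Type*} [NormedAddCommGroup H] [InnerProductSpace ℂ H]

/-- A bounded operator with finite-dimensional range. -/
def FinRange (A : H →L[ℂ] H) : Prop := (A : H →ₗ[ℂ] H).HasFiniteRange

theorem FinRange.add {A B : H →L[ℂ] H} (hA : FinRange A) (hB : FinRange B) : FinRange (A + B) :=
  LinearMap.HasFiniteRange.add hA hB

theorem FinRange.sub {A B : H →L[ℂ] H} (hA : FinRange A) (hB : FinRange B) : FinRange (A - B) :=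
  LinearMap.HasFiniteRange.sub hA hB

theorem FinRange.mul_left {A : H →L[ℂ] H} (hA : FinRange A) (B : H →L[ℂ] H) : FinRange (B * A) :=
  LinearMap.HasFiniteRange.comp_left hA (B : H →ₗ[ℂ] H)

theorem FinRange.mul_right {A : H →L[ℂ] H} (hA : FinRange A) (B : H →L[ℂ] H) : FinRange (A * B) :=
  LinearMap.HasFiniteRange.comp_right hA (B : H →ₗ[ℂ] H)

theorem FinRange.of_range_le {A : H →L[ℂ] H} {V : Submodule ℂ H} [FiniteDimensional ℂ V]
    (h : ∀ x, A x ∈ V) : FinRange A := by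
  have : (A : H →ₗ[ℂ] H).range ≤ V := by
    rintro _ ⟨x, rfl⟩
    exact h x
  have := Submodule.finiteDimensional_of_le this
  exact Module.Finite.iff_fg.mp this

theorem FinRange.finiteDimensional {A : H →L[ℂ] H} (hA : FinRange A) :
    FiniteDimensional ℂ (A : H →ₗ[ℂ] H).range :=
  Module.Finite.iff_fg.mpr hA

/-- With Q the orthogonal projection onto the range of `A`, the identity A = Q A gives A* = A* Q,
which factors through a finite-dimensional space. -/
theorem FinRange.adjoint [CompleteSpace H] {A : H →L[ℂ] H} (hA : FinRange A) :
    FinRange (star A) := by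
  have := hA.finiteDimensional
  set V := (A : H →ₗ[ℂ] H).range
  have h1 : V.starProjection * A = A := by
    ext x
    exact Submodule.starProjection_eq_self_iff.mpr ⟨x, rfl⟩
  have h2 : star A = star A * V.starProjection := by
    conv_lhs => rw [← h1, star_mul]
    rw [(isSelfAdjoint_starProjection V).star_eq]
  have h3 : FinRange V.starProjection :=
    FinRange.of_range_le (V := V) fun x => Submodule.starProjection_apply_mem V x
  rw [h2]
  exact h3.mul_left _

/-- Atkinson's criterion. It turns products, finite-rank perturbations, adjoints and conjugates into
algebra modulo the ideal of finite-rank operators. -/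
theorem isFredholm_iff_exists_finRange {T : H →L[ℂ] H} :
    T.IsFredholm ↔ ∃ G : H →L[ℂ] H, FinRange (G * T - 1) ∧ FinRange (T * G - 1) := by
  rw [ContinuousLinearMap.isFredholm_iff_exists_isQuasiInverse]
  refine exists_congr fun G => ?_
  rw [LinearMap.IsQuasiInverse, LinearMap.IsLeftQuasiInverse, LinearMap.IsRightQuasiInverse,
    LinearMap.FiniteRangeSetoid.equiv_iff_hasFiniteRange,
    LinearMap.FiniteRangeSetoid.equiv_iff_hasFiniteRange]
  rfl

theorem isFredholm_of_isUnit {T : H →L[ℂ] H} (h : IsUnit T) : T.IsFredholm := by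
  obtain ⟨u, rfl⟩ := h
  have h0 : FinRange (0 : H →L[ℂ] H) := LinearMap.HasFiniteRange.zero
  exact isFredholm_iff_exists_finRange.mpr ⟨↑u⁻¹, by simpa using h0, by simpa using h0⟩

theorem _root_.ContinuousLinearMap.IsFredholm.mul
    {T S : H →L[ℂ] H} (hT : T.IsFredholm) (hS : S.IsFredholm) :
    (T * S).IsFredholm := by
  obtain ⟨G, h1, h2⟩ := isFredholm_iff_exists_finRange.mp hT
  obtain ⟨K, h3, h4⟩ := isFredholm_iff_exists_finRange.mp hS
  refine isFredholm_iff_exists_finRange.mpr ⟨K * G, ?_, ?_⟩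
  · have : K * G * (T * S) - 1 = K * ((G * T - 1) * S) + (K * S - 1) := by noncomm_ring
    rw [this]
    exact ((h1.mul_right _).mul_left _).add h3
  · have : T * S * (K * G) - 1 = T * ((S * K - 1) * G) + (T * G - 1) := by noncomm_ring
    rw [this]
    exact ((h4.mul_right _).mul_left _).add h2

theorem _root_.ContinuousLinearMap.IsFredholm.add_finRange
    {T A : H →L[ℂ] H} (hT : T.IsFredholm) (hA : FinRange A) :
    (T + A).IsFredholm := by
  obtain ⟨G, h1, h2⟩ := isFredholm_iff_exists_finRange.mp hT
  refine isFredholm_iff_exists_finRange.mpr ⟨G, ?_, ?_⟩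
  · have : G * (T + A) - 1 = (G * T - 1) + G * A := by noncomm_ring
    rw [this]
    exact h1.add (hA.mul_left _)
  · have : (T + A) * G - 1 = (T * G - 1) + A * G := by noncomm_ring
    rw [this]
    exact h2.add (hA.mul_right _)

theorem _root_.ContinuousLinearMap.IsFredholm.adjoint [CompleteSpace H]
    {T : H →L[ℂ] H} (hT : T.IsFredholm) :
    (star T).IsFredholm := by
  obtain ⟨G, h1, h2⟩ := isFredholm_iff_exists_finRange.mp hT
  refine isFredholm_iff_exists_finRange.mpr ⟨star G, ?_, ?_⟩
  · simpa using h2.adjoint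
  · simpa using h1.adjoint

/-- If `G` inverts `T` modulo finite rank, then u = 1 + G(A - T) and v = 1 + (A - T)G are units for
`A` near `T`, and u⁻¹G = Gv⁻¹ inverts `A` modulo finite rank on both sides. -/
theorem _root_.ContinuousLinearMap.IsFredholm.isOpen [CompleteSpace H]
    : IsOpen {T : H →L[ℂ] H | T.IsFredholm} := by
  rw [isOpen_iff_mem_nhds]
  intro T hT
  obtain ⟨G, h1, h2⟩ := isFredholm_iff_exists_finRange.mp hT
  have hu : ∀ᶠ A in nhds T, IsUnit (1 + G * (A - T)) ∧ IsUnit (1 + (A - T) * G) := by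
    refine Filter.Eventually.and ?_ ?_
    · have hc : Continuous fun A : H →L[ℂ] H => 1 + G * (A - T) := by fun_prop
      exact hc.continuousAt.eventually (Units.isOpen.mem_nhds (by simp))
    · have hc : Continuous fun A : H →L[ℂ] H => 1 + (A - T) * G := by fun_prop
      exact hc.continuousAt.eventually (Units.isOpen.mem_nhds (by simp))
  filter_upwards [hu] with A ⟨hA, hA'⟩
  obtain ⟨u, hu⟩ := hA
  obtain ⟨v, hv⟩ := hA'
  have huv : (↑u⁻¹ : H →L[ℂ] H) * G = G * ↑v⁻¹ := by
    rw [Units.inv_mul_eq_iff_eq_mul, ← mul_assoc, Units.eq_mul_inv_iff_mul_eq, hu, hv]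
    noncomm_ring
  refine isFredholm_iff_exists_finRange.mpr ⟨↑u⁻¹ * G, ?_, ?_⟩
  · have : (↑u⁻¹ : H →L[ℂ] H) * G * A - 1 = ↑u⁻¹ * (G * T - 1) := by
      have h3 : (G * A : H →L[ℂ] H) = (u : H →L[ℂ] H) + (G * T - 1) := by
        rw [hu]
        noncomm_ring
      rw [mul_assoc, h3, mul_add, Units.inv_mul]
      noncomm_ring
    rw [this]
    exact h1.mul_left _
  · have : A * ((↑u⁻¹ : H →L[ℂ] H) * G) - 1 = (T * G - 1) * ↑v⁻¹ := by
      have h3 : (A * G : H →L[ℂ] H) = (v : H →L[ℂ] H) + (T * G - 1) := by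
        rw [hv]
        noncomm_ring
      rw [huv, ← mul_assoc, h3, add_mul, Units.mul_inv]
      noncomm_ring
    rw [this]
    exact h2.mul_right _

/-- `G` is the Moore–Penrose inverse of `T`, and `p`, `r` are the orthogonal projections onto the
kernel and the cokernel of `T`. -/
structure IsPseudoinverse [CompleteSpace H] (T G p r : H →L[ℂ] H) : Prop where
  proj_ker : IsStarProjection p
  proj_coker : IsStarProjection r
  mem_ker : ∀ x, T x = 0 ↔ p x = x
  mem_coker : ∀ x, star T x = 0 ↔ r x = x
  mul_left : G * T = 1 - p
  mul_right : T * G = 1 - r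
  mul_coker : G * r = 0
  ker_mul : p * G = 0

theorem IsPseudoinverse.adjoint [CompleteSpace H] {T G p r : H →L[ℂ] H}
    (h : IsPseudoinverse T G p r) : IsPseudoinverse (star T) (star G) r p where
  proj_ker := h.proj_coker
  proj_coker := h.proj_ker
  mem_ker := h.mem_coker
  mem_coker := by simpa using h.mem_ker
  mul_left := by
    have := congrArg star h.mul_right
    simpa [h.proj_coker.isSelfAdjoint.star_eq] using this
  mul_right := by
    have := congrArg star h.mul_left
    simpa [h.proj_ker.isSelfAdjoint.star_eq] using this
  mul_coker := by
    have := congrArg star h.ker_mul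
    simpa [h.proj_ker.isSelfAdjoint.star_eq] using this
  ker_mul := by
    have := congrArg star h.mul_coker
    simpa [h.proj_coker.isSelfAdjoint.star_eq] using this

/-- A quasi-inverse with T G₀ T = T is compressed to (1 - p) G₀ (1 - r). Closedness of the range
identifies the range of 1 - r with that of `T`. -/
theorem _root_.ContinuousLinearMap.IsFredholm.exists_pseudoinverse [CompleteSpace H]
    {T : H →L[ℂ] H} (hT : T.IsFredholm) :
    ∃ G p r : H →L[ℂ] H, IsPseudoinverse T G p r := by
  obtain ⟨pkg⟩ := hT.nonempty_fredholmPackage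
  have := hT.finite_ker
  have := hT.adjoint.finite_ker
  set G₀ := pkg.quasiInverse with hG₀
  have hTGT : T * G₀ * T = T := by
    ext x
    have hx : T x ∈ pkg.decCodom.X₁ := pkg.range_eq ▸ ⟨x, rfl⟩
    have h1 := congrArg (fun A : H →L[ℂ] H => A (G₀ (T x))) pkg.eq_equiv
    change T (G₀ (T x)) = _ at h1
    change T (G₀ (T x)) = T x
    rw [h1, hG₀, ContinuousLinearMap.FredholmPackage.quasiInverse]
    simp only [ContinuousLinearMap.comp_apply, Submodule.subtypeL_apply]
    have e1 : ∀ y : pkg.decDom.X₁, pkg.decDom.proj (y : H) = y := fun y => by simp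
    have e2 : ((pkg.decCodom.proj (T x) : pkg.decCodom.X₁) : H) = T x := by
      have : pkg.decCodom.proj (((⟨T x, hx⟩ : pkg.decCodom.X₁)) : H) = ⟨T x, hx⟩ :=
        Submodule.projectionOnto_apply_left _ _
      exact congrArg Subtype.val this
    rw [e1]
    simpa using e2
  set p := (T.ker).starProjection with hp
  set r := ((star T).ker).starProjection with hr
  have hTp : T * p = 0 := by
    ext x
    have : p x ∈ T.ker := Submodule.starProjection_apply_mem _ x
    exact this
  have hsr : star T * r = 0 := by
    ext x
    have : r x ∈ (star T).ker := Submodule.starProjection_apply_mem _ x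
    exact this
  have hpp : IsStarProjection p := isStarProjection_starProjection
  have hrr : IsStarProjection r := isStarProjection_starProjection
  have hrT : r * T = 0 := by
    have := congrArg star hsr
    simpa [hrr.isSelfAdjoint.star_eq] using this
  have hpT : (1 - p) * (G₀ * T) = 1 - p := by
    have : ∀ x, p ((G₀ * T) x - x) = (G₀ * T) x - x := fun x => by
      refine Submodule.starProjection_eq_self_iff.mpr ?_
      change T ((G₀ * T) x - x) = 0
      rw [map_sub, sub_eq_zero]
      exact congrArg (fun A : H →L[ℂ] H => A x) hTGT
    ext x
    have h := this x
    rw [map_sub] at h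
    change (G₀ * T) x - p ((G₀ * T) x) = x - p x
    rw [sub_eq_sub_iff_sub_eq_sub, ← h]
  have hrange : ∀ x, ∃ y, T y = x - r x := by
    intro x
    have h1 : x - r x ∈ ((star T).ker)ᗮ := Submodule.sub_starProjection_mem_orthogonal x
    have h2 : ((star T).ker)ᗮ = (T : H →ₗ[ℂ] H).range := by
      have h3 : ((T : H →ₗ[ℂ] H).range)ᗮ = (star T).ker := ContinuousLinearMap.orthogonal_range T
      rw [← h3, Submodule.orthogonal_orthogonal_eq_closure]
      exact hT.isClosed_range.submodule_topologicalClosure_eq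
    rw [h2] at h1
    exact h1
  have hTG : T * G₀ * (1 - r) = 1 - r := by
    ext x
    obtain ⟨y, hy⟩ := hrange x
    change T (G₀ (x - r x)) = x - r x
    rw [← hy]
    exact congrArg (fun A : H →L[ℂ] H => A y) hTGT
  refine ⟨(1 - p) * G₀ * (1 - r), p, r, hpp, hrr,
    fun x => (Submodule.starProjection_eq_self_iff (K := T.ker)).symm,
    fun x => (Submodule.starProjection_eq_self_iff (K := (star T).ker)).symm, ?_, ?_, ?_, ?_⟩
  · calc (1 - p) * G₀ * (1 - r) * T = (1 - p) * (G₀ * T) - (1 - p) * G₀ * (r * T) := by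
          noncomm_ring
      _ = 1 - p := by rw [hrT, hpT, mul_zero, sub_zero]
  · calc T * ((1 - p) * G₀ * (1 - r)) = T * G₀ * (1 - r) - (T * p) * G₀ * (1 - r) := by
          noncomm_ring
      _ = 1 - r := by rw [hTp, hTG]; simp
  · rw [mul_assoc _ (1 - r) r, sub_mul 1 r r, one_mul, hrr.isIdempotentElem.eq, sub_self, mul_zero]
  · rw [← mul_assoc, ← mul_assoc, mul_sub p 1 p, mul_one, hpp.isIdempotentElem.eq, sub_self,
      zero_mul, zero_mul]

end FredholmOperators

/-! ### Lyapunov–Schmidt reduction near a Fredholm operator. -/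

section Perturbation

variable {H : Type*} [NormedAddCommGroup H] [InnerProductSpace ℂ H] [CompleteSpace H]

theorem IsPseudoinverse.mul_ker {T G p r : H →L[ℂ] H} (h : IsPseudoinverse T G p r) :
    T * p = 0 := by
  ext x
  refine (h.mem_ker _).mpr ?_
  exact congrArg (fun A : H →L[ℂ] H => A x) h.proj_ker.isIdempotentElem.eq

/-- If `B` inverts `1 + G D`, then `T + D` maps `B n` into the cokernel of `T` for every `n` in the
kernel of `T`. -/
theorem IsPseudoinverse.perturb_apply {T G p r D B : H →L[ℂ] H} (h : IsPseudoinverse T G p r)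
    (hB' : (1 + G * D) * B = 1) {n : H} (hn : T n = 0) :
    p (B n) = n ∧ (T + D) (B n) = r (D (B n)) := by
  have e1 : ∀ y, G (T y) = y - p y := fun y => congrArg (fun A : H →L[ℂ] H => A y) h.mul_left
  have e2 : ∀ y, T (G y) = y - r y := fun y => congrArg (fun A : H →L[ℂ] H => A y) h.mul_right
  have e4 : ∀ y, p (G y) = 0 := fun y => congrArg (fun A : H →L[ℂ] H => A y) h.ker_mul
  have e5 : B n + G (D (B n)) = n := congrArg (fun A : H →L[ℂ] H => A n) hB'
  have e6 : B n = n - G (D (B n)) := eq_sub_of_add_eq e5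
  constructor
  · rw [e6, map_sub, e4, sub_zero, (h.mem_ker n).mp hn]
  · have e7 : T (B n) = -(D (B n) - r (D (B n))) := by
      conv_lhs => rw [e6]
      rw [map_sub, hn, e2, zero_sub]
    change T (B n) + D (B n) = _
    rw [e7]
    abel

/-- Applying `G` to (T + D)x = 0 gives (1 + GD)x = p x. -/
theorem IsPseudoinverse.perturb_ker {T G p r D B : H →L[ℂ] H} (h : IsPseudoinverse T G p r)
    (hB : B * (1 + G * D) = 1) {x : H} (hx : (T + D) x = 0) : x = B (p x) := by
  have e1 : ∀ y, G (T y) = y - p y := fun y => congrArg (fun A : H →L[ℂ] H => A y) h.mul_left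
  have e4 : ∀ y, B (y + G (D y)) = y := fun y => congrArg (fun A : H →L[ℂ] H => A y) hB
  have hx : T x + D x = 0 := hx
  have h1 : p x = x + G (D x) := by
    have := congrArg G hx
    rw [map_add, e1, map_zero, sub_add_eq_add_sub, sub_eq_zero] at this
    exact this.symm
  rw [h1, e4]

/-- The Schur complement of `T + D` as a map from the kernel to the cokernel of `T`. -/
def IsPseudoinverse.schur {T G p r : H →L[ℂ] H} (h : IsPseudoinverse T G p r) (D B : H →L[ℂ] H) :
    T.ker →ₗ[ℂ] (star T).ker :=
  LinearMap.codRestrict (star T).ker ((r * D * B : H →L[ℂ] H).toLinearMap ∘ₗ T.ker.subtype)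
    fun n => by
      refine (h.mem_coker _).mpr ?_
      exact congrArg (fun A : H →L[ℂ] H => A (D (B n))) h.proj_coker.isIdempotentElem.eq

theorem IsPseudoinverse.schur_apply {T G p r : H →L[ℂ] H} (h : IsPseudoinverse T G p r)
    (D B : H →L[ℂ] H) (n : T.ker) : (h.schur D B n : H) = r (D (B n)) := rfl

/-- `B` maps the kernel of the Schur complement bijectively onto that of `T + D`; the inverse is
`p`. -/
theorem IsPseudoinverse.finrank_ker_perturb {T G p r D B : H →L[ℂ] H}
    (h : IsPseudoinverse T G p r) (hB : B * (1 + G * D) = 1) (hB' : (1 + G * D) * B = 1) :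
    finrank ℂ (T + D).ker = finrank ℂ (h.schur D B).ker := by
  let f : (h.schur D B).ker →ₗ[ℂ] (T + D).ker :=
    LinearMap.codRestrict _ ((B : H →ₗ[ℂ] H) ∘ₗ T.ker.subtype ∘ₗ Submodule.subtype _) fun n => by
      change (T + D) (B n.1.1) = 0
      rw [(h.perturb_apply hB' n.1.2).2]
      exact congrArg Subtype.val n.2
  have hf : Function.Bijective f := by
    constructor
    · intro n m hnm
      have : B n.1.1 = B m.1.1 := congrArg Subtype.val hnm
      have h1 := (h.perturb_apply hB' n.1.2).1
      have h2 := (h.perturb_apply hB' m.1.2).1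
      rw [this, h2] at h1
      exact Subtype.ext (Subtype.ext h1.symm)
    · rintro ⟨x, hx⟩
      have hx' : x = B (p x) := h.perturb_ker hB hx
      have hp : T (p x) = 0 := congrArg (fun A : H →L[ℂ] H => A x) h.mul_ker
      refine ⟨⟨⟨p x, hp⟩, ?_⟩, Subtype.ext hx'.symm⟩
      refine Subtype.ext ?_
      rw [h.schur_apply, ← (h.perturb_apply hB' hp).2]
      change (T + D) (B (p x)) = 0
      rw [← hx']
      exact hx
  exact (LinearEquiv.ofBijective f hf).finrank_eq.symm

/-- The Schur complement of the adjoint problem is the adjoint of the Schur complement, so one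
finite matrix controls both kernel and cokernel. -/
theorem IsPseudoinverse.adjoint_schur {T G p r D B : H →L[ℂ] H} [FiniteDimensional ℂ T.ker]
    [FiniteDimensional ℂ (star T).ker] (h : IsPseudoinverse T G p r)
    (hB : B * (1 + G * D) = 1) (hB' : (1 + G * D) * B = 1) :
    finrank ℂ (star (T + D)).ker = finrank ℂ (LinearMap.adjoint (h.schur D B)).ker := by
  -- This is the inverse of 1 + DG, obtained from that of 1 + GD; it satisfies B₁D = DB.
  set B₁ : H →L[ℂ] H := 1 - D * B * G with hB₁
  have h1 : B₁ * (1 + D * G) = 1 := by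
    have : B₁ * (1 + D * G) = 1 + D * G - D * (B * (1 + G * D)) * G := by
      rw [hB₁]; noncomm_ring
    rw [this, hB, mul_one]
    abel
  have h2 : (1 + D * G) * B₁ = 1 := by
    have : (1 + D * G) * B₁ = 1 + D * G - D * ((1 + G * D) * B) * G := by
      rw [hB₁]; noncomm_ring
    rw [this, hB', mul_one]
    abel
  have h3 : B₁ * D = D * B := by
    have : B₁ * D = D * (B * (1 + G * D)) - D * (B * (G * D)) + (D - D * B) - (D - D * B)
      + (D - D * (B * (1 + G * D))) := by
      rw [hB₁]; noncomm_ring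
    have h4 : B * (G * D) = 1 - B := by
      rw [mul_add, mul_one] at hB
      exact eq_sub_of_add_eq' hB
    rw [this, hB, h4]
    noncomm_ring
  have h4 : star B₁ * (1 + star G * star D) = 1 := by
    have := congrArg star h2
    simpa using this
  have h5 : (1 + star G * star D) * star B₁ = 1 := by
    have := congrArg star h1
    simpa using this
  rw [star_add, h.adjoint.finrank_ker_perturb h4 h5]
  have key : ∀ (m : (star T).ker) (n : T.ker),
      inner ℂ (p (star D (star B₁ (m : H)))) (n : H) = inner ℂ (m : H) (r (D (B (n : H)))) := by
    intro m n
    have e1 : ∀ (A : H →L[ℂ] H) (x y : H), inner ℂ (star A x) y = inner ℂ x (A y) :=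
      fun A x y => ContinuousLinearMap.adjoint_inner_left A y x
    have e2 : ∀ x y, inner ℂ (p x) y = inner ℂ x (p y) := fun x y => by
      rw [← e1 p, h.proj_ker.isSelfAdjoint.star_eq]
    have e3 : ∀ x y, inner ℂ (r x) y = inner ℂ x (r y) := fun x y => by
      rw [← e1 r, h.proj_coker.isSelfAdjoint.star_eq]
    have e4 : B₁ (D n) = D (B n) := congrArg (fun A : H →L[ℂ] H => A n) h3
    rw [e2, (h.mem_ker n).mp n.2, e1, e1, e4, ← e3, (h.mem_coker m).mp m.2]
  have hk : ∀ m : (star T).ker, p (star D (star B₁ (m : H))) = 0 ↔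
      LinearMap.adjoint (h.schur D B) m = 0 := by
    intro m
    have e6 : ∀ n : T.ker, inner ℂ (LinearMap.adjoint (h.schur D B) m) n =
        inner ℂ (p (star D (star B₁ (m : H)))) (n : H) := by
      intro n
      rw [LinearMap.adjoint_inner_left, key]
      rfl
    constructor
    · intro h0
      refine ext_inner_right ℂ fun n => ?_
      rw [e6, h0, inner_zero_left, inner_zero_left]
    · intro h0
      have hp : T (p (star D (star B₁ (m : H)))) = 0 :=
        congrArg (fun A : H →L[ℂ] H => A (star D (star B₁ (m : H)))) h.mul_ker
      have := e6 ⟨_, hp⟩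
      rw [h0, inner_zero_left] at this
      exact inner_self_eq_zero.mp this.symm
  let f : (h.adjoint.schur (star D) (star B₁)).ker →ₗ[ℂ]
      (LinearMap.adjoint (h.schur D B)).ker :=
    LinearMap.codRestrict _ (Submodule.subtype _) fun m =>
      (hk m.1).mp (congrArg Subtype.val m.2)
  refine (LinearEquiv.ofBijective f ⟨fun a b hab => ?_, fun m => ?_⟩).finrank_eq
  · have h9 : (f a).1 = (f b).1 := by rw [hab]
    exact Subtype.ext h9
  · exact ⟨⟨m.1, Subtype.ext ((hk m.1).mpr m.2)⟩, rfl⟩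

theorem tendsto_inverse_one_add (G T : H →L[ℂ] H) :
    Filter.Tendsto (fun A : H →L[ℂ] H => Ring.inverse (1 + G * (A - T))) (nhds T) (nhds 1) := by
  have h1 : ContinuousAt (fun A : H →L[ℂ] H => 1 + G * (A - T)) T := by fun_prop
  have h2 := NormedRing.inverse_continuousAt (1 : (H →L[ℂ] H)ˣ)
  have h3 : (((1 : (H →L[ℂ] H)ˣ) : H →L[ℂ] H)) = 1 + G * (T - T) := by simp
  rw [h3] at h2
  have h4 := ContinuousAt.comp (f := fun A : H →L[ℂ] H => 1 + G * (A - T)) h2 h1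
  have h5 := h4.tendsto
  simpa [Function.comp_def] using h5

/-- Structure of the kernels of operators close to a Fredholm operator. -/
theorem _root_.ContinuousLinearMap.IsFredholm.exists_schur
    {T : H →L[ℂ] H} (hT : T.IsFredholm) :
    ∃ q : (H →L[ℂ] H) → (H →L[ℂ] H), Filter.Tendsto q (nhds T) (nhds 1) ∧
    ∀ᶠ A in nhds T, ∃ s : T.ker →ₗ[ℂ] (star T).ker,
      (∀ n : T.ker, A (q A n) = (s n : H)) ∧
      (∀ n m : T.ker, inner ℂ (m : H) (q A n) = inner ℂ (m : H) (n : H)) ∧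
      finrank ℂ A.ker = finrank ℂ s.ker ∧
      (finrank ℂ A.ker : ℤ) - finrank ℂ (star A).ker =
        finrank ℂ T.ker - finrank ℂ (star T).ker := by
  have hk := hT.finite_ker
  have hk' := hT.adjoint.finite_ker
  obtain ⟨G, p, r, h⟩ := hT.exists_pseudoinverse
  refine ⟨fun A => Ring.inverse (1 + G * (A - T)), tendsto_inverse_one_add G T, ?_⟩
  have hu : ∀ᶠ A in nhds T, IsUnit (1 + G * (A - T)) := by
    have hc : Continuous fun A : H →L[ℂ] H => 1 + G * (A - T) := by fun_prop
    exact hc.continuousAt.eventually (Units.isOpen.mem_nhds (by simp))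
  filter_upwards [hu] with A hA
  have hB := Ring.inverse_mul_cancel _ hA
  have hB' := Ring.mul_inverse_cancel _ hA
  set B := Ring.inverse (1 + G * (A - T))
  have hTA : A = T + (A - T) := by abel
  have h1 : finrank ℂ A.ker = finrank ℂ (h.schur (A - T) B).ker := by
    conv_lhs => rw [hTA]
    exact h.finrank_ker_perturb hB hB'
  have h2 : finrank ℂ (star A).ker = finrank ℂ (LinearMap.adjoint (h.schur (A - T) B)).ker := by
    conv_lhs => rw [hTA]
    exact h.adjoint_schur hB hB'
  refine ⟨h.schur (A - T) B, fun n => ?_, fun n m => ?_, h1, ?_⟩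
  · rw [h.schur_apply, ← (h.perturb_apply hB' n.2).2, ← hTA]
  · have h3 := (h.perturb_apply hB' n.2).1
    conv_rhs => rw [← h3]
    have e1 : ∀ (A : H →L[ℂ] H) (x y : H), inner ℂ (star A x) y = inner ℂ x (A y) :=
      fun A x y => ContinuousLinearMap.adjoint_inner_left A y x
    rw [← e1 p, h.proj_ker.isSelfAdjoint.star_eq, (h.mem_ker m).mp m.2]
  · rw [h1, h2]
    -- A map between finite-dimensional spaces and its adjoint have equal rank, so the difference of
    -- their nullities depends only on the two spaces.
    have h3 := LinearMap.finrank_range_add_finrank_ker (h.schur (A - T) B)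
    have h4 := LinearMap.finrank_range_add_finrank_ker (LinearMap.adjoint (h.schur (A - T) B))
    have h5 := LinearMap.finrank_range_adjoint (h.schur (A - T) B)
    omega

theorem _root_.ContinuousLinearMap.IsFredholm.eventually_index_eq
    {T : H →L[ℂ] H} (hT : T.IsFredholm) :
    ∀ᶠ A in nhds T, noetherIndex A = noetherIndex T := by
  obtain ⟨q, -, hq⟩ := hT.exists_schur
  filter_upwards [hq] with A ⟨_, _, _, _, h⟩
  exact h

/-- The kernel dimension drops strictly along a perturbation which, to first order, does not
vanish between the kernel and the cokernel. -/
theorem _root_.ContinuousLinearMap.IsFredholm.eventually_finrank_ker_lt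
    {T : H →L[ℂ] H} (hT : T.IsFredholm)
    {E : ℝ → H →L[ℂ] H} (hE : ContinuousAt E 0) {x y : H} (hx : T x = 0) (hy : star T y = 0)
    (hxy : inner ℂ y (E 0 x) ≠ 0) :
    ∀ᶠ t : ℝ in nhds 0, t ≠ 0 → finrank ℂ (T + (t : ℂ) • E t).ker < finrank ℂ T.ker := by
  have hk := hT.finite_ker
  obtain ⟨q, hq1, hq⟩ := hT.exists_schur
  have hc : Filter.Tendsto (fun t : ℝ => T + (t : ℂ) • E t) (nhds 0) (nhds T) := by
    have : ContinuousAt (fun t : ℝ => T + (t : ℂ) • E t) 0 := by fun_prop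
    simpa using this.tendsto
  have happ : ∀ {A : ℝ → H →L[ℂ] H} {v : ℝ → H} {A₀ : H →L[ℂ] H} {v₀ : H},
      Filter.Tendsto A (nhds 0) (nhds A₀) → Filter.Tendsto v (nhds 0) (nhds v₀) →
      Filter.Tendsto (fun t => A t (v t)) (nhds 0) (nhds (A₀ v₀)) := fun {_ _ A₀ v₀} hA hv =>
    (isBoundedBilinearMap_apply.continuous.tendsto (A₀, v₀)).comp (hA.prodMk_nhds hv)
  have h2 : Filter.Tendsto (fun t : ℝ => inner ℂ y (E t (q (T + (t : ℂ) • E t) x))) (nhds 0)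
      (nhds (inner ℂ y (E 0 x))) := by
    have h3 : Filter.Tendsto (fun t : ℝ => E t (q (T + (t : ℂ) • E t) x)) (nhds 0)
        (nhds (E 0 ((1 : H →L[ℂ] H) x))) := by
      have h4 : Filter.Tendsto (fun t : ℝ => q (T + (t : ℂ) • E t) x) (nhds 0)
          (nhds ((1 : H →L[ℂ] H) x)) := happ (hq1.comp hc) tendsto_const_nhds
      exact happ hE h4
    exact Filter.Tendsto.inner tendsto_const_nhds h3
  filter_upwards [hc.eventually hq, h2.eventually_ne hxy] with t ⟨s, hs, _, hf, _⟩ hne ht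
  rw [hf]
  -- The vector y is orthogonal to the range of T, so its product with (T + tE)q x is t⟨y, E q x⟩,
  -- and the second factor is near ⟨y, E 0 x⟩ ≠ 0.
  have hs0 : s ⟨x, hx⟩ ≠ 0 := by
    intro h0
    apply hne
    have h3 := hs ⟨x, hx⟩
    rw [h0] at h3
    have h4 : inner ℂ y ((T + (t : ℂ) • E t) (q (T + (t : ℂ) • E t) x)) = 0 := by
      rw [h3]
      exact inner_zero_right _
    have h5 : inner ℂ y (T (q (T + (t : ℂ) • E t) x)) = 0 := by
      rw [← ContinuousLinearMap.adjoint_inner_left]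
      change inner ℂ (star T y) _ = 0
      rw [hy, inner_zero_left]
    change inner ℂ y (T _ + (t : ℂ) • (E t) _) = 0 at h4
    rw [inner_add_right, h5, zero_add, inner_smul_right] at h4
    exact (mul_eq_zero.mp h4).resolve_left (by exact_mod_cast ht)
  refine Submodule.finrank_lt ?_
  intro htop
  exact hs0 (LinearMap.mem_ker.mp (htop ▸ Submodule.mem_top))

end Perturbation

/-! ### Antilinear structures, alternating forms and the parity of kernels. -/

section ParityOfKernels

variable {H : Type*} [NormedAddCommGroup H] [InnerProductSpace ℂ H]

/-- Polarization gives the real parts; replacing y by iy gives the imaginary parts, with the sign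
change caused by antilinearity. -/
theorem inner_antilinear (J : H →ₛₗᵢ[starRingEnd ℂ] H) (x y : H) :
    inner ℂ (J x) (J y) = inner ℂ y x := by
  have hre : ∀ x y, (inner ℂ (J x) (J y)).re = (inner ℂ x y).re := fun x y => by
    have h1 := re_inner_eq_norm_add_mul_self_sub_norm_mul_self_sub_norm_mul_self_div_two
      (𝕜 := ℂ) (J x) (J y)
    have h2 := re_inner_eq_norm_add_mul_self_sub_norm_mul_self_sub_norm_mul_self_div_two
      (𝕜 := ℂ) x y
    rw [← map_add, J.norm_map, J.norm_map, J.norm_map] at h1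
    exact h1.trans h2.symm
  rw [← inner_conj_symm]
  refine Complex.ext ?_ ?_
  · rw [Complex.conj_re, hre y x]
  · have h := hre x (Complex.I • y)
    rw [map_smulₛₗ, inner_smul_right, inner_smul_right] at h
    simp only [Complex.conj_I, Complex.mul_re, Complex.neg_re, Complex.neg_im, Complex.I_re,
      Complex.I_im] at h
    have h1 : (inner ℂ (J y) (J x)).im = -(inner ℂ (J x) (J y)).im := by
      rw [← inner_conj_symm, Complex.conj_im]
    have h2 : (inner ℂ y x).im = -(inner ℂ x y).im := by
      rw [← inner_conj_symm, Complex.conj_im]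
    rw [Complex.conj_im, h1, h2]
    linarith

theorem finrank_le_of_antilinear {N M : Submodule ℂ H} [FiniteDimensional ℂ M] (j : H → H)
    (hadd : ∀ x y, j (x + y) = j x + j y)
    (hsmul : ∀ (c : ℂ) x, j (c • x) = starRingEnd ℂ c • j x)
    (hmaps : ∀ x ∈ N, j x ∈ M) (hinj : ∀ x ∈ N, j x = 0 → x = 0) :
    finrank ℂ N ≤ finrank ℂ M := by
  let f : N →+ M := AddMonoidHom.mk' (fun x => ⟨j x, hmaps x x.2⟩)
    fun x y => Subtype.ext (hadd x y)
  have hf : Function.Injective f := by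
    rw [injective_iff_map_eq_zero]
    intro x hx
    exact Subtype.ext (hinj x x.2 (congrArg Subtype.val hx))
  have h := rank_le_of_surjective_injective (R := ℂ) (R' := ℂ) (starRingEnd ℂ) f
    (fun z => ⟨starRingEnd ℂ z, Complex.conj_conj z⟩) hf fun r m => Subtype.ext (hsmul r m)
  exact Cardinal.toNat_le_toNat h (rank_lt_aleph0 ℂ M)

/-- A finite-dimensional complex space with an antilinear map of square `-1` has even dimension. -/
theorem even_finrank_of_quaternionic {N : Submodule ℂ H} [FiniteDimensional ℂ N] (j : H → H)
    (hadd : ∀ x y, j (x + y) = j x + j y)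
    (hsmul : ∀ (c : ℂ) x, j (c • x) = starRingEnd ℂ c • j x)
    (hmaps : ∀ x ∈ N, j x ∈ N) (hsq : ∀ x ∈ N, j (j x) = -x) :
    Even (finrank ℂ N) := by
  let f : N →ₛₗ[starRingEnd ℂ] N :=
    { toFun := fun x => ⟨j x, hmaps x x.2⟩
      map_add' := fun x y => Subtype.ext (hadd x y)
      map_smul' := fun c x => Subtype.ext (hsmul c x) }
  have hff : ∀ x, f (f x) = -x := fun x => Subtype.ext (hsq x x.2)
  let b := finBasis ℂ N
  let A : Matrix (Fin (finrank ℂ N)) (Fin (finrank ℂ N)) ℂ := fun i k => b.repr (f (b k)) i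
  -- In a basis, j² = -1 becomes A Ā = -1. Taking determinants, |det A|² = (-1)^dim, which rules out
  -- odd dimension.
  have hA : A * A.map (starRingEnd ℂ) = -1 := by
    ext i k
    have h1 : f (f (b k)) = ∑ l, starRingEnd ℂ (A l k) • f (b l) := by
      conv_lhs => rw [← b.sum_repr (f (b k)), map_sum]
      simp only [map_smulₛₗ, A]
    have h2 := congrArg (fun v => b.repr v i) h1
    simp only [hff, map_neg, map_sum, map_smul, Finsupp.coe_neg, Pi.neg_apply, Basis.repr_self,
      Finsupp.coe_finsetSum, Finset.sum_apply, Finsupp.smul_apply, smul_eq_mul] at h2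
    rw [Matrix.mul_apply, Matrix.neg_apply, Matrix.one_apply]
    rw [Finsupp.single_apply] at h2
    simp only [eq_comm (a := k)] at h2
    rw [h2]
    refine Finset.sum_congr rfl fun l _ => ?_
    rw [Matrix.map_apply, mul_comm]
  have hdet := congrArg Matrix.det hA
  rw [Matrix.det_mul, Matrix.det_neg, Matrix.det_one, mul_one, Fintype.card_fin] at hdet
  have h3 : (A.map (starRingEnd ℂ)).det = starRingEnd ℂ A.det :=
    (RingHom.map_det (starRingEnd ℂ) A).symm
  rw [h3, Complex.mul_conj] at hdet
  by_contra hodd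
  rw [Nat.not_even_iff_odd] at hodd
  rw [hodd.neg_one_pow] at hdet
  have h4 : Complex.normSq A.det = -1 := by exact_mod_cast hdet
  linarith [Complex.normSq_nonneg A.det]

/-- The rank of an alternating bilinear form is even. -/
theorem finrank_eq_finrank_ker_of_isAlt {V : Type*} [AddCommGroup V] [Module ℂ V]
    [FiniteDimensional ℂ V] (ω : V →ₗ[ℂ] V →ₗ[ℂ] ℂ) (hω : ∀ x, ω x x = 0) :
    (finrank ℂ V : ZMod 2) = (finrank ℂ ω.ker : ZMod 2) := by
  -- The form is nondegenerate on a complement of its radical, and a skew matrix of odd size is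
  -- singular.
  obtain ⟨W, hW⟩ := Submodule.exists_isCompl ω.ker
  have hskew : ∀ x y, ω x y = -ω y x := fun x y => by
    have := hω (x + y)
    simp only [map_add, LinearMap.add_apply, hω, zero_add, add_zero] at this
    linear_combination this
  have hdim := Submodule.finrank_add_eq_of_isCompl hW
  suffices Even (finrank ℂ W) by
    rw [← hdim]
    push_cast
    rw [(ZMod.natCast_eq_zero_iff_even).mpr this, add_zero]
  let b := finBasis ℂ W
  let A : Matrix (Fin (finrank ℂ W)) (Fin (finrank ℂ W)) ℂ := fun i k => ω (b i) (b k)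
  have hdet : A.det ≠ 0 := by
    intro h0
    obtain ⟨v, hv, hAv⟩ := Matrix.exists_mulVec_eq_zero_iff.mpr h0
    set w : W := ∑ i, v i • b i with hw
    have h1 : ∀ i, ω (b i) (w : V) = 0 := fun i => by
      have := congrFun hAv i
      rw [Matrix.mulVec, dotProduct] at this
      rw [hw]
      simp only [Submodule.coe_sum, Submodule.coe_smul, map_sum, map_smul, smul_eq_mul]
      refine Eq.trans ?_ this
      exact Finset.sum_congr rfl fun k _ => mul_comm _ _
    have h2 : ∀ u : W, ω (w : V) (u : V) = 0 := fun u => by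
      rw [hskew, ← b.sum_repr u]
      simp only [Submodule.coe_sum, Submodule.coe_smul, map_sum, map_smul, LinearMap.sum_apply,
        LinearMap.smul_apply, h1, smul_zero, Finset.sum_const_zero, neg_zero]
    have h3 : (w : V) ∈ ω.ker := by
      refine LinearMap.mem_ker.mpr (LinearMap.ext fun y => ?_)
      obtain ⟨k, hk, u, hu, rfl⟩ := Submodule.mem_sup.mp 
        (hW.sup_eq_top ▸ Submodule.mem_top : y ∈ ω.ker ⊔ W)
      rw [map_add, h2 ⟨u, hu⟩, hskew, LinearMap.mem_ker.mp hk]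
      simp
    have h4 : (w : V) = 0 := by
      have := hW.inf_eq_bot ▸ (Submodule.mem_inf.mpr ⟨h3, w.2⟩)
      simpa using this
    have h5 : w = 0 := Subtype.ext h4
    apply hv
    funext i
    exact Fintype.linearIndependent_iff.mp b.linearIndependent v (hw ▸ h5) i
  have hT : A.transpose = -A := by
    ext i k
    exact hskew _ _
  by_contra hodd
  rw [Nat.not_even_iff_odd] at hodd
  have h6 := congrArg Matrix.det hT
  rw [Matrix.det_transpose, Matrix.det_neg, Fintype.card_fin, hodd.neg_one_pow] at h6
  exact hdet (self_eq_neg.mp (by linear_combination h6))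

variable [CompleteSpace H]

theorem inner_star_left (A : H →L[ℂ] H) (x y : H) :
    inner ℂ (star A x) y = inner ℂ x (A y) :=
  ContinuousLinearMap.adjoint_inner_left A y x

theorem inner_star_right (A : H →L[ℂ] H) (x y : H) :
    inner ℂ x (star A y) = inner ℂ (A x) y :=
  ContinuousLinearMap.adjoint_inner_right A x y

/-- The parity of the kernel dimension of odd symmetric Fredholm operators is locally constant. -/
theorem eventually_index2_eq_of_oddSymmetric {T : H →L[ℂ] H} (hT : T.IsFredholm)
    (J : H →ₛₗᵢ[starRingEnd ℂ] H) (hJ : ∀ x, J (J x) = -x)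
    (hJT : ∀ x, J (T x) = star T (J x)) :
    ∀ᶠ A : H →L[ℂ] H in nhds T, (∀ x, J (A x) = star A (J x)) → index2 A = index2 T := by
  have hk := hT.finite_ker
  obtain ⟨q, -, hq⟩ := hT.exists_schur
  have hJc : ∀ x y, inner ℂ (J x) y = -inner ℂ (J y) x := fun x y => by
    rw [← inner_antilinear J y (J x), hJ, inner_neg_right]
  have hJ' : ∀ y, star T y = 0 → T (J y) = 0 := fun y hy => by
    have h1 : J (T (J y)) = 0 := by rw [hJT, hJ, map_neg, hy, neg_zero]
    exact J.injective (h1.trans J.map_zero.symm)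
  filter_upwards [hq] with A ⟨s, hs, hsq, hf, _⟩ hJA
  -- JA = A*J together with J² = -1 makes this number equal to its own negative.
  have halt : ∀ x, inner ℂ (J x) (A x) = 0 := fun x => by
    have h1 : inner ℂ (J x) (A x) = inner ℂ (J (A x)) x := by
      rw [hJA, inner_star_left]
    exact self_eq_neg.mp (h1.trans (by rw [hJc (A x) x]))
  let ω : T.ker →ₗ[ℂ] T.ker →ₗ[ℂ] ℂ := LinearMap.mk₂ ℂ
    (fun n m => inner ℂ (J (m : H)) (s n : H))
    (fun a b m => by rw [map_add]; exact inner_add_right _ _ _)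
    (fun c a m => by rw [map_smul]; exact inner_smul_right _ _ _)
    (fun a m m' => by
      rw [Submodule.coe_add, map_add]
      exact inner_add_left _ _ _)
    (fun c a m => by
      rw [Submodule.coe_smul, map_smulₛₗ, inner_smul_left, Complex.conj_conj]
      rfl)
  -- Since J(s n) lies in Ker T and q n - n is orthogonal to Ker T, the vector n may be replaced by
  -- q n; then s n = A(q n) reduces the claim to `halt`.
  have hω : ∀ n, ω n n = 0 := fun n => by
    change inner ℂ (J (n : H)) (s n : H) = 0
    have h1 : inner ℂ (J (n : H)) (s n : H) = inner ℂ (J (q A n)) (s n : H) := by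
      rw [hJc, hJc (q A n)]
      have := hsq n ⟨J (s n), hJ' _ (s n).2⟩
      exact congrArg Neg.neg this.symm
    rw [h1, ← hs, halt]
  -- `J` carries Ker T* into Ker T, so J(s n) is an admissible test vector and recovers the norm of
  -- s n.
  have hker : ω.ker = s.ker := by
    ext n
    constructor
    · intro hn
      have h1 : ω n ⟨J (s n), hJ' _ (s n).2⟩ = 0 := by rw [LinearMap.mem_ker.mp hn]; rfl
      change inner ℂ (J (J (s n : H))) (s n : H) = 0 at h1
      rw [hJ, inner_neg_left, neg_eq_zero, inner_self_eq_zero] at h1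
      exact LinearMap.mem_ker.mpr (Subtype.ext h1)
    · intro hn
      refine LinearMap.mem_ker.mpr (LinearMap.ext fun m => ?_)
      change inner ℂ (J (m : H)) (s n : H) = 0
      rw [LinearMap.mem_ker.mp hn]
      exact inner_zero_right _
  rw [index2, index2, hf, ← hker, finrank_eq_finrank_ker_of_isAlt ω hω]

end ParityOfKernels

/-! ### Complex conjugations and Lagrangian projections. -/

section Conjugations

variable {H : Type*} [NormedAddCommGroup H] [InnerProductSpace ℂ H]

theorem Conjugation.bar_apply (J : Conjugation H) (A : H →L[ℂ] H) (x : H) :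
    J.bar A x = J.toIsometry (A (J.toIsometry x)) := rfl

theorem Conjugation.bar_add (J : Conjugation H) (A B : H →L[ℂ] H) :
    J.bar (A + B) = J.bar A + J.bar B := by
  ext x
  exact map_add J.toIsometry _ _

theorem Conjugation.bar_sub (J : Conjugation H) (A B : H →L[ℂ] H) :
    J.bar (A - B) = J.bar A - J.bar B := by
  ext x
  exact map_sub J.toIsometry _ _

theorem Conjugation.bar_mul (J : Conjugation H) (A B : H →L[ℂ] H) :
    J.bar (A * B) = J.bar A * J.bar B := by
  ext x
  change J.toIsometry (A (B _)) = J.toIsometry (A (J.toIsometry (J.toIsometry (B _))))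
  rw [J.involutive]

theorem Conjugation.bar_one (J : Conjugation H) : J.bar 1 = 1 := by
  ext x
  exact J.involutive x

theorem Conjugation.bar_bar (J : Conjugation H) (A : H →L[ℂ] H) : J.bar (J.bar A) = A := by
  ext x
  change J.toIsometry (J.toIsometry (A (J.toIsometry (J.toIsometry x)))) = A x
  rw [J.involutive, J.involutive]

theorem Conjugation.inner_left (J : Conjugation H) (x y : H) :
    inner ℂ (J.toIsometry x) y = inner ℂ (J.toIsometry y) x := by
  conv_lhs => rw [← J.involutive y]
  rw [inner_antilinear]

theorem Conjugation.bar_star [CompleteSpace H] (J : Conjugation H) (A : H →L[ℂ] H) :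
    J.bar (star A) = star (J.bar A) := by
  ext x
  refine ext_inner_left ℂ fun y => ?_
  rw [inner_star_right, J.bar_apply, J.bar_apply, J.inner_left, ← inner_star_left,
    ← inner_antilinear J.toIsometry, J.involutive]

theorem Conjugation.map_apply (J : Conjugation H) (A : H →L[ℂ] H) (x : H) :
    J.toIsometry (A x) = J.bar A (J.toIsometry x) := by
  rw [J.bar_apply, J.involutive]

theorem Conjugation.continuous_bar (J : Conjugation H) : Continuous J.bar := by
  have : ∀ A B, ‖J.bar A - J.bar B‖ ≤ ‖A - B‖ := fun A B => by
    rw [← J.bar_sub]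
    refine ContinuousLinearMap.opNorm_le_bound _ (norm_nonneg _) fun x => ?_
    rw [J.bar_apply, LinearIsometry.norm_map]
    exact ((A - B).le_opNorm _).trans (by rw [LinearIsometry.norm_map])
  refine LipschitzWith.continuous (K := 1) (LipschitzWith.of_dist_le_mul fun A B => ?_)
  rw [dist_eq_norm, dist_eq_norm]
  simpa using this A B

theorem Conjugation.finRange_bar (J : Conjugation H) {A : H →L[ℂ] H} (hA : FinRange A) :
    FinRange (J.bar A) := by
  have := hA.finiteDimensional
  set b := finBasis ℂ (A : H →ₗ[ℂ] H).range
  have hfin : FiniteDimensional ℂ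
      (Submodule.span ℂ (Set.range fun i => J.toIsometry (b i : H))) :=
    FiniteDimensional.span_of_finite ℂ (Set.finite_range _)
  refine FinRange.of_range_le
    (V := Submodule.span ℂ (Set.range fun i => J.toIsometry (b i : H))) fun x => ?_
  have h1 := b.sum_repr ⟨A (J.toIsometry x), ⟨J.toIsometry x, rfl⟩⟩
  have h2 := congrArg Subtype.val h1
  simp only [Submodule.coe_sum, Submodule.coe_smul] at h2
  rw [J.bar_apply, ← h2, map_sum]
  refine Submodule.sum_mem _ fun i _ => ?_
  rw [map_smulₛₗ]
  exact Submodule.smul_mem _ _ (Submodule.subset_span ⟨i, rfl⟩)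

/-- The projection obtained from the Lagrangian projection `P` by replacing the range of `p` by its
conjugate. -/
def Conjugation.flip (J : Conjugation H) (P p : H →L[ℂ] H) : H →L[ℂ] H := P - p + J.bar p

section Lagrangian

variable [CompleteSpace H]

variable {J : Conjugation H} {P R p : H →L[ℂ] H}

theorem _root_.IsStarProjection.apply_apply (hP : IsStarProjection P) (x : H) : P (P x) = P x :=
  congrArg (fun A : H →L[ℂ] H => A x) hP.isIdempotentElem.eq

theorem _root_.IsStarProjection.inner_apply (hP : IsStarProjection P) (x y : H) :
    inner ℂ (P x) y = inner ℂ x (P y) := by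
  rw [← inner_star_left, hP.isSelfAdjoint.star_eq]

theorem _root_.IsStarProjection.mem_range (hP : IsStarProjection P) {x : H} :
    x ∈ (P : H →ₗ[ℂ] H).range ↔ P x = x := by
  constructor
  · rintro ⟨y, rfl⟩
    exact hP.apply_apply y
  · intro h
    exact ⟨x, h⟩

theorem _root_.IsStarProjection.inner_eq_zero (hP : IsStarProjection P) {x y : H} (hx : P x = 0)
    (hy : P y = y) : inner ℂ x y = 0 := by
  rw [← hy, ← hP.inner_apply, hx, inner_zero_left]

theorem Conjugation.conj_apply (hPJ : J.bar P = 1 - P) (x : H) :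
    J.toIsometry (P x) = J.toIsometry x - P (J.toIsometry x) := by
  rw [J.map_apply, hPJ]
  rfl

theorem Conjugation.apply_conj_eq_zero (hPJ : J.bar P = 1 - P) {x : H} (hx : P x = x) :
    P (J.toIsometry x) = 0 := by
  have h2 := J.conj_apply hPJ x
  rw [hx] at h2
  exact sub_eq_self.mp h2.symm

/-- The relation J P J = 1 - P says that J maps ran P into its orthogonal complement: ran P is
Lagrangian for the symmetric bilinear form ⟨Jx, y⟩. -/
theorem Conjugation.isotropic (hPJ : J.bar P = 1 - P) (hP : IsStarProjection P) {x y : H}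
    (hx : P x = x) (hy : P y = y) : inner ℂ (J.toIsometry x) y = 0 :=
  hP.inner_eq_zero (J.apply_conj_eq_zero hPJ hx) hy

theorem Conjugation.bar_flip (hPJ : J.bar P = 1 - P) : J.bar (J.flip P p) = 1 - J.flip P p := by
  rw [Conjugation.flip, J.bar_add, J.bar_sub, J.bar_bar, hPJ]
  abel

theorem mul_eq_of_mul_eq (hP : IsStarProjection P) (hp : IsStarProjection p) (hPp : P * p = p) :
    p * P = p := by
  have := congrArg star hPp
  rwa [star_mul, hP.isSelfAdjoint.star_eq, hp.isSelfAdjoint.star_eq] at this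

theorem Conjugation.mul_bar_eq_zero (hPJ : J.bar P = 1 - P) (hPp : P * p = p) :
    P * J.bar p = 0 := by
  ext x
  refine J.apply_conj_eq_zero hPJ ?_
  exact congrArg (fun A : H →L[ℂ] H => A (J.toIsometry x)) hPp

theorem Conjugation.isStarProjection_bar (hp : IsStarProjection p) :
    IsStarProjection (J.bar p) where
  isIdempotentElem := by
    change J.bar p * J.bar p = J.bar p
    rw [← J.bar_mul, hp.isIdempotentElem.eq]
  isSelfAdjoint := by
    change star (J.bar p) = J.bar p
    rw [← J.bar_star, hp.isSelfAdjoint.star_eq]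

theorem Conjugation.bar_mul_eq_zero (hPJ : J.bar P = 1 - P) (hP : IsStarProjection P)
    (hp : IsStarProjection p) (hPp : P * p = p) : J.bar p * P = 0 := by
  have h := congrArg star (J.mul_bar_eq_zero hPJ hPp)
  rwa [star_mul, hP.isSelfAdjoint.star_eq, (J.isStarProjection_bar hp).isSelfAdjoint.star_eq,
    star_zero] at h

theorem Conjugation.isStarProjection_flip (hPJ : J.bar P = 1 - P) (hP : IsStarProjection P)
    (hp : IsStarProjection p) (hPp : P * p = p) : IsStarProjection (J.flip P p) where
  isIdempotentElem := by
    have h1 := J.mul_bar_eq_zero hPJ hPp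
    have h2 := J.bar_mul_eq_zero hPJ hP hp hPp
    have h3 := mul_eq_of_mul_eq hP hp hPp
    have h4 : p * J.bar p = 0 := by
      rw [show p * J.bar p = p * P * J.bar p by rw [h3], mul_assoc, h1, mul_zero]
    have h5 : J.bar p * p = 0 := by
      rw [show J.bar p * p = J.bar p * (P * p) by rw [hPp], ← mul_assoc, h2, zero_mul]
    have h6 := (J.isStarProjection_bar hp).isIdempotentElem.eq
    change (P - p + J.bar p) * (P - p + J.bar p) = P - p + J.bar p
    have : (P - p + J.bar p) * (P - p + J.bar p) = P * P - P * p - p * P + p * p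
      + (P * J.bar p - p * J.bar p + J.bar p * P - J.bar p * p) + J.bar p * J.bar p := by
      noncomm_ring
    rw [this, h1, h2, h4, h5, h6, h3, hPp, hP.isIdempotentElem.eq, hp.isIdempotentElem.eq]
    abel
  isSelfAdjoint := by
    change star (P - p + J.bar p) = P - p + J.bar p
    rw [star_add, star_sub, hP.isSelfAdjoint.star_eq, hp.isSelfAdjoint.star_eq,
      (J.isStarProjection_bar hp).isSelfAdjoint.star_eq]

/-- The parity of the dimension of the intersection of two Lagrangian subspaces, one of which is
transversal to a modification of the other in finitely many dimensions. -/
theorem Conjugation.finrank_inf_range_eq (hPJ : J.bar P = 1 - P) (hP : IsStarProjection P)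
    (hRJ : J.bar R = 1 - R) (hR : IsStarProjection R) (hp : IsStarProjection p)
    (hPp : P * p = p) (hfin : FinRange p) (hu : IsUnit (J.flip P p - R)) :
    (finrank ℂ ((P : H →ₗ[ℂ] H).range ⊓ (R : H →ₗ[ℂ] H).range : Submodule ℂ H) : ZMod 2) =
      (finrank ℂ (p : H →ₗ[ℂ] H).range : ZMod 2) := by
  have hfd := hfin.finiteDimensional
  set V := (p : H →ₗ[ℂ] H).range
  set P' := J.flip P p with hP'
  have hP'J : J.bar P' = 1 - P' := J.bar_flip hPJ
  have hP'P : IsStarProjection P' := J.isStarProjection_flip hPJ hP hp hPp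
  have hPpx : ∀ x, P (p x) = p x := fun x => congrArg (fun A : H →L[ℂ] H => A x) hPp
  have hpPx : ∀ x, p (P x) = p x := fun x =>
    congrArg (fun A : H →L[ℂ] H => A x) (mul_eq_of_mul_eq hP hp hPp)
  have hPq : ∀ x, P (J.bar p x) = 0 := fun x =>
    congrArg (fun A : H →L[ℂ] H => A x) (J.mul_bar_eq_zero hPJ hPp)
  have hqP : ∀ x, J.bar p (P x) = 0 := fun x =>
    congrArg (fun A : H →L[ℂ] H => A x) (J.bar_mul_eq_zero hPJ hP hp hPp)
  have hP'x : ∀ x, P' x = P x - p x + J.bar p x := fun x => rfl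
  have hpP' : ∀ x, p (P' x) = 0 := fun x => by
    rw [hP'x, map_add, map_sub, hpPx, hp.apply_apply, sub_self, zero_add, ← hpPx, hPq, map_zero]
  obtain ⟨u, hu⟩ := hu
  set Di : H →L[ℂ] H := ↑u⁻¹
  have hD1 : ∀ x, P' (Di x) - R (Di x) = x := fun x => by
    have := u.mul_inv
    rw [hu] at this
    exact congrArg (fun A : H →L[ℂ] H => A x) this
  have hD2 : ∀ x, Di (P' x - R x) = x := fun x => by
    have := u.inv_mul
    rw [hu] at this
    exact congrArg (fun A : H →L[ℂ] H => A x) this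
  have hinj : ∀ v, P' v = v → R v = v → v = 0 := fun v h1 h2 => by
    have := hD2 v
    rw [h1, h2, sub_self, map_zero] at this
    exact this.symm
  -- Invertibility of P' - R splits H into ran P' and ran R; `r` is the projection onto ran R along
  -- ran P'.
  set r : H →L[ℂ] H := -(R * Di) with hr
  have hRr : ∀ x, R (r x) = r x := fun x => by
    change R (-(R (Di x))) = -(R (Di x))
    rw [map_neg, hR.apply_apply]
  have hPr : ∀ x, P' (x - r x) = x - r x := fun x => by
    have : x - r x = P' (Di x) := by
      change x - -(R (Di x)) = _
      rw [sub_neg_eq_add]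
      exact (sub_eq_iff_eq_add.mp (hD1 x)).symm
    rw [this, hP'P.apply_apply]
  have hruniq : ∀ x y, R y = y → P' (x - y) = x - y → r x = y := fun x y h1 h2 => by
    refine sub_eq_zero.mp (hinj _ ?_ ?_)
    · have : r x - y = (x - y) - (x - r x) := by abel
      rw [this, map_sub, h2, hPr]
    · rw [map_sub, h1, hRr]
  let ω : V →ₗ[ℂ] V →ₗ[ℂ] ℂ := LinearMap.mk₂ ℂ
    (fun n m => inner ℂ (J.toIsometry (r n)) (m : H))
    (fun a b m => by
      rw [Submodule.coe_add, map_add, map_add]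
      exact inner_add_left _ _ _)
    (fun c a m => by
      rw [Submodule.coe_smul, map_smul, map_smulₛₗ, inner_smul_left, Complex.conj_conj]
      rfl)
    (fun a m m' => inner_add_right _ _ _)
    (fun c a m => inner_smul_right _ _ _)
  have hV : ∀ n : V, p n = n := fun n => hp.mem_range.mp n.2
  have hVP : ∀ n : V, P n = n := fun n => by rw [← hV n, hPpx]
  -- Write n = a + b with a in ran R and b in ran P'. The symmetric form vanishes at a, at b and at
  -- n, each of which lies in a Lagrangian subspace; hence ⟨Ja, b⟩ = 0.
  have hω : ∀ n, ω n n = 0 := fun n => by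
    change inner ℂ (J.toIsometry (r n)) (n : H) = 0
    set a := r n with ha
    set b := (n : H) - r n with hb
    have hn : (n : H) = a + b := by rw [ha, hb]; abel
    have h1 : inner ℂ (J.toIsometry a) a = 0 := J.isotropic hRJ hR (hRr _) (hRr _)
    have h2 : inner ℂ (J.toIsometry b) b = 0 := J.isotropic hP'J hP'P (hPr _) (hPr _)
    have h3 : inner ℂ (J.toIsometry (n : H)) (n : H) = 0 := J.isotropic hPJ hP (hVP n) (hVP n)
    rw [hn, map_add, inner_add_left, inner_add_right, inner_add_right, h1, h2, J.inner_left b a]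
      at h3
    have h4 : inner ℂ (J.toIsometry a) b = 0 := by linear_combination h3 / 2
    rw [hn, inner_add_right, h1, h4, add_zero]
  rw [finrank_eq_finrank_ker_of_isAlt ω hω]
  congr 1
  -- For n in the radical, r n has no component in the conjugate of ran p, which is the only part of
  -- ran P' outside ran P.
  have hrad : ∀ n : V, n ∈ ω.ker → P (r n) = r n := fun n hn => by
    have h1 : p (J.toIsometry (r n)) = 0 := by
      refine ext_inner_right ℂ fun z => ?_
      rw [hp.inner_apply, inner_zero_left]
      have : ω n ⟨p z, z, rfl⟩ = 0 := by rw [LinearMap.mem_ker.mp hn]; rfl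
      exact this
    have h2 : J.bar p (r n) = 0 := by rw [J.bar_apply, h1, map_zero]
    have h3 : J.bar p ((n : H) - r n) = 0 := by
      rw [map_sub, h2, sub_zero, ← hVP n, hqP]
    have h4 : P ((n : H) - r n) = (n : H) - r n := by
      have h5 := hPr (n : H)
      rw [hP'x, h3, add_zero] at h5
      rw [← h5, map_sub, hP.apply_apply, hPpx]
    rw [map_sub, hVP] at h4
    exact sub_right_injective h4
  let f : ω.ker →ₗ[ℂ] ((P : H →ₗ[ℂ] H).range ⊓ (R : H →ₗ[ℂ] H).range : Submodule ℂ H) :=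
    LinearMap.codRestrict _ ((r : H →ₗ[ℂ] H) ∘ₗ V.subtype ∘ₗ Submodule.subtype _) fun n =>
      ⟨hP.mem_range.mpr (hrad n.1 n.2), hR.mem_range.mpr (hRr _)⟩
  have hpr : ∀ n : V, p (r n) = n := fun n => by
    have h1 := hpP' ((n : H) - r n)
    rw [hPr, map_sub, hV, sub_eq_zero] at h1
    exact h1.symm
  refine (LinearEquiv.ofBijective f ⟨fun n m hnm => ?_, fun x => ?_⟩).finrank_eq.symm
  · have h1 : r n.1 = r m.1 := congrArg Subtype.val hnm
    have h2 := hpr n.1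
    rw [h1, hpr] at h2
    exact Subtype.ext (Subtype.ext h2.symm)
  · have hx1 : P x = x := hP.mem_range.mp x.2.1
    have hx2 : R x = x := hR.mem_range.mp x.2.2
    -- For x in both Lagrangians, p x - x lies in ran P', so x is the ran R component of p x. This
    -- makes `r` surjective from the radical onto the intersection.
    have hrx : r (p x) = x := by
      refine hruniq _ _ hx2 ?_
      have h1 : J.bar p (x : H) = 0 := by rw [← hx1, hqP]
      have h2 : J.bar p (p (x : H)) = 0 := by rw [← hPpx, hqP]
      rw [hP'x, map_sub, map_sub, map_sub, hPpx, hp.apply_apply, hx1, h1, h2]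
      abel
    refine ⟨⟨⟨p x, x, rfl⟩, ?_⟩, Subtype.ext hrx⟩
    refine LinearMap.mem_ker.mpr (LinearMap.ext fun m => ?_)
    change inner ℂ (J.toIsometry (r (p x))) (m : H) = 0
    rw [hrx]
    exact J.isotropic hPJ hP hx1 (hVP m)

end Lagrangian

end Conjugations

/-! ### Fredholm pairs of Lagrangian subspaces. -/

section LagrangianPairs

variable {H : Type*} [NormedAddCommGroup H] [InnerProductSpace ℂ H] [CompleteSpace H]

theorem isUnit_of_isSelfAdjoint {D : H →L[ℂ] H} (hD : D.IsFredholm) (hsa : IsSelfAdjoint D)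
    (hinj : ∀ x, D x = 0 → x = 0) : IsUnit D := by
  obtain ⟨G, p, r, h⟩ := hD.exists_pseudoinverse
  have hp : p = 0 := by
    ext x
    refine hinj _ ((h.mem_ker _).mpr ?_)
    exact congrArg (fun A : H →L[ℂ] H => A x) h.proj_ker.isIdempotentElem.eq
  have hr : r = 0 := by
    ext x
    refine hinj _ ?_
    have := (h.mem_coker (r x)).mpr (congrArg (fun A : H →L[ℂ] H => A x)
      h.proj_coker.isIdempotentElem.eq)
    rwa [hsa.star_eq] at this
  have h1 := h.mul_left
  have h2 := h.mul_right
  rw [hp, sub_zero] at h1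
  rw [hr, sub_zero] at h2
  exact ⟨⟨D, G, h2, h1⟩, rfl⟩

/-- Flipping the whole intersection makes the pair transversal. A kernel vector x of the difference
has equal images under both projections, and this image lies in both ranges, so it is 0; then Jx
also lies in both ranges. A finite-rank change keeps P - R Fredholm, and an injective self-adjoint
Fredholm operator is invertible. -/
theorem isUnit_flip_sub {J : Conjugation H} {P R p : H →L[ℂ] H} (hPJ : J.bar P = 1 - P)
    (hP : IsStarProjection P) (hRJ : J.bar R = 1 - R) (hR : IsStarProjection R)
    (hp : IsStarProjection p) (hmem : ∀ x, p x = x ↔ P x = x ∧ R x = x) (hfin : FinRange p)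
    (hF : (P - R).IsFredholm) : IsUnit (J.flip P p - R) := by
  have hPp : P * p = p := by
    ext x
    exact ((hmem _).mp (hp.apply_apply x)).1
  have hRp : R * p = p := by
    ext x
    exact ((hmem _).mp (hp.apply_apply x)).2
  have hpRx : ∀ x, p (R x) = p x := fun x =>
    congrArg (fun A : H →L[ℂ] H => A x) (mul_eq_of_mul_eq hR hp hRp)
  have hpPx : ∀ x, p (P x) = p x := fun x =>
    congrArg (fun A : H →L[ℂ] H => A x) (mul_eq_of_mul_eq hP hp hPp)
  have hPpx : ∀ x, P (p x) = p x := fun x => congrArg (fun A : H →L[ℂ] H => A x) hPp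
  have hPq : ∀ x, P (J.bar p x) = 0 := fun x =>
    congrArg (fun A : H →L[ℂ] H => A x) (J.mul_bar_eq_zero hPJ hPp)
  have hFl : IsStarProjection (J.flip P p) := J.isStarProjection_flip hPJ hP hp hPp
  have hFlJ := J.bar_flip (p := p) hPJ
  have hx : ∀ x, J.flip P p x = P x - p x + J.bar p x := fun x => rfl
  have htriv : ∀ v, J.flip P p v = v → R v = v → v = 0 := fun v h1 h2 => by
    have h3 : J.bar p v = 0 := by
      have h4 : J.toIsometry (J.bar p v) = 0 := by
        rw [J.bar_apply, J.involutive]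
        rw [← hpRx, J.apply_conj_eq_zero hRJ h2, map_zero]
      exact J.toIsometry.injective (h4.trans J.toIsometry.map_zero.symm)
    have h4 : p v = 0 := by
      have h5 := congrArg p h1
      rw [hx, map_add, map_sub, hpPx, hp.apply_apply, sub_self, zero_add, h3, map_zero] at h5
      exact h5.symm
    rw [hx, h3, h4, sub_zero, add_zero] at h1
    rw [← (hmem v).mpr ⟨h1, h2⟩, h4]
  refine isUnit_of_isSelfAdjoint ?_ ?_ fun x h0 => ?_
  · have : J.flip P p - R = (P - R) + (J.bar p - p) := by
      rw [Conjugation.flip]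
      abel
    rw [this]
    exact hF.add_finRange ((J.finRange_bar hfin).sub hfin)
  · exact hFl.isSelfAdjoint.sub hR.isSelfAdjoint
  · have h1 : J.flip P p x = R x := sub_eq_zero.mp h0
    have h2 : J.flip P p x = 0 := by
      refine htriv _ (hFl.apply_apply x) ?_
      rw [h1, hR.apply_apply]
    have h3 : J.toIsometry x = 0 := by
      refine htriv _ ?_ ?_
      · have := J.conj_apply hFlJ x
        rw [h2, map_zero] at this
        exact (sub_eq_zero.mp this.symm).symm
      · have := J.conj_apply hRJ x
        rw [← h1, h2, map_zero] at this
        exact (sub_eq_zero.mp this.symm).symm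
    exact J.toIsometry.injective (h3.trans J.toIsometry.map_zero.symm)

theorem finrank_range_mul_le {B : H →L[ℂ] H} (hB : FinRange B) (A C : H →L[ℂ] H) :
    finrank ℂ (A * B * C : H →L[ℂ] H).range ≤ finrank ℂ B.range := by
  have := hB.finiteDimensional
  have h : (A * B * C : H →L[ℂ] H).range ≤ Submodule.map (A : H →ₗ[ℂ] H) B.range := by
    rintro _ ⟨x, rfl⟩
    exact ⟨B (C x), ⟨C x, rfl⟩, rfl⟩
  exact (Submodule.finrank_mono h).trans (Submodule.finrank_map_le _ _)

/-- Projections onto the ranges of `P t p`, converging to the finite-rank projection `p`. -/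
theorem exists_tendsto_finRange_projection {ι : Type*} {l : Filter ι} {P : ι → H →L[ℂ] H}
    {P₀ p : H →L[ℂ] H} (hP : ∀ t, IsStarProjection (P t)) (hlim : Filter.Tendsto P l (nhds P₀))
    (hP₀ : P₀ * p = p) (hP₀s : IsStarProjection P₀) (hp : IsStarProjection p)
    (hfin : FinRange p) :
    ∃ q : ι → H →L[ℂ] H, Filter.Tendsto q l (nhds p) ∧ ∀ᶠ t in l,
      IsStarProjection (q t) ∧ P t * q t = q t ∧ FinRange (q t) ∧
      finrank ℂ (q t : H →ₗ[ℂ] H).range = finrank ℂ (p : H →ₗ[ℂ] H).range := by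
  have hpP₀ := mul_eq_of_mul_eq hP₀s hp hP₀
  have hpp := hp.isIdempotentElem.eq
  set c : ι → H →L[ℂ] H := fun t => p * P t * p + 1 - p with hc
  have hclim : Filter.Tendsto c l (nhds 1) := by
    have h1 : Filter.Tendsto c l (nhds (p * P₀ * p + 1 - p)) :=
      (((hlim.const_mul p).mul_const p).add_const 1).sub_const p
    have h2 : p * P₀ * p + 1 - p = 1 := by
      rw [hpP₀, hpp]
      abel
    rwa [h2] at h1
  have hcu : ∀ᶠ t in l, IsUnit (c t) :=
    hclim.eventually (Units.isOpen.mem_nhds isUnit_one)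
  have hcilim : Filter.Tendsto (fun t => Ring.inverse (c t)) l (nhds 1) := by
    have h2 := (NormedRing.inverse_continuousAt (1 : (H →L[ℂ] H)ˣ)).tendsto
    rw [Units.val_one, Ring.inverse_one] at h2
    exact h2.comp hclim
  -- The orthogonal projection onto the range of P p: the compression p P p, completed by 1 - p to
  -- the operator `c t`, tends to 1 and is inverted to normalize P p p P.
  refine ⟨fun t => P t * p * Ring.inverse (c t) * p * P t, ?_, ?_⟩
  · have h1 := ((((hlim.mul_const p).mul hcilim).mul_const p).mul hlim)
    have h2 : P₀ * p * 1 * p * P₀ = p := by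
      rw [hP₀, mul_one, hpp, hpP₀]
    rwa [h2] at h1
  filter_upwards [hcu] with t ht
  set e := Ring.inverse (c t) with he
  have h1 : e * c t = 1 := Ring.inverse_mul_cancel _ ht
  have h2 : c t * e = 1 := Ring.mul_inverse_cancel _ ht
  have hPt := (hP t).isIdempotentElem.eq
  have hpc : p * c t = p * P t * p := by
    calc p * c t = (p * p) * P t * p + p - p * p := by rw [hc]; noncomm_ring
      _ = p * P t * p := by rw [hpp]; abel
  have hcp : c t * p = p * P t * p := by
    calc c t * p = p * P t * (p * p) + p - p * p := by rw [hc]; noncomm_ring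
      _ = p * P t * p := by rw [hpp]; abel
  have hep : e * p = p * e := by
    calc e * p = e * (p * c t) * e := by rw [mul_assoc, mul_assoc, h2, mul_one]
      _ = e * (c t * p) * e := by rw [hpc, hcp]
      _ = p * e := by rw [← mul_assoc, h1, one_mul]
  have hcs : star (c t) = c t := by
    rw [hc]
    simp only [star_sub, star_add, star_mul, star_one, hp.isSelfAdjoint.star_eq,
      (hP t).isSelfAdjoint.star_eq, mul_assoc]
  have hes : star e = e := by
    have h3 : star e * c t = 1 := by
      have := congrArg star h2
      rwa [star_mul, hcs, star_one] at this
    calc star e = star e * (c t * e) := by rw [h2, mul_one]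
      _ = e := by rw [← mul_assoc, h3, one_mul]
  -- Recovering `p` by multiplication from the new projection shows that neither rank exceeds the
  -- other.
  have hback : p * P t * (P t * p * e * p * P t) * (P t * p * e) = p := by
    calc p * P t * (P t * p * e * p * P t) * (P t * p * e)
        = (p * (P t * P t) * p) * e * (p * (P t * P t) * p) * e := by noncomm_ring
      _ = (p * c t) * e * (p * c t) * e := by rw [hPt, ← hpc]
      _ = p * (c t * e) * p * (c t * e) := by noncomm_ring
      _ = p := by rw [h2, mul_one, mul_one, hpp]
  refine ⟨⟨?_, ?_⟩, ?_, ?_, ?_⟩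
  · change P t * p * e * p * P t * (P t * p * e * p * P t) = P t * p * e * p * P t
    calc P t * p * e * p * P t * (P t * p * e * p * P t)
        = P t * p * e * (p * (P t * P t) * p) * e * p * P t := by noncomm_ring
      _ = P t * p * e * (c t * p) * e * p * P t := by rw [hPt, hcp]
      _ = P t * p * (e * c t) * (p * e) * p * P t := by noncomm_ring
      _ = P t * (p * p) * e * p * P t := by rw [h1]; noncomm_ring
      _ = P t * p * e * p * P t := by rw [hpp]
  · change star (P t * p * e * p * P t) = P t * p * e * p * P t
    simp only [star_mul, hp.isSelfAdjoint.star_eq, (hP t).isSelfAdjoint.star_eq, hes, mul_assoc]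
  · simp only [← mul_assoc, hPt]
  · simp only [mul_assoc]
    exact (hfin.mul_right _).mul_left _
  · refine le_antisymm ?_ ?_
    · have h3 : P t * p * e * p * P t = P t * p * (e * p * P t) := by noncomm_ring
      change finrank ℂ ((P t * p * e * p * P t : H →L[ℂ] H) : H →ₗ[ℂ] H).range ≤ _
      rw [h3]
      exact finrank_range_mul_le hfin _ _
    · conv_lhs => rw [← hback]
      refine finrank_range_mul_le ?_ _ _
      rw [mul_assoc, mul_assoc, mul_assoc]
      exact (hfin.mul_right _).mul_left _

/-- The parity of the dimension of the intersection of a Fredholm pair of Lagrangian subspaces is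
locally constant. -/
theorem eventually_finrank_inf_range_eq {ι : Type*} {l : Filter ι} {J : Conjugation H}
    {P R : ι → H →L[ℂ] H} {P₀ R₀ : H →L[ℂ] H}
    (hP : ∀ t, IsStarProjection (P t)) (hR : ∀ t, IsStarProjection (R t))
    (hPJ : ∀ t, J.bar (P t) = 1 - P t) (hRJ : ∀ t, J.bar (R t) = 1 - R t)
    (hP₀ : IsStarProjection P₀) (hR₀ : IsStarProjection R₀)
    (hP₀J : J.bar P₀ = 1 - P₀) (hR₀J : J.bar R₀ = 1 - R₀)
    (hPl : Filter.Tendsto P l (nhds P₀)) (hRl : Filter.Tendsto R l (nhds R₀))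
    (hF : (P₀ - R₀).IsFredholm)
    [FiniteDimensional ℂ ((P₀ : H →ₗ[ℂ] H).range ⊓ (R₀ : H →ₗ[ℂ] H).range : Submodule ℂ H)] :
    ∀ᶠ t in l,
      (finrank ℂ ((P t : H →ₗ[ℂ] H).range ⊓ (R t : H →ₗ[ℂ] H).range : Submodule ℂ H) : ZMod 2) =
      (finrank ℂ ((P₀ : H →ₗ[ℂ] H).range ⊓ (R₀ : H →ₗ[ℂ] H).range : Submodule ℂ H) : ZMod 2) := by
  set N : Submodule ℂ H := (P₀ : H →ₗ[ℂ] H).range ⊓ (R₀ : H →ₗ[ℂ] H).range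
  set p : H →L[ℂ] H := N.starProjection with hp
  have hps : IsStarProjection p := isStarProjection_starProjection
  have hmem : ∀ x, p x = x ↔ P₀ x = x ∧ R₀ x = x := fun x => by
    rw [hp, Submodule.starProjection_eq_self_iff, Submodule.mem_inf, hP₀.mem_range,
      hR₀.mem_range]
  have hfin : FinRange p :=
    FinRange.of_range_le (V := N) fun x => Submodule.starProjection_apply_mem N x
  have hrange : (p : H →ₗ[ℂ] H).range = N := Submodule.range_starProjection N
  have hP₀p : P₀ * p = p := by
    ext x
    exact ((hmem _).mp (hps.apply_apply x)).1
  obtain ⟨q, hq, hq'⟩ := exists_tendsto_finRange_projection hP hPl hP₀p hP₀ hps hfin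
  -- Transversality after the flip is an open condition, so nearby pairs become transversal by
  -- flipping equally many dimensions, and this number fixes the parity.
  have hu := isUnit_flip_sub hP₀J hP₀ hR₀J hR₀ hps hmem hfin hF
  have hlim : Filter.Tendsto (fun t => J.flip (P t) (q t) - R t) l (nhds (J.flip P₀ p - R₀)) :=
    ((hPl.sub hq).add ((J.continuous_bar.tendsto p).comp hq)).sub hRl
  filter_upwards [hq', hlim.eventually (Units.isOpen.mem_nhds hu)] with t ⟨h1, h2, h3, h4⟩ h5
  rw [J.finrank_inf_range_eq (hPJ t) (hP t) (hRJ t) (hR t) h1 h2 h3 h5, h4, hrange]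

end LagrangianPairs

/-! ### The antiunitary S Σ C and its action on kernels. -/

section Cells

variable {H : Type*} [NormedAddCommGroup H] [InnerProductSpace ℂ H] [CompleteSpace H]

theorem unitary_star_apply {U : H →L[ℂ] H} (hU : U ∈ unitary (H →L[ℂ] H)) (x : H) :
    star U (U x) = x :=
  congrArg (fun A : H →L[ℂ] H => A x) (Unitary.star_mul_self_of_mem hU)

theorem unitary_apply_star {U : H →L[ℂ] H} (hU : U ∈ unitary (H →L[ℂ] H)) (x : H) :
    U (star U x) = x :=
  congrArg (fun A : H →L[ℂ] H => A x) (Unitary.mul_star_self_of_mem hU)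

theorem norm_unitary_apply {U : H →L[ℂ] H} (hU : U ∈ unitary (H →L[ℂ] H)) (x : H) :
    ‖U x‖ = ‖x‖ := by
  have h : inner ℂ (U x) (U x) = inner ℂ x x := by rw [← inner_star_right, unitary_star_apply hU]
  rw [inner_self_eq_norm_sq_to_K, inner_self_eq_norm_sq_to_K] at h
  have h' : ‖U x‖ ^ 2 = ‖x‖ ^ 2 := by exact_mod_cast h
  exact (sq_eq_sq₀ (norm_nonneg _) (norm_nonneg _)).mp h'

/-- The antiunitary operator `S C`. -/
def Conjugation.twist (C : Conjugation H) {S : H →L[ℂ] H} (hS : S ∈ unitary (H →L[ℂ] H)) :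
    H →ₛₗᵢ[starRingEnd ℂ] H where
  toFun x := S (C.toIsometry x)
  map_add' x y := by rw [map_add, map_add]
  map_smul' c x := by rw [map_smulₛₗ, map_smul]
  norm_map' x := (norm_unitary_apply hS _).trans (C.toIsometry.norm_map x)

theorem Conjugation.twist_apply (C : Conjugation H) {S : H →L[ℂ] H}
    (hS : S ∈ unitary (H →L[ℂ] H)) (x : H) : C.twist hS x = S (C.toIsometry x) := rfl

theorem IsSymmetryOperator.conj_apply {C : Conjugation H} {ε : ℤˣ} {S : H →L[ℂ] H}
    (hS : IsSymmetryOperator C ε S) (x : H) : C.toIsometry (S x) = S (C.toIsometry x) := by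
  rw [C.map_apply, hS.real]

theorem IsSymmetryOperator.apply_apply {C : Conjugation H} {ε : ℤˣ} {S : H →L[ℂ] H}
    (hS : IsSymmetryOperator C ε S) (x : H) : S (S x) = (ε : ℤ) • x :=
  congrArg (fun A : H →L[ℂ] H => A x) hS.sq

theorem commute_apply {A B : H →L[ℂ] H} (h : Commute A B) (x : H) : A (B x) = B (A x) :=
  congrArg (fun A : H →L[ℂ] H => A x) h.eq

/-- Moving `S` and the conjugation to the other side turns each table relation into an intertwining
by the antiunitary S C, so that conditions from S and Σ can be composed. -/
theorem Conjugation.symmetry_relation_iff {C : Conjugation H} {ε : ℤˣ} {S : H →L[ℂ] H}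
    (hS : IsSymmetryOperator C ε S) (A B : H →L[ℂ] H) :
    star S * C.bar A * S = B ↔ ∀ x, C.twist hS.unitary (B x) = A (C.twist hS.unitary x) := by
  constructor
  · intro h x
    have h1 : star S (C.bar A (S x)) = B x := congrArg (fun A : H →L[ℂ] H => A x) h
    rw [C.twist_apply, C.twist_apply, ← h1, ← hS.conj_apply, unitary_apply_star hS.unitary,
      C.bar_apply, C.involutive, hS.conj_apply]
  · intro h
    ext x
    change star S (C.bar A (S x)) = B x
    have h1 := h x
    rw [C.twist_apply, C.twist_apply, ← hS.conj_apply, ← hS.conj_apply] at h1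
    rw [C.bar_apply, ← h1, C.involutive, unitary_star_apply hS.unitary]

theorem Kind.relation_iff_of_preserves {C : Conjugation H} {k : Kind} {S : H →L[ℂ] H}
    (hS : IsSymmetryOperator C k.sign S) (hk : k = .R ∨ k = .Q) (P : H →L[ℂ] H) :
    k.Relation C S P ↔ ∀ x, C.twist hS.unitary (P x) = P (C.twist hS.unitary x) := by
  rcases hk with rfl | rfl <;> exact C.symmetry_relation_iff hS P P

theorem Kind.relation_iff_of_flips {C : Conjugation H} {k : Kind} {S : H →L[ℂ] H}
    (hS : IsSymmetryOperator C k.sign S) (hk : k = .O ∨ k = .S) (P : H →L[ℂ] H) :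
    k.Relation C S P ↔
      ∀ x, C.twist hS.unitary (P x) = C.twist hS.unitary x - P (C.twist hS.unitary x) := by
  have h1 : k.Relation C S P ↔ star S * C.bar P * S = 1 - P := by
    rcases hk with rfl | rfl <;> rfl
  rw [h1, C.symmetry_relation_iff hS]
  refine forall_congr' fun x => ?_
  change C.twist hS.unitary (x - P x) = _ ↔ _
  rw [map_sub, sub_eq_iff_eq_add, eq_sub_iff_add_eq, eq_comm, add_comm]

theorem Column.relation_iff_of_bar {C : Conjugation H} {d : Column} {S : H →L[ℂ] H}
    (hS : IsSymmetryOperator C d.sign S) (hd : d = .d4 ∨ d = .d8) (F : H →L[ℂ] H) :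
    d.Relation C S F ↔ ∀ x, C.twist hS.unitary (F x) = F (C.twist hS.unitary x) := by
  rcases hd with rfl | rfl <;> exact C.symmetry_relation_iff hS F F

theorem Column.relation_iff_of_transpose {C : Conjugation H} {d : Column} {S : H →L[ℂ] H}
    (hS : IsSymmetryOperator C d.sign S) (hd : d = .d2 ∨ d = .d6) (F : H →L[ℂ] H) :
    d.Relation C S F ↔ ∀ x, C.twist hS.unitary (F x) = star F (C.twist hS.unitary x) := by
  have h : d.Relation C S F ↔ star S * C.bar (star F) * S = F := by
    rw [C.bar_star]
    rcases hd with rfl | rfl <;> rfl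
  rw [h, C.symmetry_relation_iff hS]

section Cell

/-- The symmetries of a pairing seen by one of the operators `S`, `Ŝ` and by `Σ`. -/
structure IsCell (C : Conjugation H) (k : Kind) (d : Column) (S Sigma P F : H →L[ℂ] H) :
    Prop where
  symm_S : IsSymmetryOperator C k.sign S
  symm_Sigma : IsSymmetryOperator C d.sign Sigma
  comm : Commute S Sigma
  projection : IsStarProjection P
  unitary : F ∈ unitary (H →L[ℂ] H)
  rel_S : k.Relation C S P
  rel_Sigma : d.Relation C Sigma F
  comm_S_F : Commute S F
  comm_Sigma_P : Commute Sigma P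
  fredholm : (pairingOp P F).IsFredholm

theorem IsPairing.cell {C : Conjugation H} {s : Symmetries H} {j : Fin 8} {d : Column}
    {P F : H →L[ℂ] H} (hs : s.Admissible C j d) (h : IsPairing C s j d P F) :
    IsCell C (rowKind j) d s.S s.Sigma P F :=
  ⟨hs.symm_S, hs.symm_Sigma, hs.comm, h.projection, h.unitary, h.rel_S, h.rel_Sigma, h.comm_S_F,
    h.comm_Sigma_P, h.fredholm⟩

theorem IsPairing.cell_hat {C : Conjugation H} {s : Symmetries H} {j : Fin 8} {d : Column}
    {P F : H →L[ℂ] H} (hs : s.Admissible C j d) (h : IsPairing C s j d P F) {k : Kind}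
    (hk : rowKindHat j = some k) : IsCell C k d s.Shat s.Sigma P F :=
  ⟨hs.symm_Shat k hk, hs.symm_Sigma, (hs.comm_hat k hk).2, h.projection, h.unitary,
    h.rel_Shat k hk, h.rel_Sigma, h.comm_Shat_F k hk, h.comm_Sigma_P, h.fredholm⟩

variable {C : Conjugation H} {k : Kind} {d : Column} {S Sigma P F : H →L[ℂ] H}

/-- The antiunitary operator `S Σ C`. -/
def IsCell.twist (h : IsCell C k d S Sigma P F) : H →ₛₗᵢ[starRingEnd ℂ] H :=
  C.twist (mul_mem h.symm_S.unitary h.symm_Sigma.unitary)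

theorem IsCell.twist_apply (h : IsCell C k d S Sigma P F) (x : H) :
    h.twist x = S (Sigma (C.toIsometry x)) := rfl

theorem IsCell.twist_apply_eq (h : IsCell C k d S Sigma P F) (x : H) :
    h.twist x = S (C.twist h.symm_Sigma.unitary x) := rfl

theorem IsCell.twist_apply_eq' (h : IsCell C k d S Sigma P F) (x : H) :
    h.twist x = Sigma (C.twist h.symm_S.unitary x) := commute_apply h.comm _

/-- `S` and `Sigma` are real and commute, so the square of S Σ C is S²Σ². This sign separates 2ℤ
from ℤ and ℤ₂ from 0 in the even rows. -/
theorem IsCell.twist_twist (h : IsCell C k d S Sigma P F) (x : H) :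
    h.twist (h.twist x) = ((k.sign * d.sign : ℤˣ) : ℤ) • x := by
  rw [h.twist_apply, h.twist_apply, h.symm_S.conj_apply, h.symm_Sigma.conj_apply, C.involutive,
    ← commute_apply h.comm, h.symm_S.apply_apply, h.symm_Sigma.apply_apply, smul_smul]
  rfl

theorem IsCell.twist_P_of_preserves (h : IsCell C k d S Sigma P F) (hk : k = .R ∨ k = .Q) (x : H) :
    h.twist (P x) = P (h.twist x) := by
  rw [h.twist_apply_eq', (Kind.relation_iff_of_preserves h.symm_S hk P).mp h.rel_S,
    commute_apply h.comm_Sigma_P, ← h.twist_apply_eq']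

theorem IsCell.twist_P_of_flips (h : IsCell C k d S Sigma P F) (hk : k = .O ∨ k = .S) (x : H) :
    h.twist (P x) = h.twist x - P (h.twist x) := by
  rw [h.twist_apply_eq', (Kind.relation_iff_of_flips h.symm_S hk P).mp h.rel_S, map_sub,
    commute_apply h.comm_Sigma_P, ← h.twist_apply_eq']

theorem IsCell.twist_F_of_bar (h : IsCell C k d S Sigma P F) (hd : d = .d4 ∨ d = .d8) (x : H) :
    h.twist (F x) = F (h.twist x) := by
  rw [h.twist_apply_eq, (Column.relation_iff_of_bar h.symm_Sigma hd F).mp h.rel_Sigma,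
    commute_apply h.comm_S_F, ← h.twist_apply_eq]

theorem commute_star_of_mem_unitary {U A : H →L[ℂ] H} (hU : U ∈ unitary (H →L[ℂ] H))
    (h : Commute A U) : Commute A (star U) := by
  change A * star U = star U * A
  calc A * star U = star U * U * A * star U := by
        rw [Unitary.star_mul_self_of_mem hU, one_mul]
    _ = star U * (A * (U * star U)) := by rw [mul_assoc (star U), ← h.eq]; noncomm_ring
    _ = star U * A := by rw [Unitary.mul_star_self_of_mem hU, mul_one]

theorem IsCell.twist_F_of_transpose (h : IsCell C k d S Sigma P F) (hd : d = .d2 ∨ d = .d6)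
    (x : H) : h.twist (F x) = star F (h.twist x) := by
  rw [h.twist_apply_eq, (Column.relation_iff_of_transpose h.symm_Sigma hd F).mp h.rel_Sigma,
    commute_apply (commute_star_of_mem_unitary h.unitary h.comm_S_F), ← h.twist_apply_eq]

end Cell

section Kernel

variable {P F : H →L[ℂ] H}

theorem pairingOp_apply (P F : H →L[ℂ] H) (x : H) :
    pairingOp P F x = P (F (P x)) + x - P x := rfl

theorem star_pairingOp (hP : IsStarProjection P) : star (pairingOp P F) = pairingOp P (star F) := by
  rw [pairingOp, pairingOp, star_sub, star_add, star_mul, star_mul, star_one,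
    hP.isSelfAdjoint.star_eq, mul_assoc]

/-- The ranges of PFP and 1 - P are orthogonal, so the two terms vanish separately. -/
theorem pairingOp_apply_eq_zero_iff (hP : IsStarProjection P) (x : H) :
    pairingOp P F x = 0 ↔ P x = x ∧ P (F x) = 0 := by
  rw [pairingOp_apply]
  constructor
  · intro h
    have h1 := congrArg P h
    rw [map_sub, map_add, hP.apply_apply, hP.apply_apply, map_zero, add_sub_cancel_right] at h1
    rw [h1, zero_add, sub_eq_zero] at h
    rw [← h] at h1
    exact ⟨h.symm, h1⟩
  · rintro ⟨h1, h2⟩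
    rw [h1, h2, zero_add, sub_self]

theorem star_pairingOp_apply_eq_zero_iff (hP : IsStarProjection P) (x : H) :
    star (pairingOp P F) x = 0 ↔ P x = x ∧ P (star F x) = 0 := by
  rw [star_pairingOp hP, pairingOp_apply_eq_zero_iff hP]

/-- Antilinear injections in both directions compare the dimensions of kernel and cokernel. -/
theorem noetherIndex_eq_zero_of_antilinear {T : H →L[ℂ] H} (hT : T.IsFredholm) (j j' : H → H)
    (hadd : ∀ x y, j (x + y) = j x + j y)
    (hsmul : ∀ (c : ℂ) x, j (c • x) = starRingEnd ℂ c • j x)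
    (hmaps : ∀ x, T x = 0 → star T (j x) = 0) (hinj : ∀ x, j x = 0 → x = 0)
    (hadd' : ∀ x y, j' (x + y) = j' x + j' y)
    (hsmul' : ∀ (c : ℂ) x, j' (c • x) = starRingEnd ℂ c • j' x)
    (hmaps' : ∀ x, star T x = 0 → T (j' x) = 0) (hinj' : ∀ x, j' x = 0 → x = 0) :
    noetherIndex T = 0 := by
  have := hT.finite_ker
  have := hT.adjoint.finite_ker
  have h1 : finrank ℂ T.ker ≤ finrank ℂ (star T).ker :=
    finrank_le_of_antilinear j hadd hsmul hmaps fun x _ => hinj x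
  have h2 : finrank ℂ (star T).ker ≤ finrank ℂ T.ker :=
    finrank_le_of_antilinear j' hadd' hsmul' hmaps' fun x _ => hinj' x
  rw [noetherIndex]
  omega

variable {C : Conjugation H} {k : Kind} {d : Column} {S Sigma : H →L[ℂ] H}

theorem unitary_apply_eq_zero {U : H →L[ℂ] H} (hU : U ∈ unitary (H →L[ℂ] H)) {x : H}
    (h : U x = 0) : x = 0 := by
  rw [← unitary_star_apply hU x, h, map_zero]

theorem antilinear_eq_zero (J : H →ₛₗᵢ[starRingEnd ℂ] H) {x : H} (h : J x = 0) : x = 0 :=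
  J.injective (h.trans J.map_zero.symm)

theorem IsCell.twist_pairingOp (h : IsCell C k d S Sigma P F) (hk : k = .R ∨ k = .Q)
    (hd : d = .d2 ∨ d = .d6) (x : H) :
    h.twist (pairingOp P F x) = star (pairingOp P F) (h.twist x) := by
  rw [star_pairingOp h.projection, pairingOp_apply, pairingOp_apply, map_sub, map_add,
    h.twist_P_of_preserves hk, h.twist_F_of_transpose hd, h.twist_P_of_preserves hk]

theorem IsCell.noetherIndex_eq_zero_of_transpose (h : IsCell C k d S Sigma P F)
    (hk : k = .R ∨ k = .Q) (hd : d = .d2 ∨ d = .d6) : noetherIndex (pairingOp P F) = 0 := by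
  refine noetherIndex_eq_zero_of_antilinear h.fredholm h.twist h.twist (map_add _)
    (map_smulₛₗ _) (fun x hx => ?_) (fun x => antilinear_eq_zero _) (map_add _)
    (map_smulₛₗ _) (fun x hx => ?_) (fun x => antilinear_eq_zero _)
  · rw [← h.twist_pairingOp hk hd, hx, map_zero]
  · refine antilinear_eq_zero h.twist ?_
    rw [h.twist_pairingOp hk hd, h.twist_twist, map_zsmul, hx, smul_zero]

/-- For x in the kernel, Fx lies in ran(1 - P). With K = S Σ C exchanging P and 1 - P and commuting
with F, the vector FKx = KFx lies in ran P, while F*(FKx) = Kx lies in ran(1 - P). -/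
theorem IsCell.twist_mem_coker_of_bar (h : IsCell C k d S Sigma P F) (hk : k = .O ∨ k = .S)
    (hd : d = .d4 ∨ d = .d8) {x : H} (hx : pairingOp P F x = 0) :
    star (pairingOp P F) (F (h.twist x)) = 0 := by
  rw [pairingOp_apply_eq_zero_iff h.projection] at hx
  rw [star_pairingOp_apply_eq_zero_iff h.projection, unitary_star_apply h.unitary]
  constructor
  · have := h.twist_P_of_flips hk (F x)
    rw [hx.2, map_zero, h.twist_F_of_bar hd] at this
    exact (sub_eq_zero.mp this.symm).symm
  · have := h.twist_P_of_flips hk x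
    rw [hx.1] at this
    exact sub_eq_self.mp this.symm

theorem IsCell.noetherIndex_eq_zero_of_bar (h : IsCell C k d S Sigma P F)
    (hk : k = .O ∨ k = .S) (hd : d = .d4 ∨ d = .d8) : noetherIndex (pairingOp P F) = 0 := by
  refine noetherIndex_eq_zero_of_antilinear h.fredholm (fun x => F (h.twist x))
    (fun x => h.twist (star F x)) (fun x y => by simp) (fun c x => by simp [map_smulₛₗ])
    (fun x hx => h.twist_mem_coker_of_bar hk hd hx)
    (fun x hx => antilinear_eq_zero _ (unitary_apply_eq_zero h.unitary hx))
    (fun x y => by simp) (fun c x => by simp [map_smulₛₗ]) (fun x hx => ?_)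
    (fun x hx => unitary_apply_eq_zero (Unitary.star_mem h.unitary) (antilinear_eq_zero _ hx))
  rw [star_pairingOp_apply_eq_zero_iff h.projection] at hx
  rw [pairingOp_apply_eq_zero_iff h.projection, ← h.twist_F_of_bar hd,
    unitary_apply_star h.unitary]
  constructor
  · have := h.twist_P_of_flips hk (star F x)
    rw [hx.2, map_zero] at this
    exact (sub_eq_zero.mp this.symm).symm
  · have := h.twist_P_of_flips hk x
    rw [hx.1] at this
    exact sub_eq_self.mp this.symm

/-- Replacing `F` by its adjoint yields a pairing of the same class. -/
theorem IsCell.adjoint (h : IsCell C k d S Sigma P F) : IsCell C k d S Sigma P (star F) where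
  symm_S := h.symm_S
  symm_Sigma := h.symm_Sigma
  comm := h.comm
  projection := h.projection
  unitary := Unitary.star_mem h.unitary
  rel_S := h.rel_S
  rel_Sigma := by
    have hd : (d = .d4 ∨ d = .d8) ∨ (d = .d2 ∨ d = .d6) := by cases d <;> simp
    rcases hd with hd | hd
    · rw [Column.relation_iff_of_bar h.symm_Sigma hd]
      have h1 := (Column.relation_iff_of_bar h.symm_Sigma hd F).mp h.rel_Sigma
      intro x
      conv_rhs => rw [← unitary_apply_star h.unitary x, h1, unitary_star_apply h.unitary]
    · rw [Column.relation_iff_of_transpose h.symm_Sigma hd, star_star]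
      have h1 := (Column.relation_iff_of_transpose h.symm_Sigma hd F).mp h.rel_Sigma
      intro x
      conv_rhs => rw [← unitary_apply_star h.unitary x, h1, unitary_apply_star h.unitary]
  comm_S_F := commute_star_of_mem_unitary h.unitary h.comm_S_F
  comm_Sigma_P := h.comm_Sigma_P
  fredholm := by
    rw [← star_pairingOp h.projection]
    exact h.fredholm.adjoint

/-- The twist commutes with both `P` and `F`, so it restricts to a quaternionic structure on the
kernel. -/
theorem IsCell.even_finrank_ker_of_bar (h : IsCell C k d S Sigma P F) (hk : k = .R ∨ k = .Q)
    (hd : d = .d4 ∨ d = .d8) (hsign : k.sign * d.sign = -1) :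
    Even (finrank ℂ (pairingOp P F).ker) := by
  have := h.fredholm.finite_ker
  refine even_finrank_of_quaternionic h.twist (map_add _) (map_smulₛₗ _) (fun x hx => ?_)
    (fun x _ => ?_)
  · have hx' := (pairingOp_apply_eq_zero_iff h.projection x).mp hx
    refine (pairingOp_apply_eq_zero_iff h.projection _).mpr ⟨?_, ?_⟩
    · rw [← h.twist_P_of_preserves hk, hx'.1]
    · rw [← h.twist_F_of_bar hd, ← h.twist_P_of_preserves hk, hx'.2, map_zero]
  · rw [h.twist_twist, hsign]
    simp

/-- The twist K alone moves the kernel out of ran P; F*K brings it back, and (F*K)² = K² = -1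
because KF = F*K. -/
theorem IsCell.even_finrank_ker_of_transpose (h : IsCell C k d S Sigma P F) (hk : k = .O ∨ k = .S)
    (hd : d = .d2 ∨ d = .d6) (hsign : k.sign * d.sign = -1) :
    Even (finrank ℂ (pairingOp P F).ker) := by
  have := h.fredholm.finite_ker
  refine even_finrank_of_quaternionic (fun x => star F (h.twist x)) (fun x y => by simp)
    (fun c x => by simp [map_smulₛₗ]) (fun x hx => ?_) (fun x _ => ?_)
  · have hx' := (pairingOp_apply_eq_zero_iff h.projection x).mp hx
    refine (pairingOp_apply_eq_zero_iff h.projection _).mpr ⟨?_, ?_⟩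
    · have := h.twist_P_of_flips hk (F x)
      rw [hx'.2, map_zero, h.twist_F_of_transpose hd] at this
      exact (sub_eq_zero.mp this.symm).symm
    · rw [unitary_apply_star h.unitary]
      have := h.twist_P_of_flips hk x
      rw [hx'.1] at this
      exact sub_eq_self.mp this.symm
  · rw [← h.twist_F_of_transpose hd, unitary_apply_star h.unitary, h.twist_twist, hsign]
    simp

/-- The cokernel is the kernel for the pairing (P, F*), which has the same symmetries, so it is
even-dimensional as well. -/
theorem IsCell.even_noetherIndex (h : IsCell C k d S Sigma P F)
    (hkd : (k = .R ∨ k = .Q) ∧ (d = .d4 ∨ d = .d8) ∨ (k = .O ∨ k = .S) ∧ (d = .d2 ∨ d = .d6))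
    (hsign : k.sign * d.sign = -1) :
    Even (finrank ℂ (pairingOp P F).ker) ∧ Even (noetherIndex (pairingOp P F)) := by
  have h1 : Even (finrank ℂ (pairingOp P F).ker) := by
    rcases hkd with ⟨hk, hd⟩ | ⟨hk, hd⟩
    · exact h.even_finrank_ker_of_bar hk hd hsign
    · exact h.even_finrank_ker_of_transpose hk hd hsign
  have h2 : Even (finrank ℂ (pairingOp P (star F)).ker) := by
    rcases hkd with ⟨hk, hd⟩ | ⟨hk, hd⟩
    · exact h.adjoint.even_finrank_ker_of_bar hk hd hsign
    · exact h.adjoint.even_finrank_ker_of_transpose hk hd hsign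
  refine ⟨h1, ?_⟩
  rw [noetherIndex, star_pairingOp h.projection]
  exact ((Int.even_coe_nat _).mpr h1).sub ((Int.even_coe_nat _).mpr h2)

end Kernel

end Cells

/-! ### Invariance of the indices along homotopies. -/

section HomotopyInvariance

variable {H : Type*} [NormedAddCommGroup H] [InnerProductSpace ℂ H] [CompleteSpace H]

theorem continuous_pairingOp : Continuous fun A : (H →L[ℂ] H) × (H →L[ℂ] H) =>
    pairingOp A.1 A.2 := by
  unfold pairingOp
  fun_prop

variable {C : Conjugation H} {s : Symmetries H} {j : Fin 8} {d : Column} {P F : H →L[ℂ] H}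

/-- The unit interval is connected, so local constancy suffices. -/
theorem isHomotopyInvariantAt_of_eventually_eq {α : Type*} {f : (H →L[ℂ] H) → α}
    (h : ∀ Pt Ft : unitInterval → H →L[ℂ] H, IsPath C s j d Pt Ft → ∀ t₀, ∀ᶠ t in nhds t₀,
      f (pairingOp (Pt t) (Ft t)) = f (pairingOp (Pt t₀) (Ft t₀))) :
    IsHomotopyInvariantAt f C s j d P F := by
  intro Pt Ft hpath h0 h1 t
  have hlc : IsLocallyConstant fun t => f (pairingOp (Pt t) (Ft t)) :=
    (IsLocallyConstant.iff_eventually_eq _).mpr (h Pt Ft hpath)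
  rw [← h0, ← h1]
  exact hlc.apply_eq_of_preconnectedSpace t 0

theorem IsPath.tendsto_pairingOp {Pt Ft : unitInterval → H →L[ℂ] H} (h : IsPath C s j d Pt Ft)
    (t₀ : unitInterval) : Filter.Tendsto (fun t => pairingOp (Pt t) (Ft t)) (nhds t₀)
      (nhds (pairingOp (Pt t₀) (Ft t₀))) :=
  (continuous_pairingOp.comp (h.continuous_P.prodMk h.continuous_F)).tendsto t₀

theorem isHomotopyInvariantAt_noetherIndex :
    IsHomotopyInvariantAt noetherIndex C s j d P F :=
  isHomotopyInvariantAt_of_eventually_eq fun _ _ h t₀ =>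
    (h.tendsto_pairingOp t₀).eventually (h.pairing t₀).fredholm.eventually_index_eq

/-- The symmetries are fixed along the path, so one antiunitary K with K² = -1 satisfies KT = T*K
for all operators of the path. -/
theorem isHomotopyInvariantAt_index2_of_preserves {k : Kind} {S : H →L[ℂ] H}
    (hcell : ∀ P F, IsPairing C s j d P F → IsCell C k d S s.Sigma P F)
    (hk : k = .R ∨ k = .Q) (hd : d = .d2 ∨ d = .d6) (hsign : k.sign * d.sign = -1) :
    IsHomotopyInvariantAt index2 C s j d P F := by
  refine isHomotopyInvariantAt_of_eventually_eq fun Pt Ft h t₀ => ?_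
  have h₀ := hcell _ _ (h.pairing t₀)
  have h1 := eventually_index2_eq_of_oddSymmetric h₀.fredholm h₀.twist
    (fun x => by rw [h₀.twist_twist, hsign]; simp) (h₀.twist_pairingOp hk hd)
  filter_upwards [(h.tendsto_pairingOp t₀).eventually h1] with t ht
  exact ht ((hcell _ _ (h.pairing t)).twist_pairingOp hk hd)

theorem _root_.IsStarProjection.mul_star_unitary (hP : IsStarProjection P)
    (hF : F ∈ unitary (H →L[ℂ] H)) : IsStarProjection (star F * (1 - P) * F) where
  isIdempotentElem := by
    change star F * (1 - P) * F * (star F * (1 - P) * F) = _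
    calc star F * (1 - P) * F * (star F * (1 - P) * F)
        = star F * (1 - P) * (F * star F) * (1 - P) * F := by noncomm_ring
      _ = star F * ((1 - P) * (1 - P)) * F := by
        rw [Unitary.mul_star_self_of_mem hF]; noncomm_ring
      _ = _ := by rw [hP.isIdempotentElem.one_sub.eq]
  isSelfAdjoint := by
    change star _ = _
    rw [star_mul, star_mul, star_star, star_sub, star_one, hP.isSelfAdjoint.star_eq, mul_assoc]

/-- The condition P F x = 0 says that Fx lies in ran(1 - P), i.e. x in ran F*(1 - P)F. -/
theorem ker_pairingOp_eq_inf_range (hP : IsStarProjection P) (hF : F ∈ unitary (H →L[ℂ] H)) :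
    (pairingOp P F).ker = (P : H →ₗ[ℂ] H).range ⊓
      ((star F * (1 - P) * F : H →L[ℂ] H) : H →ₗ[ℂ] H).range := by
  ext x
  rw [Submodule.mem_inf, hP.mem_range, (hP.mul_star_unitary hF).mem_range]
  refine (pairingOp_apply_eq_zero_iff hP x).trans (and_congr_right fun _ => ?_)
  have h1 : (star F * (1 - P) * F : H →L[ℂ] H) x = x - star F (P (F x)) := by
    change star F (F x - P (F x)) = _
    rw [map_sub, unitary_star_apply hF]
  rw [h1, sub_eq_self]
  exact ⟨fun h => by rw [h, map_zero], unitary_apply_eq_zero (Unitary.star_mem hF)⟩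

theorem Conjugation.isFredholm_bar (J : Conjugation H) {T : H →L[ℂ] H} (hT : T.IsFredholm) :
    (J.bar T).IsFredholm := by
  obtain ⟨G, h1, h2⟩ := isFredholm_iff_exists_finRange.mp hT
  refine isFredholm_iff_exists_finRange.mpr ⟨J.bar G, ?_, ?_⟩
  · rw [← J.bar_mul, ← J.bar_one, ← J.bar_sub]
    exact J.finRange_bar h1
  · rw [← J.bar_mul, ← J.bar_one, ← J.bar_sub]
    exact J.finRange_bar h2

theorem isFredholm_sub_of_bar {J : Conjugation H} (hP : IsStarProjection P)
    (hF : F ∈ unitary (H →L[ℂ] H)) (hJP : J.bar P = 1 - P) (hJF : J.bar F = F)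
    (hT : (pairingOp P F).IsFredholm) : (P - star F * (1 - P) * F).IsFredholm := by
  have hPP := hP.isIdempotentElem.eq
  have hbar : J.bar (pairingOp P F) = (1 - P) * F * (1 - P) + P := by
    rw [pairingOp, J.bar_sub, J.bar_add, J.bar_mul, J.bar_mul, J.bar_one, hJP, hJF]
    abel
  have hu : IsUnit (2 * P - 1) := by
    have h1 : (2 * P - 1) * (2 * P - 1) = 1 := by
      calc (2 * P - 1) * (2 * P - 1) = 4 * (P * P) - 4 * P + 1 := by noncomm_ring
        _ = 1 := by rw [hPP, sub_self, zero_add]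
    exact ⟨⟨_, _, h1, h1⟩, rfl⟩
  have huF : IsUnit (star F) := ⟨⟨star F, F, Unitary.star_mul_self_of_mem hF,
    Unitary.mul_star_self_of_mem hF⟩, rfl⟩
  -- The product T·(JTJ) is the block-diagonal part PFP + (1 - P)F(1 - P) of F. The symmetry 2P - 1
  -- reverses the sign of its second block, and F* then yields the difference of projections; every
  -- factor is Fredholm.
  have hfac : P - star F * (1 - P) * F =
      star F * (pairingOp P F * J.bar (pairingOp P F) * (2 * P - 1)) := by
    have e1 : pairingOp P F * J.bar (pairingOp P F) = P * F * P + (1 - P) * F * (1 - P) := by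
      rw [hbar, pairingOp]
      calc (P * F * P + 1 - P) * ((1 - P) * F * (1 - P) + P)
          = P * F * (P - P * P) * F * (1 - P) + P * F * (P * P) + (1 - 2 * P + P * P) * F * (1 - P)
            + P - P * P := by noncomm_ring
        _ = _ := by rw [hPP]; noncomm_ring
    have e2 : (P * F * P + (1 - P) * F * (1 - P)) * (2 * P - 1) =
        P * F * P - (1 - P) * F * (1 - P) := by
      calc (P * F * P + (1 - P) * F * (1 - P)) * (2 * P - 1)
          = P * F * (2 * (P * P) - P) + (1 - P) * F * (3 * P - 2 * (P * P) - 1) := by noncomm_ring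
        _ = _ := by rw [hPP]; noncomm_ring
    rw [e1, e2]
    have hFF := Unitary.star_mul_self_of_mem hF
    calc P - star F * (1 - P) * F
        = P - star F * F + star F * P * F := by noncomm_ring
      _ = star F * F * P - star F * F + star F * P * F := by rw [hFF, one_mul]
      _ = _ := by noncomm_ring
  rw [hfac]
  exact (isFredholm_of_isUnit huF).mul ((hT.mul (J.isFredholm_bar hT)).mul
    (isFredholm_of_isUnit hu))

/-- Since K² = 1, the twist is a conjugation J, with respect to which P and F*(1 - P)F are a
Fredholm pair of Lagrangian projections; the kernel is the intersection of their ranges. -/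
theorem isHomotopyInvariantAt_index2_of_flips {k : Kind} {S : H →L[ℂ] H}
    (hcell : ∀ P F, IsPairing C s j d P F → IsCell C k d S s.Sigma P F)
    (hk : k = .O ∨ k = .S) (hd : d = .d4 ∨ d = .d8) (hsign : k.sign * d.sign = 1) :
    IsHomotopyInvariantAt index2 C s j d P F := by
  refine isHomotopyInvariantAt_of_eventually_eq fun Pt Ft h t₀ => ?_
  have h₀ := hcell _ _ (h.pairing t₀)
  let J : Conjugation H := ⟨h₀.twist, fun x => by rw [h₀.twist_twist, hsign]; simp⟩
  have hJP : ∀ t, J.bar (Pt t) = 1 - Pt t := fun t => by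
    ext x
    have := (hcell _ _ (h.pairing t)).twist_P_of_flips hk (J.toIsometry x)
    change J.toIsometry (Pt t (J.toIsometry x)) =
      J.toIsometry (J.toIsometry x) - Pt t (J.toIsometry (J.toIsometry x)) at this
    rwa [J.involutive] at this
  have hJF : ∀ t, J.bar (Ft t) = Ft t := fun t => by
    ext x
    have := (hcell _ _ (h.pairing t)).twist_F_of_bar hd (J.toIsometry x)
    change J.toIsometry (Ft t (J.toIsometry x)) = Ft t (J.toIsometry (J.toIsometry x)) at this
    rwa [J.involutive] at this
  have hJR : ∀ t, J.bar (star (Ft t) * (1 - Pt t) * Ft t) =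
      1 - star (Ft t) * (1 - Pt t) * Ft t := fun t => by
    rw [J.bar_mul, J.bar_mul, J.bar_star, J.bar_sub, J.bar_one, hJP, hJF]
    calc star (Ft t) * (1 - (1 - Pt t)) * Ft t
        = star (Ft t) * Ft t - star (Ft t) * (1 - Pt t) * Ft t := by noncomm_ring
      _ = _ := by rw [Unitary.star_mul_self_of_mem (h.pairing t).unitary]
  have hker := fun t => ker_pairingOp_eq_inf_range (h.pairing t).projection (h.pairing t).unitary
  have := h₀.fredholm.finite_ker
  rw [hker] at this
  have hFt := h.continuous_F.tendsto t₀
  have hPt := h.continuous_P.tendsto t₀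
  have key := eventually_finrank_inf_range_eq (l := nhds t₀) (P := Pt)
    (R := fun t => star (Ft t) * (1 - Pt t) * Ft t)
    (fun t => (h.pairing t).projection)
    (fun t => (h.pairing t).projection.mul_star_unitary (h.pairing t).unitary)
    hJP hJR h₀.projection (h₀.projection.mul_star_unitary h₀.unitary) (hJP t₀) (hJR t₀) hPt
    ((hFt.star.mul (tendsto_const_nhds.sub hPt)).mul hFt)
    (isFredholm_sub_of_bar h₀.projection h₀.unitary (hJP t₀) (hJF t₀) h₀.fredholm)
  filter_upwards [key] with t ht
  rw [index2, index2, hker, hker]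
  exact ht

end HomotopyInvariance

/-! ### Direct sums with finite-dimensional pairings. -/

section Augmentations

variable {H : Type*} [NormedAddCommGroup H] [InnerProductSpace ℂ H]

section DirectSum

variable {n : ℕ}

local notation "𝔼" => EuclideanSpace ℂ (Fin n)

theorem directSum_apply (A : H →L[ℂ] H) (B : 𝔼 →L[ℂ] 𝔼) (x : Augmented H n) :
    directSum A B x = WithLp.toLp 2 (A x.fst, B x.snd) := rfl

theorem directSum_mul (A A' : H →L[ℂ] H) (B B' : 𝔼 →L[ℂ] 𝔼) :
    directSum A B * directSum A' B' = directSum (A * A') (B * B') := rfl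

theorem directSum_one : directSum (1 : H →L[ℂ] H) (1 : 𝔼 →L[ℂ] 𝔼) = 1 := rfl

theorem directSum_sub (A A' : H →L[ℂ] H) (B B' : 𝔼 →L[ℂ] 𝔼) :
    directSum A B - directSum A' B' = directSum (A - A') (B - B') := rfl

theorem directSum_zsmul (m : ℤ) (A : H →L[ℂ] H) (B : 𝔼 →L[ℂ] 𝔼) :
    m • directSum A B = directSum (m • A) (m • B) := rfl

theorem augment_bar_directSum (C : Conjugation H) (A : H →L[ℂ] H) (B : 𝔼 →L[ℂ] 𝔼) :
    (C.augment n).bar (directSum A B) = directSum (C.bar A) ((stdConj n).bar B) := rfl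

theorem pairingOp_directSum (P F : H →L[ℂ] H) (P' F' : 𝔼 →L[ℂ] 𝔼) :
    pairingOp (directSum P P') (directSum F F') =
      directSum (pairingOp P F) (pairingOp P' F') := rfl

theorem continuous_directSum_left (B : 𝔼 →L[ℂ] 𝔼) :
    Continuous fun A : H →L[ℂ] H => directSum A B := by
  suffices hl : LipschitzWith 1 fun A : H →L[ℂ] H => directSum A B from hl.continuous
  refine LipschitzWith.of_dist_le_mul fun A A' => ?_
  rw [dist_eq_norm, dist_eq_norm, NNReal.coe_one, one_mul, directSum_sub, sub_self]
  refine ContinuousLinearMap.opNorm_le_bound _ (norm_nonneg _) fun x => ?_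
  have h1 : ‖directSum (A - A') (0 : 𝔼 →L[ℂ] 𝔼) x‖ = ‖(A - A') x.fst‖ := by
    rw [directSum_apply, WithLp.prod_norm_eq_of_L2]
    change √(‖(A - A') x.fst‖ ^ 2 + ‖(0 : 𝔼)‖ ^ 2) = _
    simp
  rw [h1]
  refine ((A - A').le_opNorm _).trans (mul_le_mul_of_nonneg_left ?_ (norm_nonneg _))
  rw [WithLp.prod_norm_eq_of_L2]
  exact Real.le_sqrt_of_sq_le (le_add_of_nonneg_right (sq_nonneg _))

/-- The kernel of `A ⊕ 1` is the kernel of `A`. -/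
theorem finrank_ker_directSum_one (A : H →L[ℂ] H) :
    finrank ℂ (directSum A (1 : 𝔼 →L[ℂ] 𝔼)).ker = finrank ℂ A.ker := by
  refine LinearEquiv.finrank_eq
    { toFun := fun x => ⟨(x : Augmented H n).fst, ?_⟩
      invFun := fun x => ⟨WithLp.toLp 2 (x, 0), ?_⟩
      map_add' := fun x y => rfl
      map_smul' := fun c x => rfl
      left_inv := fun x => ?_
      right_inv := fun x => rfl }
  · exact congrArg WithLp.fst x.2
  · have := x.2
    change WithLp.toLp 2 (A (x : H), (0 : 𝔼)) = 0
    rw [show A (x : H) = 0 from x.2]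
    rfl
  · have h : (x : Augmented H n).snd = 0 := congrArg WithLp.snd x.2
    ext1
    change WithLp.toLp 2 ((x : Augmented H n).fst, (0 : 𝔼)) = x
    rw [← h]
    rfl

theorem FinRange.directSum {A : H →L[ℂ] H} (hA : FinRange A) (B : 𝔼 →L[ℂ] 𝔼) :
    FinRange (directSum A B) := by
  have := hA.finiteDimensional
  set V : Submodule ℂ (Augmented H n) :=
    ((A : H →ₗ[ℂ] H).range.prod (⊤ : Submodule ℂ 𝔼)).comap
      ((WithLp.linearEquiv 2 ℂ (H × 𝔼)) : Augmented H n →ₗ[ℂ] (H × 𝔼)) with hV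
  have hfd : FiniteDimensional ℂ V := by
    let f : V →ₗ[ℂ] ((A : H →ₗ[ℂ] H).range × 𝔼) :=
      { toFun := fun x => (⟨(x : Augmented H n).fst, x.2.1⟩, (x : Augmented H n).snd)
        map_add' := fun x y => rfl
        map_smul' := fun c x => rfl }
    refine FiniteDimensional.of_injective f fun x y hxy => ?_
    have h1 : (x : Augmented H n).fst = (y : Augmented H n).fst :=
      congrArg (fun z => (z.1 : H)) hxy
    have h2 : (x : Augmented H n).snd = (y : Augmented H n).snd := congrArg (fun z => z.2) hxy
    ext1
    calc (x : Augmented H n) = WithLp.toLp 2 ((x : Augmented H n).fst, 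
        (x : Augmented H n).snd) := rfl
      _ = y := by rw [h1, h2]; rfl
  exact FinRange.of_range_le (V := V) fun x => ⟨⟨x.fst, rfl⟩, trivial⟩

/-- On the finite-dimensional summand every operator has finite rank, so a parametrix may be taken
to be 0 there. -/
theorem isFredholm_directSum {A : H →L[ℂ] H} (hA : A.IsFredholm) (B : 𝔼 →L[ℂ] 𝔼) :
    (directSum A B).IsFredholm := by
  obtain ⟨G, h1, h2⟩ := isFredholm_iff_exists_finRange.mp hA
  refine isFredholm_iff_exists_finRange.mpr ⟨directSum G 0, ?_, ?_⟩
  · rw [directSum_mul, ← directSum_one, directSum_sub]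
    exact h1.directSum _
  · rw [directSum_mul, ← directSum_one, directSum_sub]
    exact h2.directSum _

variable [CompleteSpace H]

theorem star_directSum (A : H →L[ℂ] H) (B : 𝔼 →L[ℂ] 𝔼) :
    star (directSum A B) = directSum (star A) (star B) := by
  ext1 x
  refine ext_inner_left ℂ fun y => ?_
  rw [inner_star_right, WithLp.prod_inner_apply, WithLp.prod_inner_apply]
  change inner ℂ (A y.fst) x.fst + inner ℂ (B y.snd) x.snd =
    inner ℂ y.fst (star A x.fst) + inner ℂ y.snd (star B x.snd)
  rw [inner_star_right, inner_star_right]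

theorem directSum_mem_unitary {A : H →L[ℂ] H} {B : 𝔼 →L[ℂ] 𝔼}
    (hA : A ∈ unitary (H →L[ℂ] H)) (hB : B ∈ unitary (𝔼 →L[ℂ] 𝔼)) :
    directSum A B ∈ unitary (Augmented H n →L[ℂ] Augmented H n) := by
  rw [Unitary.mem_iff, star_directSum, directSum_mul, directSum_mul,
    Unitary.star_mul_self_of_mem hA, Unitary.star_mul_self_of_mem hB,
    Unitary.mul_star_self_of_mem hA, Unitary.mul_star_self_of_mem hB]
  exact ⟨rfl, rfl⟩

theorem commute_directSum {A A' : H →L[ℂ] H} {B B' : 𝔼 →L[ℂ] 𝔼} (hA : Commute A A')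
    (hB : Commute B B') : Commute (directSum A B) (directSum A' B') := by
  change _ * _ = _ * _
  rw [directSum_mul, directSum_mul, hA.eq, hB.eq]

theorem directSum_isStarProjection {A : H →L[ℂ] H} {B : 𝔼 →L[ℂ] 𝔼} (hA : IsStarProjection A)
    (hB : IsStarProjection B) : IsStarProjection (directSum A B) where
  isIdempotentElem := by
    change _ * _ = _
    rw [directSum_mul, hA.isIdempotentElem.eq, hB.isIdempotentElem.eq]
  isSelfAdjoint := by
    change star _ = _
    rw [star_directSum, hA.isSelfAdjoint.star_eq, hB.isSelfAdjoint.star_eq]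

theorem Kind.relation_directSum {C : Conjugation H} {k : Kind} {S P : H →L[ℂ] H}
    {S' P' : 𝔼 →L[ℂ] 𝔼} (h : k.Relation C S P) (h' : k.Relation (stdConj n) S' P') :
    k.Relation (C.augment n) (directSum S S') (directSum P P') := by
  cases k <;> unfold Kind.Relation at * <;>
    rw [star_directSum, augment_bar_directSum, directSum_mul, directSum_mul, h, h'] <;> rfl

theorem Column.relation_directSum {C : Conjugation H} {d : Column} {S F : H →L[ℂ] H}
    {S' F' : 𝔼 →L[ℂ] 𝔼} (h : d.Relation C S F) (h' : d.Relation (stdConj n) S' F') :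
    d.Relation (C.augment n) (directSum S S') (directSum F F') := by
  have hbar : star (directSum S S') * (C.augment n).bar (directSum F F') * directSum S S' =
      directSum (star S * C.bar F * S) (star S' * (stdConj n).bar F' * S') := by
    rw [star_directSum, augment_bar_directSum, directSum_mul, directSum_mul]
  have htranspose :
      star (directSum S S') * (C.augment n).transpose (directSum F F') * directSum S S' =
      directSum (star S * C.transpose F * S) (star S' * (stdConj n).transpose F' * S') := by
    rw [Conjugation.transpose, star_directSum, augment_bar_directSum, star_directSum,
      directSum_mul, directSum_mul]
    rfl
  cases d
  · exact htranspose.trans (congrArg₂ directSum h h')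
  · exact hbar.trans (congrArg₂ directSum h h')
  · exact htranspose.trans (congrArg₂ directSum h h')
  · exact hbar.trans (congrArg₂ directSum h h')

theorem IsPairing.augment {C : Conjugation H} {s : Symmetries H} {s' : Symmetries 𝔼} {j : Fin 8}
    {d : Column} {P F : H →L[ℂ] H} {P' F' : 𝔼 →L[ℂ] 𝔼} (h : IsPairing C s j d P F)
    (h' : IsPairing (stdConj n) s' j d P' F') :
    IsPairing (C.augment n) (s.augment s') j d (directSum P P') (directSum F F') where
  projection := directSum_isStarProjection h.projection h'.projection
  unitary := directSum_mem_unitary h.unitary h'.unitary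
  rel_S := Kind.relation_directSum h.rel_S h'.rel_S
  rel_Shat k hk := Kind.relation_directSum (h.rel_Shat k hk) (h'.rel_Shat k hk)
  rel_Sigma := Column.relation_directSum h.rel_Sigma h'.rel_Sigma
  comm_S_F := commute_directSum h.comm_S_F h'.comm_S_F
  comm_Shat_F k hk := commute_directSum (h.comm_Shat_F k hk) (h'.comm_Shat_F k hk)
  comm_Sigma_P := commute_directSum h.comm_Sigma_P h'.comm_Sigma_P
  fredholm := by
    rw [pairingOp_directSum]
    exact isFredholm_directSum h.fredholm _

theorem directSum_apply_eq_smul_iff {A : H →L[ℂ] H} {B : 𝔼 →L[ℂ] 𝔼} {μ : ℂ}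
    {x : Augmented H n} : directSum A B x = μ • x ↔ A x.fst = μ • x.fst ∧ B x.snd = μ • x.snd := by
  constructor
  · exact fun h => ⟨congrArg WithLp.fst h, congrArg WithLp.snd h⟩
  · rintro ⟨h1, h2⟩
    rw [directSum_apply, h1, h2]
    rfl

theorem nonempty_eigenspace_directSum {A : H →L[ℂ] H} {B : 𝔼 →L[ℂ] 𝔼} {μ ν : ℂ}
    (hA : Nonempty (End.eigenspace (A : H →ₗ[ℂ] H) μ ≃ₗᵢ[ℂ] End.eigenspace (A : H →ₗ[ℂ] H) ν))
    (hB : Nonempty (End.eigenspace (B : 𝔼 →ₗ[ℂ] 𝔼) μ ≃ₗᵢ[ℂ] End.eigenspace (B : 𝔼 →ₗ[ℂ] 𝔼) ν)) :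
    Nonempty (End.eigenspace (directSum A B : Augmented H n →ₗ[ℂ] Augmented H n) μ ≃ₗᵢ[ℂ]
      End.eigenspace (directSum A B : Augmented H n →ₗ[ℂ] Augmented H n) ν) := by
  obtain ⟨f⟩ := hA
  obtain ⟨g⟩ := hB
  have hmem : ∀ (μ : ℂ) (x : Augmented H n),
      x ∈ End.eigenspace (directSum A B : Augmented H n →ₗ[ℂ] Augmented H n) μ ↔
      x.fst ∈ End.eigenspace (A : H →ₗ[ℂ] H) μ ∧ x.snd ∈ End.eigenspace (B : 𝔼 →ₗ[ℂ] 𝔼) μ := by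
    intro μ x
    rw [End.mem_eigenspace_iff, End.mem_eigenspace_iff, End.mem_eigenspace_iff]
    exact directSum_apply_eq_smul_iff
  refine ⟨⟨?_, ?_⟩⟩
  · refine
      { toFun := fun x => ⟨WithLp.toLp 2 ((f ⟨_, ((hmem μ x).mp x.2).1⟩ : H),
          (g ⟨_, ((hmem μ x).mp x.2).2⟩ : 𝔼)), ?_⟩
        invFun := fun x => ⟨WithLp.toLp 2 ((f.symm ⟨_, ((hmem ν x).mp x.2).1⟩ : H),
          (g.symm ⟨_, ((hmem ν x).mp x.2).2⟩ : 𝔼)), ?_⟩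
        map_add' := fun x y => ?_
        map_smul' := fun c x => ?_
        left_inv := fun x => ?_
        right_inv := fun x => ?_ }
    · exact (hmem ν _).mpr ⟨Subtype.prop _, Subtype.prop _⟩
    · ext1
      have h1 := congrArg Subtype.val (map_add f ⟨_, ((hmem μ x).mp x.2).1⟩
        ⟨_, ((hmem μ y).mp y.2).1⟩)
      have h2 := congrArg Subtype.val (map_add g ⟨_, ((hmem μ x).mp x.2).2⟩
        ⟨_, ((hmem μ y).mp y.2).2⟩)
      exact congrArg (WithLp.toLp 2) (Prod.ext h1 h2)
    · ext1
      have h1 := congrArg Subtype.val (map_smul f c ⟨_, ((hmem μ x).mp x.2).1⟩)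
      have h2 := congrArg Subtype.val (map_smul g c ⟨_, ((hmem μ x).mp x.2).2⟩)
      exact congrArg (WithLp.toLp 2) (Prod.ext h1 h2)
    · exact (hmem μ _).mpr ⟨Subtype.prop _, Subtype.prop _⟩
    · ext1
      have h1 := congrArg Subtype.val (f.symm_apply_apply ⟨_, ((hmem μ x).mp x.2).1⟩)
      have h2 := congrArg Subtype.val (g.symm_apply_apply ⟨_, ((hmem μ x).mp x.2).2⟩)
      exact congrArg (WithLp.toLp 2) (Prod.ext h1 h2)
    · ext1
      have h1 := congrArg Subtype.val (f.apply_symm_apply ⟨_, ((hmem ν x).mp x.2).1⟩)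
      have h2 := congrArg Subtype.val (g.apply_symm_apply ⟨_, ((hmem ν x).mp x.2).2⟩)
      exact congrArg (WithLp.toLp 2) (Prod.ext h1 h2)
  · intro x
    change ‖WithLp.toLp 2 ((f ⟨_, ((hmem μ x).mp x.2).1⟩ : H),
          (g ⟨_, ((hmem μ x).mp x.2).2⟩ : 𝔼))‖ = ‖(x : Augmented H n)‖
    rw [WithLp.prod_norm_eq_of_L2, WithLp.prod_norm_eq_of_L2]
    have h1 := f.norm_map ⟨_, ((hmem μ x).mp x.2).1⟩
    have h2 := g.norm_map ⟨_, ((hmem μ x).mp x.2).2⟩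
    rw [Submodule.coe_norm, Submodule.coe_norm] at h1 h2
    change √(‖((f ⟨_, ((hmem μ x).mp x.2).1⟩ : _) : H)‖ ^ 2
      + ‖((g ⟨_, ((hmem μ x).mp x.2).2⟩ : _) : 𝔼)‖ ^ 2) = _
    rw [h1, h2]

/-- Eigenspaces of the sum are orthogonal sums of eigenspaces. The condition `h` excludes
eigenvalues contributed by the new summand alone; these could have eigenspaces of too small a
dimension. -/
theorem IsSymmetryOperator.directSum {C : Conjugation H} {ε : ℤˣ} {S : H →L[ℂ] H}
    {S' : 𝔼 →L[ℂ] 𝔼} (hS : IsSymmetryOperator C ε S) (hS' : IsSymmetryOperator (stdConj n) ε S')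
    (h : ∀ μ : ℂ,
      End.HasEigenvalue (IndexPairing.directSum S S' : Augmented H n →ₗ[ℂ] Augmented H n) μ →
      End.HasEigenvalue (S : H →ₗ[ℂ] H) μ)
    (h' : ∀ μ ν : ℂ, End.HasEigenvalue (S : H →ₗ[ℂ] H) μ → End.HasEigenvalue (S : H →ₗ[ℂ] H) ν →
      Nonempty (End.eigenspace (S' : 𝔼 →ₗ[ℂ] 𝔼) μ ≃ₗᵢ[ℂ] End.eigenspace (S' : 𝔼 →ₗ[ℂ] 𝔼) ν)) :
    IsSymmetryOperator (C.augment n) ε (IndexPairing.directSum S S') where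
  real := by rw [augment_bar_directSum, hS.real, hS'.real]
  unitary := directSum_mem_unitary hS.unitary hS'.unitary
  sq := by rw [directSum_mul, hS.sq, hS'.sq, ← directSum_one, directSum_zsmul]
  eigenspaces μ ν hμ hν := nonempty_eigenspace_directSum
    (hS.eigenspaces μ ν (h μ hμ) (h ν hν)) (h' μ ν (h μ hμ) (h ν hν))

end DirectSum

section Zero

variable [CompleteSpace H]

theorem isSymmetryOperator_of_subsingleton {E : Type*} [NormedAddCommGroup E]
    [InnerProductSpace ℂ E] [CompleteSpace E] [Subsingleton E] (C : Conjugation E) (ε : ℤˣ)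
    (S : E →L[ℂ] E) : IsSymmetryOperator C ε S where
  real := by ext; exact Subsingleton.elim _ _
  unitary := ⟨by ext; exact Subsingleton.elim _ _, by ext; exact Subsingleton.elim _ _⟩
  sq := by ext; exact Subsingleton.elim _ _
  eigenspaces μ ν h := by
    obtain ⟨x, hx⟩ := h.exists_hasEigenvector
    exact absurd (Subsingleton.elim _ _) hx.2

theorem isPairing_of_subsingleton {E : Type*} [NormedAddCommGroup E]
    [InnerProductSpace ℂ E] [CompleteSpace E] [Subsingleton E] (C : Conjugation E)
    (s : Symmetries E) (j : Fin 8) (d : Column) (P F : E →L[ℂ] E) : IsPairing C s j d P F := by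
  have h : ∀ A B : E →L[ℂ] E, A = B := fun A B => by ext; exact Subsingleton.elim _ _
  refine ⟨⟨h _ _, h _ _⟩, ⟨h _ _, h _ _⟩, ?_, fun k _ => ?_, ?_, h _ _, fun _ _ => h _ _, h _ _,
    isFredholm_of_isUnit ?_⟩
  · cases rowKind j <;> exact h _ _
  · cases k <;> exact h _ _
  · cases d <;> exact h _ _
  · rw [h (pairingOp P F) 1]
    exact isUnit_one

instance : Subsingleton (EuclideanSpace ℂ (Fin 0)) :=
  ⟨fun x y => by ext i; exact i.elim0⟩

theorem IsSymmetryOperator.directSum_zero {C : Conjugation H} {ε : ℤˣ} {S : H →L[ℂ] H}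
    (hS : IsSymmetryOperator C ε S)
    (S' : EuclideanSpace ℂ (Fin 0) →L[ℂ] EuclideanSpace ℂ (Fin 0)) :
    IsSymmetryOperator (C.augment 0) ε (IndexPairing.directSum S S') := by
  refine hS.directSum (isSymmetryOperator_of_subsingleton _ _ _) (fun μ hμ => ?_)
    fun μ ν _ _ => ⟨⟨0, fun x => ?_⟩⟩
  · obtain ⟨x, hx, hx0⟩ := hμ.exists_hasEigenvector
    rw [End.mem_eigenspace_iff] at hx
    have h1 := (directSum_apply_eq_smul_iff.mp hx).1
    refine End.hasEigenvalue_of_hasEigenvector (x := x.fst)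
      ⟨End.mem_eigenspace_iff.mpr h1, fun h0 => hx0 ?_⟩
    calc x = WithLp.toLp 2 (x.fst, x.snd) := rfl
      _ = 0 := by
        rw [h0, Subsingleton.elim x.snd 0]
        rfl
  · rw [Subsingleton.elim x 0, map_zero, norm_zero, norm_zero]

/-- A class of pairings which can be deformed to pairings with an even-dimensional kernel is
trivializable. -/
theorem isTrivializable_of_joinedIn_augment {C : Conjugation H} {s : Symmetries H} {j : Fin 8}
    {d : Column} {P F : H →L[ℂ] H} {n : ℕ} {s' : Symmetries (EuclideanSpace ℂ (Fin n))}
    {P' : EuclideanSpace ℂ (Fin n) →L[ℂ] EuclideanSpace ℂ (Fin n)}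
    (hs' : s'.Admissible (stdConj n) j d) (hs : (s.augment s').Admissible (C.augment n) j d)
    {q : (Augmented H n →L[ℂ] Augmented H n) × (Augmented H n →L[ℂ] Augmented H n)}
    (hq : JoinedIn {q | IsPairing (C.augment n) (s.augment s') j d q.1 q.2}
      (directSum P P', directSum F 1) q)
    (heven : Even (finrank ℂ (pairingOp q.1 q.2).ker)) : IsTrivializable C s j d P F := by
  obtain ⟨γ, hγ⟩ := hq
  refine ⟨n, s', P', fun t => (γ t).1, fun t => (γ t).2, hs', hs,
    ⟨γ.continuous.fst, γ.continuous.snd, hγ⟩, by simp, by simp, ?_⟩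
  change index2 (pairingOp (γ 1).1 (γ 1).2) = 0
  rw [γ.target, index2]
  exact (ZMod.natCast_eq_zero_iff_even).mpr heven

/-- When the deformation already exists on `H`, the zero-dimensional summand serves as augmentation.
-/
theorem isTrivializable_of_joinedIn {C : Conjugation H} {s : Symmetries H} {j : Fin 8}
    {d : Column} (hs : s.Admissible C j d) {P F : H →L[ℂ] H} {q : (H →L[ℂ] H) × (H →L[ℂ] H)}
    (hq : JoinedIn {q | IsPairing C s j d q.1 q.2} (P, F) q)
    (heven : Even (finrank ℂ (pairingOp q.1 q.2).ker)) : IsTrivializable C s j d P F := by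
  set s' : Symmetries (EuclideanSpace ℂ (Fin 0)) := ⟨1, 1, 1⟩
  have hc : Continuous fun q : (H →L[ℂ] H) × (H →L[ℂ] H) =>
      (directSum q.1 (1 : EuclideanSpace ℂ (Fin 0) →L[ℂ] _),
        directSum q.2 (1 : EuclideanSpace ℂ (Fin 0) →L[ℂ] _)) :=
    ((continuous_directSum_left _).comp continuous_fst).prodMk
      ((continuous_directSum_left _).comp continuous_snd)
  have hs'0 : s'.Admissible (stdConj 0) j d :=
    ⟨isSymmetryOperator_of_subsingleton _ _ _, isSymmetryOperator_of_subsingleton _ _ _,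
      Commute.one_left _, fun _ _ => isSymmetryOperator_of_subsingleton _ _ _,
      fun _ _ => ⟨Commute.one_left _, Commute.one_left _⟩⟩
  have hjoin := hq.map hc
  refine isTrivializable_of_joinedIn_augment (P' := 1) hs'0
    ⟨hs.symm_S.directSum_zero _, hs.symm_Sigma.directSum_zero _,
      commute_directSum hs.comm hs'0.comm, fun k hk => (hs.symm_Shat k hk).directSum_zero _,
      fun k hk => ⟨commute_directSum (hs.comm_hat k hk).1 (Commute.one_left _),
        commute_directSum (hs.comm_hat k hk).2 (Commute.one_left _)⟩⟩
    (hjoin.mono ?_) ?_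
  · rintro _ ⟨q, hq, rfl⟩
    exact hq.augment (isPairing_of_subsingleton _ _ _ _ _ _)
  · rw [pairingOp_directSum]
    have : pairingOp (1 : EuclideanSpace ℂ (Fin 0) →L[ℂ] _) 1 = 1 := by simp [pairingOp]
    rw [this, finrank_ker_directSum_one]
    exact heven

end Zero

end Augmentations

/-! ### Deformations of pairings by Cayley transforms. -/

section CayleyDeformations

variable {H : Type*} [NormedAddCommGroup H] [InnerProductSpace ℂ H] [CompleteSpace H]

section Cayley

variable {X X' : H →L[ℂ] H}

/-- The operator iX is self-adjoint and has real spectrum, whereas i/θ is not real. -/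
theorem isUnit_one_sub_smul (hX : star X = -X) (θ : ℝ) : IsUnit (1 - (θ : ℂ) • X) := by
  rcases eq_or_ne θ 0 with rfl | hθ
  · simp
  · have hA : IsSelfAdjoint (Complex.I • X) := by
      rw [isSelfAdjoint_iff, star_smul, hX]
      simp
    have h : Complex.I / θ ∉ spectrum ℂ (Complex.I • X) := fun hmem => by
      have := hA.im_eq_zero_of_mem_spectrum hmem
      simp [hθ] at this
    rw [spectrum.mem_iff, not_not] at h
    have hθ' : (θ : ℂ) ≠ 0 := by exact_mod_cast hθ
    have h2 : algebraMap ℂ (H →L[ℂ] H) (Complex.I / θ) - Complex.I • X =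
        (Complex.I / θ) • (1 - (θ : ℂ) • X) := by
      rw [Algebra.algebraMap_eq_smul_one, smul_sub, smul_smul, div_mul_cancel₀ _ hθ']
    rw [h2] at h
    have hne : Complex.I / θ ≠ 0 := div_ne_zero Complex.I_ne_zero hθ'
    exact (isUnit_smul_iff (Units.mk0 _ hne) (1 - (θ : ℂ) • X)).mp h

/-- The Cayley transform `(1 + θ X) (1 - θ X)⁻¹ = 2 (1 - θ X)⁻¹ - 1`. -/
def cayley (X : H →L[ℂ] H) (θ : ℝ) : H →L[ℂ] H := 2 * Ring.inverse (1 - (θ : ℂ) • X) - 1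

theorem continuous_inverse_one_sub_smul (hX : star X = -X) :
    Continuous fun θ : ℝ => Ring.inverse (1 - (θ : ℂ) • X) := by
  rw [continuous_iff_continuousAt]
  intro θ
  obtain ⟨u, hu⟩ := isUnit_one_sub_smul hX θ
  have h1 : ContinuousAt Ring.inverse (1 - (θ : ℂ) • X) := by
    rw [← hu]
    exact NormedRing.inverse_continuousAt u
  have h2 : Continuous fun θ : ℝ => 1 - (θ : ℂ) • X := by fun_prop
  exact ContinuousAt.comp (f := fun θ : ℝ => 1 - (θ : ℂ) • X) h1 h2.continuousAt

theorem continuous_cayley (hX : star X = -X) : Continuous (cayley X) :=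
  (continuous_const.mul (continuous_inverse_one_sub_smul hX)).sub continuous_const

theorem cayley_zero (X : H →L[ℂ] H) : cayley X 0 = 1 := by
  simp only [cayley, Complex.ofReal_zero, zero_smul, sub_zero, Ring.inverse_one]
  noncomm_ring

/-- The first-order form: the derivative at θ = 0 is 2X, and the remaining factor is continuous in
θ. -/
theorem cayley_eq_one_add (hX : star X = -X) (θ : ℝ) :
    cayley X θ = 1 + (θ : ℂ) • (2 * X * Ring.inverse (1 - (θ : ℂ) • X)) := by
  have h := Ring.mul_inverse_cancel _ (isUnit_one_sub_smul hX θ)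
  rw [sub_mul, one_mul, sub_eq_iff_eq_add, smul_mul_assoc] at h
  rw [cayley, mul_assoc, ← mul_smul_comm]
  nth_rewrite 1 [h]
  noncomm_ring

theorem star_cayley (hX : star X = -X) (θ : ℝ) : star (cayley X θ) = cayley (-X) θ := by
  rw [cayley, cayley, star_sub, star_mul, ← Ring.inverse_star, star_sub, star_smul, hX, star_one]
  have h2 : star (2 : H →L[ℂ] H) = 2 := by
    rw [← one_add_one_eq_two, star_add, star_one]
  rw [h2, Complex.star_def, Complex.conj_ofReal]
  noncomm_ring

theorem cayley_mul_cayley_neg (hX : star X = -X) (θ : ℝ) : cayley X θ * cayley (-X) θ = 1 := by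
  have hX' : star (-X) = -(-X) := by rw [star_neg, hX]
  have h1 := Ring.inverse_mul_cancel _ (isUnit_one_sub_smul hX θ)
  have h2 := Ring.mul_inverse_cancel _ (isUnit_one_sub_smul hX' θ)
  have e1 : cayley X θ = Ring.inverse (1 - (θ : ℂ) • X) * (1 - (θ : ℂ) • (-X)) := by
    have : (1 - (θ : ℂ) • (-X)) = 2 - (1 - (θ : ℂ) • X) := by
      rw [smul_neg, ← one_add_one_eq_two]
      abel
    rw [this, mul_sub, h1, cayley]
    noncomm_ring
  have e2 : cayley (-X) θ = (1 - (θ : ℂ) • X) * Ring.inverse (1 - (θ : ℂ) • (-X)) := by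
    have : (1 - (θ : ℂ) • X) = 2 - (1 - (θ : ℂ) • (-X)) := by
      rw [smul_neg, ← one_add_one_eq_two]
      abel
    rw [this, sub_mul, h2, cayley]
  calc cayley X θ * cayley (-X) θ
      = Ring.inverse (1 - (θ : ℂ) • X) * ((1 - (θ : ℂ) • (-X)) * (1 - (θ : ℂ) • X)) *
        Ring.inverse (1 - (θ : ℂ) • (-X)) := by rw [e1, e2]; noncomm_ring
    _ = Ring.inverse (1 - (θ : ℂ) • X) * ((1 - (θ : ℂ) • X) * (1 - (θ : ℂ) • (-X))) *
        Ring.inverse (1 - (θ : ℂ) • (-X)) := by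
      congr 2
      rw [smul_neg]
      generalize (θ : ℂ) • X = Y
      noncomm_ring
    _ = (Ring.inverse (1 - (θ : ℂ) • X) * (1 - (θ : ℂ) • X)) * ((1 - (θ : ℂ) • (-X)) *
        Ring.inverse (1 - (θ : ℂ) • (-X))) := by noncomm_ring
    _ = 1 := by rw [h1, h2, one_mul]

theorem cayley_mem_unitary (hX : star X = -X) (θ : ℝ) :
    cayley X θ ∈ unitary (H →L[ℂ] H) := by
  have hX' : star (-X) = -(-X) := by rw [star_neg, hX]
  rw [Unitary.mem_iff, star_cayley hX]
  refine ⟨?_, cayley_mul_cayley_neg hX θ⟩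
  have := cayley_mul_cayley_neg hX' θ
  rwa [neg_neg] at this

/-- The Cayley transform is a rational function of `X` with real coefficients. Only real homogeneity
of `f` is required, so linear and antilinear symmetries are treated together. -/
theorem map_cayley_apply (hX : star X = -X) (hX' : star X' = -X') (f : H →+ H)
    (hsmul : ∀ (θ : ℝ) x, f ((θ : ℂ) • x) = (θ : ℂ) • f x) (hf : ∀ x, f (X x) = X' (f x))
    (θ : ℝ) (x : H) : f (cayley X θ x) = cayley X' θ (f x) := by
  set G := Ring.inverse (1 - (θ : ℂ) • X) with hG
  set G' := Ring.inverse (1 - (θ : ℂ) • X') with hG'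
  have h1 : (1 - (θ : ℂ) • X) * G = 1 := Ring.mul_inverse_cancel _ (isUnit_one_sub_smul hX θ)
  have h2 : G' * (1 - (θ : ℂ) • X') = 1 := Ring.inverse_mul_cancel _ (isUnit_one_sub_smul hX' θ)
  have h3 : G x - (θ : ℂ) • X (G x) = x := congrArg (fun A : H →L[ℂ] H => A x) h1
  have h4 : ∀ y, G' (y - (θ : ℂ) • X' y) = y := fun y =>
    congrArg (fun A : H →L[ℂ] H => A y) h2
  have h5 : f (G x) = G' (f x) := by
    rw [← h4 (f (G x)), ← hf, ← hsmul, ← map_sub, h3]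
  have e : ∀ (A : H →L[ℂ] H) y, (2 * A - 1) y = A y + A y - y := fun A y => by
    rw [two_mul]
    rfl
  rw [cayley, cayley, ← hG, ← hG', e, e, map_sub, map_add, h5]

theorem commute_cayley (hX : star X = -X) {S : H →L[ℂ] H} (h : Commute S X) (θ : ℝ) :
    Commute S (cayley X θ) := by
  ext x
  exact map_cayley_apply hX hX (S : H →ₗ[ℂ] H).toAddMonoidHom (fun θ x => map_smul S _ _)
    (commute_apply h) θ x

theorem antilinear_cayley (hX : star X = -X) (J : H →ₛₗᵢ[starRingEnd ℂ] H)
    (h : ∀ x, J (X x) = X (J x)) (θ : ℝ) (x : H) :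
    J (cayley X θ x) = cayley X θ (J x) :=
  map_cayley_apply hX hX J.toLinearMap.toAddMonoidHom
    (fun θ x => (map_smulₛₗ J _ _).trans (by rw [Complex.conj_ofReal]; rfl)) h θ x

theorem antilinear_cayley_star (hX : star X = -X) (J : H → H) (hadd : ∀ x y, J (x + y) = J x + J y)
    (hsmul : ∀ (θ : ℝ) x, J ((θ : ℂ) • x) = (θ : ℂ) • J x)
    (h : ∀ x, J (X x) = -X (J x)) (θ : ℝ) (x : H) :
    J (cayley X θ x) = star (cayley X θ) (J x) := by
  rw [star_cayley hX]
  exact map_cayley_apply (X' := -X) hX (by rw [star_neg, hX]) (AddMonoidHom.mk' J hadd) hsmul h θ x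

theorem cayley_apply_of_apply_eq_zero (hX : star X = -X) (θ : ℝ) {x : H} (h : X x = 0) :
    cayley X θ x = x := by
  have h1 : Ring.inverse (1 - (θ : ℂ) • X) * (1 - (θ : ℂ) • X) = 1 :=
    Ring.inverse_mul_cancel _ (isUnit_one_sub_smul hX θ)
  have h2 : Ring.inverse (1 - (θ : ℂ) • X) (x - (θ : ℂ) • X x) = x :=
    congrArg (fun A : H →L[ℂ] H => A x) h1
  rw [h, smul_zero, sub_zero] at h2
  rw [cayley, two_mul]
  change Ring.inverse (1 - (θ : ℂ) • X) x + Ring.inverse (1 - (θ : ℂ) • X) x - x = x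
  rw [h2, add_sub_cancel_right]

/-- From (1 - X)(x + e) = 2x one reads off 2(1 - X)⁻¹x - x = e: at θ = 1 the transform is a quarter
turn in the plane of x and e. -/
theorem cayley_one_apply_of_rotation (hX : star X = -X) {x e : H} (h : X x = e) (h' : X e = -x) :
    cayley X 1 x = e := by
  have h1 : Ring.inverse (1 - ((1 : ℝ) : ℂ) • X) * (1 - ((1 : ℝ) : ℂ) • X) = 1 :=
    Ring.inverse_mul_cancel _ (isUnit_one_sub_smul hX 1)
  have h2 : Ring.inverse (1 - ((1 : ℝ) : ℂ) • X) ((x + e) - ((1 : ℝ) : ℂ) • X (x + e)) = x + e :=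
    congrArg (fun A : H →L[ℂ] H => A (x + e)) h1
  have h3 : (x + e) - ((1 : ℝ) : ℂ) • X (x + e) = x + x := by
    rw [map_add, h, h', Complex.ofReal_one, one_smul]
    abel
  rw [h3, map_add] at h2
  rw [cayley, two_mul]
  change Ring.inverse (1 - ((1 : ℝ) : ℂ) • X) x + Ring.inverse (1 - ((1 : ℝ) : ℂ) • X) x - x = e
  rw [h2, add_sub_cancel_left]

end Cayley

section Deformation

variable {C : Conjugation H} {s : Symmetries H} {j : Fin 8} {d : Column} {P F X : H →L[ℂ] H}

theorem joinedIn_of_real {Y : Type*} [TopologicalSpace Y] {A : Set Y} {f : ℝ → Y}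
    (hf : Continuous f) {θ : ℝ} (h : ∀ t ∈ unitInterval, f (t * θ) ∈ A) :
    JoinedIn A (f 0) (f θ) := by
  refine JoinedIn.ofLine (f := fun t => f (t * θ)) (by fun_prop) (by simp) (by simp) ?_
  rintro _ ⟨t, ht, rfl⟩
  exact h t ht

/-- A generator of a deformation of the unitary of an index pairing. -/
structure IsUnitaryGenerator (C : Conjugation H) (s : Symmetries H) (j : Fin 8) (d : Column)
    (F X : H →L[ℂ] H) : Prop where
  skew : star X = -X
  comm_S : Commute s.S X
  comm_Shat : ∀ k ∈ rowKindHat j, Commute s.Shat X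
  anti_bar : d = .d4 ∨ d = .d8 →
    ∀ x, s.Sigma (C.toIsometry (X x)) = X (s.Sigma (C.toIsometry x))
  anti_transpose : d = .d2 ∨ d = .d6 →
    ∀ x, star F (s.Sigma (C.toIsometry (X x))) = -X (star F (s.Sigma (C.toIsometry x)))

/-- Let W be the Cayley transform. In the columns 4 and 8, ΣC commutes with W. In the columns 2 and
6, F*ΣC anticommutes with X, so F*ΣCW = W*F*ΣC, which is the relation for FW. -/
theorem IsUnitaryGenerator.isPairing (hX : IsUnitaryGenerator C s j d F X)
    (hs : s.Admissible C j d) (h : IsPairing C s j d P F) {θ : ℝ}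
    (hfr : (pairingOp P (F * cayley X θ)).IsFredholm) :
    IsPairing C s j d P (F * cayley X θ) where
  projection := h.projection
  unitary := mul_mem h.unitary (cayley_mem_unitary hX.skew θ)
  rel_S := h.rel_S
  rel_Shat := h.rel_Shat
  rel_Sigma := by
    have hd : (d = .d4 ∨ d = .d8) ∨ (d = .d2 ∨ d = .d6) := by cases d <;> simp
    rcases hd with hd | hd
    · rw [Column.relation_iff_of_bar hs.symm_Sigma hd]
      have h1 := (Column.relation_iff_of_bar hs.symm_Sigma hd F).mp h.rel_Sigma
      intro x
      refine (h1 _).trans (congrArg F ?_)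
      exact antilinear_cayley hX.skew (C.twist hs.symm_Sigma.unitary) (hX.anti_bar hd) θ x
    · rw [Column.relation_iff_of_transpose hs.symm_Sigma hd]
      have h1 := (Column.relation_iff_of_transpose hs.symm_Sigma hd F).mp h.rel_Sigma
      intro x
      refine (h1 _).trans ?_
      rw [star_mul]
      exact antilinear_cayley_star hX.skew
        (fun x => star F (C.twist hs.symm_Sigma.unitary x)) (fun x y => by simp)
        (fun θ x => by rw [map_smulₛₗ, map_smul, Complex.conj_ofReal]) (hX.anti_transpose hd) θ x
  comm_S_F := h.comm_S_F.mul_right (commute_cayley hX.skew hX.comm_S θ)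
  comm_Shat_F k hk := (h.comm_Shat_F k hk).mul_right
    (commute_cayley hX.skew (hX.comm_Shat k hk) θ)
  comm_Sigma_P := h.comm_Sigma_P
  fredholm := hfr

theorem IsUnitaryGenerator.joinedIn (hX : IsUnitaryGenerator C s j d F X)
    (hs : s.Admissible C j d) (h : IsPairing C s j d P F) {θ : ℝ}
    (hfr : ∀ t ∈ unitInterval, (pairingOp P (F * cayley X (t * θ))).IsFredholm) :
    JoinedIn {q | IsPairing C s j d q.1 q.2} (P, F) (P, F * cayley X θ) := by
  have hc : Continuous fun θ => (P, F * cayley X θ) :=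
    continuous_const.prodMk (continuous_const.mul (continuous_cayley hX.skew))
  have := joinedIn_of_real (A := {q : (H →L[ℂ] H) × (H →L[ℂ] H) | IsPairing C s j d q.1 q.2})
      hc (θ := θ)
    fun t ht => hX.isPairing hs h (hfr t ht)
  simpa only [cayley_zero, mul_one] using this

theorem exists_forall_unitInterval_of_eventually {p : ℝ → Prop} (h : ∀ᶠ θ in nhds 0, p θ) :
    ∃ ε > 0, ∀ θ, 0 ≤ θ → θ < ε → ∀ t ∈ unitInterval, p (t * θ) := by
  obtain ⟨ε, hε, h⟩ := Metric.eventually_nhds_iff.mp h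
  refine ⟨ε, hε, fun θ h0 hθ t ht => h ?_⟩
  rw [Real.dist_eq, sub_zero, abs_of_nonneg (mul_nonneg ht.1 h0)]
  exact (mul_le_of_le_one_left h0 ht.2).trans_lt hθ

/-- The parameter must be nonzero, so that the kernel has shrunk, and so small that the whole
segment leading to it stays Fredholm. -/
theorem exists_pos_of_eventually {p : ℝ → Prop} {q : ℝ → Prop} (h : ∀ᶠ θ in nhds 0, p θ)
    (h' : ∀ᶠ θ in nhds (0 : ℝ), θ ≠ 0 → q θ) : ∃ θ : ℝ, q θ ∧ ∀ t ∈ unitInterval, p (t * θ) := by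
  obtain ⟨ε, hε, h⟩ := exists_forall_unitInterval_of_eventually h
  obtain ⟨ε', hε', h'⟩ := Metric.eventually_nhds_iff.mp h'
  have hpos : 0 < min ε ε' / 2 := half_pos (lt_min hε hε')
  have hlt : min ε ε' / 2 < min ε ε' := half_lt_self (lt_min hε hε')
  refine ⟨min ε ε' / 2, h' ?_ hpos.ne', h _ hpos.le (hlt.trans_le (min_le_left _ _))⟩
  rw [Real.dist_eq, sub_zero, abs_of_pos hpos]
  exact hlt.trans_le (min_le_right _ _)

theorem eventually_isFredholm_pairingOp {P F : ℝ → H →L[ℂ] H} (hP : Continuous P)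
    (hF : Continuous F) (h : (pairingOp (P 0) (F 0)).IsFredholm) :
    ∀ᶠ θ in nhds 0, (pairingOp (P θ) (F θ)).IsFredholm :=
  (continuous_pairingOp.comp (hP.prodMk hF)).continuousAt.eventually
    (ContinuousLinearMap.IsFredholm.isOpen.mem_nhds h)

/-- The derivative of the pairing operator at θ = 0 is 2PFXP. As `P` fixes x and y, its matrix
element between them is 2⟨y, FXx⟩. -/
theorem IsUnitaryGenerator.exists_finrank_ker_lt (hX : IsUnitaryGenerator C s j d F X)
    (hs : s.Admissible C j d) (h : IsPairing C s j d P F) {x y : H}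
    (hx : pairingOp P F x = 0) (hy : star (pairingOp P F) y = 0)
    (hxy : inner ℂ y (F (X x)) ≠ 0) :
    ∃ q, JoinedIn {q | IsPairing C s j d q.1 q.2} (P, F) q ∧
      finrank ℂ (pairingOp q.1 q.2).ker < finrank ℂ (pairingOp P F).ker := by
  set E : ℝ → H →L[ℂ] H := fun θ =>
    P * F * (2 * X * Ring.inverse (1 - (θ : ℂ) • X)) * P with hE
  have hEc : Continuous E :=
    (continuous_const.mul (continuous_const.mul (continuous_inverse_one_sub_smul hX.skew))).mul
      continuous_const
  have hT : ∀ θ : ℝ, pairingOp P F + (θ : ℂ) • E θ = pairingOp P (F * cayley X θ) := by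
    intro θ
    rw [pairingOp, pairingOp, cayley_eq_one_add hX.skew, hE]
    simp only [mul_add, add_mul, mul_one, mul_smul_comm, smul_mul_assoc, ← mul_assoc]
    abel
  have hx' := (pairingOp_apply_eq_zero_iff h.projection x).mp hx
  have hy' := (star_pairingOp_apply_eq_zero_iff h.projection y).mp hy
  have hne : inner ℂ y (E 0 x) ≠ 0 := by
    have : E 0 x = P (F (X x)) + P (F (X x)) := by
      simp only [hE, Complex.ofReal_zero, zero_smul, sub_zero, Ring.inverse_one, mul_one, two_mul,
        add_mul, mul_add]
      change P (F (X (P x))) + P (F (X (P x))) = _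
      rw [hx'.1]
    rw [this, inner_add_right, ← h.projection.inner_apply, hy'.1, ← two_mul]
    exact mul_ne_zero two_ne_zero hxy
  have h1 := h.fredholm.eventually_finrank_ker_lt hEc.continuousAt hx hy hne
  have h2 := eventually_isFredholm_pairingOp (P := fun _ => P) (F := fun θ => F * cayley X θ)
    continuous_const (continuous_const.mul (continuous_cayley hX.skew))
    (by rw [cayley_zero, mul_one]; exact h.fredholm)
  obtain ⟨θ, hθ, hfr⟩ := exists_pos_of_eventually
    (q := fun θ => finrank ℂ (pairingOp P (F * cayley X θ)).ker < finrank ℂ (pairingOp P F).ker)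
    h2 (h1.mono fun θ h hθ => by rw [← hT]; exact h hθ)
  exact ⟨_, hX.joinedIn hs h hfr, hθ⟩

/-- A generator of a deformation of the projection of an index pairing. -/
structure IsProjectionGenerator (C : Conjugation H) (s : Symmetries H) (j : Fin 8)
    (X : H →L[ℂ] H) : Prop where
  skew : star X = -X
  comm_Sigma : Commute s.Sigma X
  comm_S : ∀ x, s.S (C.toIsometry (X x)) = X (s.S (C.toIsometry x))
  comm_Shat : ∀ k ∈ rowKindHat j, ∀ x, s.Shat (C.toIsometry (X x)) = X (s.Shat (C.toIsometry x))

theorem _root_.IsStarProjection.conj_unitary {W : H →L[ℂ] H} (hP : IsStarProjection P)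
    (hW : W ∈ unitary (H →L[ℂ] H)) : IsStarProjection (W * P * star W) where
  isIdempotentElem := by
    change W * P * star W * (W * P * star W) = _
    calc W * P * star W * (W * P * star W) = W * P * (star W * W) * P * star W := by noncomm_ring
      _ = W * (P * P) * star W := by rw [Unitary.star_mul_self_of_mem hW]; noncomm_ring
      _ = _ := by rw [hP.isIdempotentElem.eq]
  isSelfAdjoint := by
    change star _ = _
    rw [star_mul, star_mul, star_star, hP.isSelfAdjoint.star_eq, mul_assoc]

theorem Kind.relation_conj_unitary {k : Kind} {S W : H →L[ℂ] H}
    (hS : IsSymmetryOperator C k.sign S) (hW : W ∈ unitary (H →L[ℂ] H))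
    (hJ : ∀ x, C.twist hS.unitary (W x) = W (C.twist hS.unitary x))
    (h : k.Relation C S P) : k.Relation C S (W * P * star W) := by
  have hJ' : ∀ x, C.twist hS.unitary (star W x) = star W (C.twist hS.unitary x) := fun x => by
    conv_rhs => rw [← unitary_apply_star hW x, hJ, unitary_star_apply hW]
  have hk : (k = .R ∨ k = .Q) ∨ (k = .O ∨ k = .S) := by cases k <;> simp
  rcases hk with hk | hk
  · rw [Kind.relation_iff_of_preserves hS hk] at h ⊢
    intro x
    change C.twist hS.unitary (W (P (star W x))) = W (P (star W (C.twist hS.unitary x)))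
    rw [hJ, h, hJ']
  · rw [Kind.relation_iff_of_flips hS hk] at h ⊢
    intro x
    change C.twist hS.unitary (W (P (star W x))) = _ - W (P (star W (C.twist hS.unitary x)))
    rw [hJ, h, hJ', map_sub, unitary_apply_star hW]

/-- Moving `P` by W is unitarily equivalent to keeping `P` and replacing F by W*FW, which allows
kernels to be compared with `P` fixed. -/
theorem pairingOp_conj_unitary {W : H →L[ℂ] H} (hW : W ∈ unitary (H →L[ℂ] H)) :
    pairingOp (W * P * star W) F = W * pairingOp P (star W * F * W) * star W := by
  rw [pairingOp, pairingOp, mul_sub, mul_add, sub_mul, add_mul, mul_one,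
    Unitary.mul_star_self_of_mem hW]
  noncomm_ring

theorem finrank_ker_conj_unitary {W : H →L[ℂ] H} (hW : W ∈ unitary (H →L[ℂ] H))
    (T : H →L[ℂ] H) : finrank ℂ (W * T * star W).ker = finrank ℂ T.ker := by
  refine LinearEquiv.finrank_eq
    { toFun := fun x => ⟨star W x, ?_⟩
      invFun := fun x => ⟨W x, ?_⟩
      map_add' := fun x y => Subtype.ext (map_add _ _ _)
      map_smul' := fun c x => Subtype.ext (map_smul _ _ _)
      left_inv := fun x => Subtype.ext (unitary_apply_star hW _)
      right_inv := fun x => Subtype.ext (unitary_star_apply hW _) }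
  · exact unitary_apply_eq_zero hW x.2
  · change W (T (star W (W x))) = 0
    rw [unitary_star_apply hW, show T x = 0 from x.2, map_zero]

theorem IsProjectionGenerator.isPairing (hX : IsProjectionGenerator C s j X)
    (hs : s.Admissible C j d) (h : IsPairing C s j d P F) {θ : ℝ}
    (hfr : (pairingOp (cayley X θ * P * star (cayley X θ)) F).IsFredholm) :
    IsPairing C s j d (cayley X θ * P * star (cayley X θ)) F where
  projection := h.projection.conj_unitary (cayley_mem_unitary hX.skew θ)
  unitary := h.unitary
  rel_S := Kind.relation_conj_unitary hs.symm_S (cayley_mem_unitary hX.skew θ)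
    (antilinear_cayley hX.skew _ hX.comm_S θ) h.rel_S
  rel_Shat k hk := Kind.relation_conj_unitary (hs.symm_Shat k hk) (cayley_mem_unitary hX.skew θ)
    (antilinear_cayley hX.skew _ (hX.comm_Shat k hk) θ) (h.rel_Shat k hk)
  rel_Sigma := h.rel_Sigma
  comm_S_F := h.comm_S_F
  comm_Shat_F := h.comm_Shat_F
  comm_Sigma_P := by
    have h1 := commute_cayley hX.skew hX.comm_Sigma θ
    exact (h1.mul_right h.comm_Sigma_P).mul_right
      (commute_star_of_mem_unitary (cayley_mem_unitary hX.skew θ) h1)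
  fredholm := hfr

/-- For the equivalent path W*FW with fixed `P` the derivative is 2P(FX - XF)P; hence the commutator
in the nonvanishing condition. -/
theorem IsProjectionGenerator.exists_finrank_ker_lt (hX : IsProjectionGenerator C s j X)
    (hs : s.Admissible C j d) (h : IsPairing C s j d P F) {x y : H}
    (hx : pairingOp P F x = 0) (hy : star (pairingOp P F) y = 0)
    (hxy : inner ℂ y (F (X x)) - inner ℂ y (X (F x)) ≠ 0) :
    ∃ θ, JoinedIn {q | IsPairing C s j d q.1 q.2} (P, F)
        (cayley X θ * P * star (cayley X θ), F) ∧
      finrank ℂ (pairingOp (cayley X θ * P * star (cayley X θ)) F).ker <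
        finrank ℂ (pairingOp P F).ker := by
  set G : ℝ → H →L[ℂ] H := fun θ => 2 * X * Ring.inverse (1 - (θ : ℂ) • X) with hG
  have hGc : Continuous G :=
    continuous_const.mul (continuous_inverse_one_sub_smul hX.skew)
  have hW : ∀ θ : ℝ, cayley X θ = 1 + (θ : ℂ) • G θ := cayley_eq_one_add hX.skew
  have hWs : ∀ θ : ℝ, star (cayley X θ) = 1 + (θ : ℂ) • star (G θ) := fun θ => by
    rw [hW, star_add, star_one, star_smul, Complex.star_def, Complex.conj_ofReal]
  have hG0 : G 0 = X + X := by simp [hG, two_mul]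
  set E : ℝ → H →L[ℂ] H := fun θ =>
    P * (star (G θ) * F + F * G θ + (θ : ℂ) • (star (G θ) * F * G θ)) * P with hE
  have hEc : Continuous E := by
    have := hGc.star
    fun_prop
  have hT : ∀ θ : ℝ, pairingOp P F + (θ : ℂ) • E θ =
      pairingOp P (star (cayley X θ) * F * cayley X θ) := by
    intro θ
    rw [pairingOp, pairingOp, hWs, hW, hE]
    simp only [mul_add, add_mul, mul_one, one_mul, mul_smul_comm, smul_mul_assoc, ← mul_assoc,
      smul_add]
    abel
  have hx' := (pairingOp_apply_eq_zero_iff h.projection x).mp hx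
  have hy' := (star_pairingOp_apply_eq_zero_iff h.projection y).mp hy
  have hne : inner ℂ y (E 0 x) ≠ 0 := by
    have : E 0 x = P ((F (X x) - X (F x)) + (F (X x) - X (F x))) := by
      have h2 : star (G 0) = -(X + X) := by
        rw [hG0, star_add, hX.skew]
        abel
      have h3 : E 0 = P * (-(X + X) * F + F * (X + X)) * P := by
        simp only [hE, h2]
        rw [hG0, Complex.ofReal_zero, zero_smul, add_zero]
      rw [h3]
      change P (-(X (F (P x)) + X (F (P x))) + F (X (P x) + X (P x))) = _
      rw [hx'.1, map_add F]
      congr 1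
      abel
    rw [this, ← h.projection.inner_apply, hy'.1, inner_add_right, inner_sub_right, ← two_mul]
    exact mul_ne_zero two_ne_zero hxy
  have h1 := h.fredholm.eventually_finrank_ker_lt hEc.continuousAt hx hy hne
  have hWc := continuous_cayley hX.skew
  have hWc' := hWc.star
  have h2 := eventually_isFredholm_pairingOp
    (P := fun θ => cayley X θ * P * star (cayley X θ)) (F := fun _ => F)
    ((hWc.mul continuous_const).mul hWc') continuous_const
    (by rw [cayley_zero, star_one, mul_one, one_mul]; exact h.fredholm)
  obtain ⟨θ, hθ, hfr⟩ := exists_pos_of_eventually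
    (q := fun θ => finrank ℂ (pairingOp P (star (cayley X θ) * F * cayley X θ)).ker <
      finrank ℂ (pairingOp P F).ker)
    h2 (h1.mono fun θ h hθ => by rw [← hT]; exact h hθ)
  refine ⟨θ, ?_, ?_⟩
  · have hc : Continuous fun θ => (cayley X θ * P * star (cayley X θ), F) :=
      ((hWc.mul continuous_const).mul hWc').prodMk continuous_const
    have := joinedIn_of_real (A := {q : (H →L[ℂ] H) × (H →L[ℂ] H) | IsPairing C s j d q.1 q.2})
      hc (θ := θ)
      fun t ht => hX.isPairing hs h (hfr t ht)
    simpa only [cayley_zero, star_one, mul_one, one_mul] using this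
  · rw [pairingOp_conj_unitary (cayley_mem_unitary hX.skew θ),
      finrank_ker_conj_unitary (cayley_mem_unitary hX.skew θ)]
    exact hθ

end Deformation

end CayleyDeformations

/-! ### Descent on the kernel dimension and generators that lower it. -/

section Drops

variable {H : Type*} [NormedAddCommGroup H] [InnerProductSpace ℂ H] [CompleteSpace H]

variable {C : Conjugation H} {s : Symmetries H} {j : Fin 8} {d : Column} {P F : H →L[ℂ] H}

/-- Each drop is strict, so strong induction on the dimension of the kernel terminates; the paths
are concatenated. -/
theorem exists_joinedIn_of_forall_exists_lt (good : (H →L[ℂ] H) × (H →L[ℂ] H) → Prop)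
    (hdrop : ∀ P F, IsPairing C s j d P F → ¬ good (P, F) →
      ∃ q, JoinedIn {q | IsPairing C s j d q.1 q.2} (P, F) q ∧
        finrank ℂ (pairingOp q.1 q.2).ker < finrank ℂ (pairingOp P F).ker)
    (h : IsPairing C s j d P F) :
    ∃ q, JoinedIn {q | IsPairing C s j d q.1 q.2} (P, F) q ∧ good q := by
  induction hn : finrank ℂ (pairingOp P F).ker using Nat.strong_induction_on generalizing P F with
  | _ n ih =>
    by_cases hg : good (P, F)
    · exact ⟨(P, F), JoinedIn.refl h, hg⟩
    · obtain ⟨q, hq, hlt⟩ := hdrop P F h hg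
      obtain ⟨q', hq', hg'⟩ := ih _ (hn ▸ hlt) hq.target_mem rfl
      exact ⟨q', hq.trans hq', hg'⟩

theorem isTrivializable_of_forall_exists_lt (hs : s.Admissible C j d)
    (hdrop : ∀ P F, IsPairing C s j d P F → ∀ x ≠ 0, pairingOp P F x = 0 →
      ∃ q, JoinedIn {q | IsPairing C s j d q.1 q.2} (P, F) q ∧
        finrank ℂ (pairingOp q.1 q.2).ker < finrank ℂ (pairingOp P F).ker)
    (h : IsPairing C s j d P F) : IsTrivializable C s j d P F := by
  suffices hodd : ∀ P F, IsPairing C s j d P F → ¬ Even (finrank ℂ (pairingOp P F).ker) →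
      ∃ q, JoinedIn {q | IsPairing C s j d q.1 q.2} (P, F) q ∧
        finrank ℂ (pairingOp q.1 q.2).ker < finrank ℂ (pairingOp P F).ker by
    obtain ⟨q, hq, hg⟩ := exists_joinedIn_of_forall_exists_lt
      (fun q => Even (finrank ℂ (pairingOp q.1 q.2).ker)) hodd h
    exact isTrivializable_of_joinedIn hs hq hg
  · intro P F h hne
    have hpos : finrank ℂ (pairingOp P F).ker ≠ 0 := fun h0 =>
      hne (by simp only [h0]; exact Even.zero)
    have := h.fredholm.finite_ker
    have := finrank_pos_iff.mp (Nat.pos_of_ne_zero hpos)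
    obtain ⟨x, hx⟩ := exists_ne (0 : (pairingOp P F).ker)
    exact hdrop P F h x (fun h0 => hx (Subtype.ext h0)) x.2

theorem isTrivializable_of_even (hs : s.Admissible C j d) (h : IsPairing C s j d P F)
    (heven : Even (finrank ℂ (pairingOp P F).ker)) : IsTrivializable C s j d P F :=
  isTrivializable_of_joinedIn hs (q := (P, F)) (JoinedIn.refl h) heven

section Hat

theorem twist_mul_apply {ε : ℤˣ} {S S' : H →L[ℂ] H} (hS : IsSymmetryOperator C ε S)
    (hS' : S' ∈ unitary (H →L[ℂ] H)) (hS'C : C.bar S' = S') (x : H) :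
    C.twist hS.unitary ((S * S') x) = (ε : ℤ) • C.twist hS' x := by
  rw [C.twist_apply, C.twist_apply]
  change S (C.toIsometry (S (S' x))) = _
  rw [hS.conj_apply, hS.apply_apply, C.map_apply, hS'C]

/-- S Ŝ is the composite of the antiunitaries S C and Ŝ C. One of them preserves `P` and the other
exchanges it with 1 - P. -/
theorem apply_apply_eq_of_kinds (hs : s.Admissible C j d) (h : IsPairing C s j d P F) {k : Kind}
    (hk : rowKindHat j = some k)
    (hkind : (rowKind j = .R ∨ rowKind j = .Q) ∧ (k = .O ∨ k = .S) ∨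
      (rowKind j = .O ∨ rowKind j = .S) ∧ (k = .R ∨ k = .Q)) (x : H) :
    (s.S * s.Shat) (P x) = (s.S * s.Shat) x - P ((s.S * s.Shat) x) := by
  have hS := hs.symm_S
  have hS' := hs.symm_Shat k hk
  have hV := twist_mul_apply hS hS'.unitary hS'.real
  apply (C.twist hS.unitary).injective
  rw [map_sub, hV]
  rcases hkind with ⟨h1, h2⟩ | ⟨h1, h2⟩
  · rw [(Kind.relation_iff_of_preserves hS h1 P).mp h.rel_S,
      (Kind.relation_iff_of_flips hS' h2 P).mp (h.rel_Shat k hk), hV, map_zsmul, smul_sub]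
  · rw [(Kind.relation_iff_of_flips hS h1 P).mp h.rel_S,
      (Kind.relation_iff_of_preserves hS' h2 P).mp (h.rel_Shat k hk), hV, map_zsmul,
      sub_sub_cancel]

theorem star_mul_of_isSymmetryOperator {ε ε' : ℤˣ} {S S' : H →L[ℂ] H}
    (hS : IsSymmetryOperator C ε S) (hS' : IsSymmetryOperator C ε' S') (h : Commute S S') :
    star (S * S') = ((ε * ε' : ℤˣ) : ℤ) • (S * S') := by
  have h1 : ∀ {ε : ℤˣ} {S : H →L[ℂ] H}, IsSymmetryOperator C ε S → star S = (ε : ℤ) • S := by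
    intro ε S hS
    have h2 : star S * (S * S) = S := by
      rw [← mul_assoc, Unitary.star_mul_self_of_mem hS.unitary, one_mul]
    rw [hS.sq, mul_smul_comm, mul_one] at h2
    rcases Int.units_eq_one_or ε with rfl | rfl
    · simpa using h2
    · simp only [Units.val_neg, Units.val_one, neg_smul, one_smul] at h2 ⊢
      exact neg_eq_iff_eq_neg.mp h2
  rw [star_mul, h1 hS, h1 hS', h.eq, smul_mul_smul_comm, mul_comm, Units.val_mul]

/-- V = SŜ commutes with `F` and exchanges P and 1 - P, so FVx is in the cokernel for every kernel
vector x. A scalar multiple cV is a generator, with matrix element c‖FVx‖². -/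
theorem exists_finrank_ker_lt_of_hat (hs : s.Admissible C j d) (h : IsPairing C s j d P F)
    {k : Kind} (hk : rowKindHat j = some k)
    (hkind : (rowKind j = .R ∨ rowKind j = .Q) ∧ (k = .O ∨ k = .S) ∨
      (rowKind j = .O ∨ rowKind j = .S) ∧ (k = .R ∨ k = .Q))
    (hd : (d = .d2 ∨ d = .d6) ∧ (rowKind j).sign * k.sign = 1 ∨
      (d = .d4 ∨ d = .d8) ∧ (rowKind j).sign * k.sign = -1) {x : H} (hx0 : x ≠ 0)
    (hx : pairingOp P F x = 0) :
    ∃ q, JoinedIn {q | IsPairing C s j d q.1 q.2} (P, F) q ∧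
      finrank ℂ (pairingOp q.1 q.2).ker < finrank ℂ (pairingOp P F).ker := by
  set V := s.S * s.Shat with hV
  have hS := hs.symm_S
  have hS' := hs.symm_Shat k hk
  have hcomm := hs.comm_hat k hk
  have hVstar := star_mul_of_isSymmetryOperator hS hS' hcomm.1
  have hVu : V ∈ unitary (H →L[ℂ] H) := mul_mem hS.unitary hS'.unitary
  have hVP := apply_apply_eq_of_kinds hs h hk hkind
  have hVF : Commute V F := h.comm_S_F.mul_left (h.comm_Shat_F k hk)
  have hVSig : Commute V s.Sigma := hs.comm.mul_left hcomm.2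
  have hVC : ∀ x, C.toIsometry (V x) = V (C.toIsometry x) := fun x => by
    change C.toIsometry (s.S (s.Shat x)) = s.S (s.Shat (C.toIsometry x))
    rw [hS.conj_apply, hS'.conj_apply]
  -- V is self-adjoint or skew-adjoint according to the product of the parities. The scalar i,
  -- respectively 1, makes cV skew-adjoint, and the column requires exactly this behavior of c under
  -- conjugation.
  obtain ⟨c, hc0, hcstar, hcbar, hctr⟩ : ∃ c : ℂ, c ≠ 0 ∧ star (c • V) = -(c • V) ∧
      (d = .d4 ∨ d = .d8 → starRingEnd ℂ c = c) ∧
      (d = .d2 ∨ d = .d6 → starRingEnd ℂ c = -c) := by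
    rcases hd with ⟨hd, hsign⟩ | ⟨hd, hsign⟩
    · refine ⟨Complex.I, Complex.I_ne_zero, ?_, ?_, fun _ => Complex.conj_I⟩
      · rw [star_smul, hVstar, hsign, Units.val_one, one_smul, Complex.star_def, Complex.conj_I,
          neg_smul]
      · rintro (rfl | rfl) <;> rcases hd with hd | hd <;> cases hd
    · refine ⟨1, one_ne_zero, ?_, fun _ => by simp, ?_⟩
      · rw [star_smul, hVstar, hsign, Units.val_neg, Units.val_one, neg_smul, one_smul, star_one,
          one_smul, one_smul]
      · rintro (rfl | rfl) <;> rcases hd with hd | hd <;> cases hd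
  have hx' := (pairingOp_apply_eq_zero_iff h.projection x).mp hx
  have hgen : IsUnitaryGenerator C s j d F (c • V) := by
    refine ⟨hcstar, ?_, ?_, ?_, ?_⟩
    · exact ((Commute.refl _).mul_right hcomm.1).smul_right c
    · intro k' hk'
      exact ((hs.comm_hat k' hk').1.symm.mul_right (Commute.refl _)).smul_right c
    · intro hd x
      change s.Sigma (C.toIsometry (c • V x)) = c • V (s.Sigma (C.toIsometry x))
      rw [map_smulₛₗ, hcbar hd, hVC, map_smul, ← commute_apply hVSig]
    · intro hd x
      change star F (s.Sigma (C.toIsometry (c • V x))) =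
        -(c • V (star F (s.Sigma (C.toIsometry x))))
      rw [map_smulₛₗ, hctr hd, hVC, map_smul, ← commute_apply hVSig, map_smul,
        ← commute_apply (commute_star_of_mem_unitary h.unitary hVF), neg_smul]
  refine hgen.exists_finrank_ker_lt hs h hx (y := F (V x)) ?_ ?_
  · rw [star_pairingOp_apply_eq_zero_iff h.projection, unitary_star_apply h.unitary]
    constructor
    · rw [← commute_apply hVF]
      have := hVP (F x)
      rw [hx'.2, map_zero] at this
      exact (sub_eq_zero.mp this.symm).symm
    · have := hVP x
      rw [hx'.1] at this
      exact sub_eq_self.mp this.symm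
  · change inner ℂ (F (V x)) (F (c • V x)) ≠ 0
    rw [map_smul, inner_smul_right]
    refine mul_ne_zero hc0 (inner_self_ne_zero.mpr fun h0 => hx0 ?_)
    exact unitary_apply_eq_zero hVu (unitary_apply_eq_zero h.unitary h0)

end Hat

section RankTwo

/-- The skew-adjoint operator `c |a⟩⟨x| - c̄ |x⟩⟨a|`. -/
def rankTwo (a x : H) (c : ℂ) : H →L[ℂ] H :=
  c • InnerProductSpace.rankOne ℂ a x - starRingEnd ℂ c • InnerProductSpace.rankOne ℂ x a

theorem rankTwo_apply (a x : H) (c : ℂ) (z : H) :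
    rankTwo a x c z = (c * inner ℂ x z) • a - (starRingEnd ℂ c * inner ℂ a z) • x := by
  rw [rankTwo, mul_smul, mul_smul]
  rfl

theorem star_rankTwo (a x : H) (c : ℂ) : star (rankTwo a x c) = -rankTwo a x c := by
  ext z
  refine ext_inner_left ℂ fun w => ?_
  change inner ℂ w (star (rankTwo a x c) z) = inner ℂ w (-(rankTwo a x c z))
  rw [inner_star_right, rankTwo_apply, rankTwo_apply]
  simp only [inner_sub_left, inner_sub_right, inner_smul_left, inner_smul_right, inner_neg_right,
    map_mul, inner_conj_symm, Complex.conj_conj]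
  ring

theorem inner_unitary {U : H →L[ℂ] H} (hU : U ∈ unitary (H →L[ℂ] H)) (x y : H) :
    inner ℂ (U x) (U y) = inner ℂ x y := by
  rw [← inner_star_right, unitary_star_apply hU]

theorem unitary_rankTwo {U : H →L[ℂ] H} (hU : U ∈ unitary (H →L[ℂ] H)) (a x : H) (c : ℂ)
    (z : H) : U (rankTwo a x c z) = rankTwo (U a) (U x) c (U z) := by
  rw [rankTwo_apply, rankTwo_apply, map_sub, map_smul, map_smul, inner_unitary hU,
    inner_unitary hU]

theorem antilinear_rankTwo (J : H →ₛₗᵢ[starRingEnd ℂ] H) (a x : H) (c : ℂ) (z : H) :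
    J (rankTwo a x c z) = rankTwo (J a) (J x) (starRingEnd ℂ c) (J z) := by
  rw [rankTwo_apply, rankTwo_apply, map_sub, map_smulₛₗ, map_smulₛₗ, map_mul, map_mul,
    inner_conj_symm, inner_conj_symm, inner_antilinear, inner_antilinear]

theorem rankTwo_swap (a x : H) (c : ℂ) : rankTwo x a (starRingEnd ℂ c) = -rankTwo a x c := by
  rw [rankTwo, rankTwo, Complex.conj_conj, neg_sub]

theorem rankTwo_smul_smul {ε ε' : ℂ} (hε : ε = 1 ∨ ε = -1) (hε' : ε' = 1 ∨ ε' = -1) (a x : H)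
    (c : ℂ) : rankTwo (ε • a) (ε' • x) c = (ε * ε') • rankTwo a x c := by
  ext z
  change _ = (ε * ε') • rankTwo a x c z
  rw [rankTwo_apply, rankTwo_apply]
  rcases hε with rfl | rfl <;> rcases hε' with rfl | rfl <;>
    simp [inner_neg_left, sub_eq_add_neg]

theorem inner_rankTwo (w a x : H) (c : ℂ) (z : H) : inner ℂ w (rankTwo a x c z) =
    c * (inner ℂ x z * inner ℂ w a) - starRingEnd ℂ c * (inner ℂ a z * inner ℂ w x) := by
  rw [rankTwo_apply, inner_sub_right, inner_smul_right, inner_smul_right, mul_assoc, mul_assoc]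

/-- Vanishing at c = 1 and at c = i would give α = β and α = -β. -/
theorem exists_mul_sub_conj_mul_ne_zero {α : ℂ} (hα : α ≠ 0) (β : ℂ) :
    ∃ c : ℂ, c * α - starRingEnd ℂ c * β ≠ 0 := by
  by_contra! h
  have h1 := h 1
  have h2 := h Complex.I
  rw [map_one, one_mul, one_mul] at h1
  rw [Complex.conj_I] at h2
  have h3 : Complex.I * (α + β) = 0 := by rw [← h2]; ring
  have h4 := (mul_eq_zero.mp h3).resolve_left Complex.I_ne_zero
  exact hα (by linear_combination (h1 + h4) / 2)

/-- A finite-rank skew-adjoint operator commuting with `S` which (anti)commutes with the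
antiunitary `J` and has a nonvanishing matrix element between `x` and `S J x`. -/
theorem exists_skew_of_antilinear {J : H →ₛₗᵢ[starRingEnd ℂ] H} {S : H →L[ℂ] H}
    (hS : S ∈ unitary (H →L[ℂ] H)) (hSJ : ∀ x, J (S x) = S (J x)) {ε σ : ℂ}
    (hε : ε = 1 ∨ ε = -1) (hσ : σ = 1 ∨ σ = -1) (hS2 : ∀ x, S (S x) = ε • x)
    (hJ2 : ∀ x, J (J x) = σ • x) {x z : H}
    (hx : inner ℂ x x * inner ℂ x x + inner ℂ (S x) x * inner ℂ (S x) x ≠ 0)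
    (hz : inner ℂ x z = 0) (hz' : inner ℂ (S x) z = 0) :
    ∃ X : H →L[ℂ] H, star X = -X ∧ Commute S X ∧ (∀ y, J (X y) = -((σ * ε) • X (J y))) ∧
      inner ℂ (S (J x)) (X x) - inner ℂ (S (J z)) (X z) ≠ 0 := by
  set a := S (J x) with ha
  clear_value a
  have hε2 : ε * ε = 1 := by rcases hε with rfl | rfl <;> norm_num
  have hSa : S a = ε • J x := by rw [ha, hS2]
  have h1 : inner ℂ (S (J z)) a = inner ℂ x z := by
    rw [ha, inner_unitary hS, inner_antilinear]
  have h1' : inner ℂ a a = inner ℂ x x := by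
    rw [ha, inner_unitary hS, inner_antilinear]
  have h2 : ∀ z, inner ℂ (S (J z)) (S a) = inner ℂ (S x) z := fun z => by
    rw [inner_unitary hS, ha, ← hSJ, inner_antilinear]
  -- In the matrix element the coefficient of c is ⟨x,x⟩² + ⟨Sx,x⟩². By orthogonality z only enters
  -- the coefficient of c̄, whose value is then irrelevant.
  obtain ⟨c, hc⟩ := exists_mul_sub_conj_mul_ne_zero hx
    (inner ℂ a x * inner ℂ a x + inner ℂ (S a) x * inner ℂ a (S x) -
      (inner ℂ a z * inner ℂ (S (J z)) x + inner ℂ (S a) z * inner ℂ (S (J z)) (S x)))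
  have hX : ∀ y, (rankTwo a x c + rankTwo (S a) (S x) c) y =
      rankTwo a x c y + rankTwo (S a) (S x) c y := fun y => rfl
  -- Adding the conjugate by S of the rank-two operator gives commutation with S, because S² = ±1.
  -- With a = SJx, the map J exchanges the two terms up to sign.
  refine ⟨rankTwo a x c + rankTwo (S a) (S x) c, ?_, ?_, ?_, ?_⟩
  · rw [star_add, star_rankTwo, star_rankTwo, neg_add]
  · ext y
    change S ((rankTwo a x c + rankTwo (S a) (S x) c) y) =
      (rankTwo a x c + rankTwo (S a) (S x) c) (S y)
    rw [hX, hX, map_add, unitary_rankTwo hS, unitary_rankTwo hS, hS2, hS2,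
      rankTwo_smul_smul hε hε, hε2, one_smul, add_comm]
  · intro y
    have e1 : J a = σ • S x := by rw [ha, hSJ, hJ2, map_smul]
    have e2 : J (S a) = (ε * σ) • x := by
      rw [hSa, map_smulₛₗ, hJ2, smul_smul]
      rcases hε with rfl | rfl <;> simp
    have e3 : rankTwo (S a) (S x) c = ε • rankTwo (J x) (S x) c := by
      rw [hSa]
      have := rankTwo_smul_smul hε (Or.inl rfl : (1 : ℂ) = 1 ∨ (1 : ℂ) = -1) (J x) (S x) c
      rwa [one_smul, mul_one] at this
    have e4 : rankTwo (σ • S x) (J x) (starRingEnd ℂ c) = -(σ • rankTwo (J x) (S x) c) := by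
      have := rankTwo_smul_smul hσ (Or.inl rfl : (1 : ℂ) = 1 ∨ (1 : ℂ) = -1) (S x) (J x)
        (starRingEnd ℂ c)
      rw [one_smul, mul_one, rankTwo_swap (J x) (S x)] at this
      rw [this, smul_neg]
    have hεσ : ε * σ = 1 ∨ ε * σ = -1 := by
      rcases hε with rfl | rfl <;> rcases hσ with rfl | rfl <;> simp
    have e5 : rankTwo ((ε * σ) • x) a (starRingEnd ℂ c) = -((ε * σ) • rankTwo a x c) := by
      have := rankTwo_smul_smul hεσ (Or.inl rfl : (1 : ℂ) = 1 ∨ (1 : ℂ) = -1) x a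
        (starRingEnd ℂ c)
      rw [one_smul, mul_one, rankTwo_swap a x] at this
      rw [this, smul_neg]
    rw [hX, map_add, antilinear_rankTwo, antilinear_rankTwo, e1, e2, hSJ x, ← ha, e3, e4, e5]
    change -(σ • rankTwo (J x) (S x) c (J y)) + -((ε * σ) • rankTwo a x c (J y)) =
      -((σ * ε) • (rankTwo a x c (J y) + ε • rankTwo (J x) (S x) c (J y)))
    rw [smul_add, smul_smul, mul_assoc, hε2, mul_one, mul_comm σ ε]
    abel
  · rw [hX, hX, inner_add_right, inner_add_right, inner_rankTwo, inner_rankTwo, inner_rankTwo,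
      inner_rankTwo, h1, h1', h2, hz, hz']
    rw [show inner ℂ a (S a) = inner ℂ (S x) x by rw [← h2 x, ← ha]]
    intro h0
    exact hc (by rw [← h0]; ring)

end RankTwo

end Drops

/-! ### Vanishing entries of the even rows. -/

section EvenRows

variable {H : Type*} [NormedAddCommGroup H] [InnerProductSpace ℂ H] [CompleteSpace H]

theorem inner_self_eq_ofReal (x : H) : inner ℂ x x = ((‖x‖ ^ 2 : ℝ) : ℂ) := by
  rw [inner_self_eq_norm_sq_to_K, Complex.ofReal_pow]
  rfl

/-- A unitary involution is self-adjoint, so ⟨Sx,x⟩ is real and its square cannot cancel ‖x‖⁴. -/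
theorem inner_sq_add_inner_sq_ne_zero {S : H →L[ℂ] H} (hS : S ∈ unitary (H →L[ℂ] H))
    (hS2 : ∀ x, S (S x) = x) {x : H} (hx : x ≠ 0) :
    inner ℂ x x * inner ℂ x x + inner ℂ (S x) x * inner ℂ (S x) x ≠ 0 := by
  have h1 : starRingEnd ℂ (inner ℂ (S x) x) = inner ℂ (S x) x := by
    rw [inner_conj_symm]
    nth_rewrite 1 [← hS2 x]
    exact inner_unitary hS _ _
  obtain ⟨r, hr⟩ := Complex.conj_eq_iff_real.mp h1
  rw [hr, inner_self_eq_ofReal]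
  intro h0
  have h2 : (‖x‖ ^ 2 * ‖x‖ ^ 2 + r * r : ℝ) = 0 := by exact_mod_cast h0
  have := norm_pos_iff.mpr hx
  nlinarith [mul_self_nonneg r, show 0 < ‖x‖ ^ 2 * ‖x‖ ^ 2 by positivity]

/-- The hypothesis gives |⟨Sx,x⟩| = ‖x‖‖Sx‖, the case of equality in the Cauchy–Schwarz inequality.
-/
theorem exists_apply_eq_smul_of_inner_sq_add {S : H →L[ℂ] H} (hS : S ∈ unitary (H →L[ℂ] H))
    {x : H} (hx : x ≠ 0)
    (h0 : inner ℂ x x * inner ℂ x x + inner ℂ (S x) x * inner ℂ (S x) x = 0) :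
    ∃ a : ℂ, S x = a • x := by
  have h1 : ‖(inner ℂ (S x) x : ℂ)‖ = ‖x‖ * ‖S x‖ := by
    rw [norm_unitary_apply hS]
    have h2 := congrArg norm (eq_neg_of_add_eq_zero_right h0)
    rw [norm_mul, norm_neg, norm_mul, inner_self_eq_ofReal, Complex.norm_real,
      Real.norm_of_nonneg (by positivity)] at h2
    have h4 : ‖(inner ℂ (S x) x : ℂ)‖ * ‖(inner ℂ (S x) x : ℂ)‖ = (‖x‖ * ‖x‖) * (‖x‖ * ‖x‖) := by
      rw [h2]
      ring
    exact (mul_self_inj (norm_nonneg _) (by positivity)).mp h4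
  rw [norm_inner_symm] at h1
  have hSx : S x ≠ 0 := fun h => hx (unitary_apply_eq_zero hS h)
  obtain ⟨r, -, hr⟩ := (norm_inner_eq_norm_iff hx hSx).mp h1
  exact ⟨r, hr⟩

variable {C : Conjugation H} {s : Symmetries H} {j : Fin 8} {d : Column} {P F : H →L[ℂ] H}

theorem IsSymmetryOperator.apply_apply_complex {ε : ℤˣ} {S : H →L[ℂ] H}
    (hS : IsSymmetryOperator C ε S) (x : H) : S (S x) = ((ε : ℤ) : ℂ) • x := by
  rw [hS.apply_apply, Int.cast_smul_eq_zsmul]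

theorem IsSymmetryOperator.twist_twist {ε : ℤˣ} {S : H →L[ℂ] H}
    (hS : IsSymmetryOperator C ε S) (x : H) :
    C.twist hS.unitary (C.twist hS.unitary x) = ((ε : ℤ) : ℂ) • x := by
  rw [C.twist_apply, C.twist_apply, hS.conj_apply, C.involutive, hS.apply_apply_complex]

theorem units_cast_eq_one_or (ε : ℤˣ) : ((ε : ℤ) : ℂ) = 1 ∨ ((ε : ℤ) : ℂ) = -1 := by
  rcases Int.units_eq_one_or ε with rfl | rfl <;> simp

theorem twist_commute_apply {ε : ℤˣ} {S S' : H →L[ℂ] H} (hS : IsSymmetryOperator C ε S)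
    (hS' : S' ∈ unitary (H →L[ℂ] H)) (h : Commute S S') (x : H) :
    C.twist hS' (S x) = S (C.twist hS' x) := by
  rw [C.twist_apply, C.twist_apply, hS.conj_apply, commute_apply h]

/-- Deformation of the unitary in an even row. -/
theorem exists_finrank_ker_lt_of_even_row (hs : s.Admissible C j d) (h : IsPairing C s j d P F)
    (hj : rowKindHat j = none)
    (hkd : (rowKind j = .R ∨ rowKind j = .Q) ∧ (d = .d2 ∨ d = .d6) ∧
        (rowKind j).sign * d.sign = 1 ∨
      (rowKind j = .O ∨ rowKind j = .S) ∧ (d = .d4 ∨ d = .d8) ∧ (rowKind j).sign * d.sign = -1)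
    {x : H} (hx : pairingOp P F x = 0)
    (hx0 : inner ℂ x x * inner ℂ x x + inner ℂ (s.S x) x * inner ℂ (s.S x) x ≠ 0) :
    ∃ q, JoinedIn {q | IsPairing C s j d q.1 q.2} (P, F) q ∧
      finrank ℂ (pairingOp q.1 q.2).ker < finrank ℂ (pairingOp P F).ker := by
  have hc := h.cell hs
  have hnone : ∀ k ∈ rowKindHat j, Commute s.Shat P := fun k hk => by simp [hj] at hk
  rcases hkd with ⟨hk, hd, hsign⟩ | ⟨hk, hd, hsign⟩
  · have hrel := (Column.relation_iff_of_transpose hs.symm_Sigma hd F).mp h.rel_Sigma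
    have hrel' := (Column.relation_iff_of_transpose hs.symm_Sigma hd _).mp hc.adjoint.rel_Sigma
    have hSF := commute_star_of_mem_unitary h.unitary h.comm_S_F
    have hu : star F * s.Sigma ∈ unitary (H →L[ℂ] H) :=
      mul_mem (Unitary.star_mem h.unitary) hs.symm_Sigma.unitary
    have hL : ∀ y, C.twist hu y = star F (C.twist hs.symm_Sigma.unitary y) := fun y => rfl
    -- Here J = F*ΣC, whose square is Σ². The cokernel vector is y = SΣCx, so F*y = SJx and the
    -- matrix element of X between x and SJx is the required one. Taking z = 0 removes the unused
    -- second term.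
    obtain ⟨X, hX1, hX2, hX3, hX4⟩ := exists_skew_of_antilinear (J := C.twist hu) (z := 0)
      hs.symm_S.unitary (twist_commute_apply hs.symm_S hu (hSF.mul_right hs.comm))
      (units_cast_eq_one_or _) (units_cast_eq_one_or d.sign) hs.symm_S.apply_apply_complex
      (fun y => by
        rw [hL, hL, hrel', star_star, unitary_star_apply h.unitary, hs.symm_Sigma.twist_twist])
      hx0 (inner_zero_right _) (inner_zero_right _)
    have hgen : IsUnitaryGenerator C s j d F X := by
      refine ⟨hX1, hX2, fun k hk => by simp [hj] at hk, ?_, fun _ y => ?_⟩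
      · rintro (rfl | rfl) <;> rcases hd with hd | hd <;> cases hd
      · have := hX3 y
        have e : ((d.sign : ℤ) : ℂ) * (((rowKind j).sign : ℤ) : ℂ) = 1 := by
          rw [← Int.cast_mul, ← Units.val_mul, mul_comm, hsign]
          simp
        rw [e, one_smul] at this
        exact this
    refine hgen.exists_finrank_ker_lt hs h hx (y := hc.twist x) ?_ ?_
    · rw [← hc.twist_pairingOp hk hd, hx, map_zero]
    · simp only [map_zero, inner_zero_right, sub_zero] at hX4
      rw [← inner_star_left, hc.twist_apply_eq, ← commute_apply hSF]
      exact hX4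
  · have hrel := (Column.relation_iff_of_bar hs.symm_Sigma hd F).mp h.rel_Sigma
    -- Here J = ΣC, and the cokernel vector is F(SJx).
    obtain ⟨X, hX1, hX2, hX3, hX4⟩ := exists_skew_of_antilinear
      (J := C.twist hs.symm_Sigma.unitary) (z := 0)
      hs.symm_S.unitary (twist_commute_apply hs.symm_S hs.symm_Sigma.unitary hs.comm)
      (units_cast_eq_one_or _) (units_cast_eq_one_or d.sign) hs.symm_S.apply_apply_complex
      hs.symm_Sigma.twist_twist hx0 (inner_zero_right _) (inner_zero_right _)
    have hgen : IsUnitaryGenerator C s j d F X := by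
      refine ⟨hX1, hX2, fun k hk => by simp [hj] at hk, fun _ y => ?_, ?_⟩
      · have := hX3 y
        have e : ((d.sign : ℤ) : ℂ) * (((rowKind j).sign : ℤ) : ℂ) = -1 := by
          rw [← Int.cast_mul, ← Units.val_mul, mul_comm, hsign]
          simp
        rw [e, neg_one_smul, neg_neg] at this
        exact this
      · rintro (rfl | rfl) <;> rcases hd with hd | hd <;> cases hd
    refine hgen.exists_finrank_ker_lt hs h hx (y := F (hc.twist x)) ?_ ?_
    · exact hc.twist_mem_coker_of_bar hk hd hx
    · simp only [map_zero, inner_zero_right, sub_zero] at hX4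
      rw [inner_unitary h.unitary, hc.twist_apply_eq]
      exact hX4

/-- Deformation of the projection in an even row. -/
theorem exists_finrank_ker_lt_of_projection (hs : s.Admissible C j d) (h : IsPairing C s j d P F)
    (hj : rowKindHat j = none) (hk : rowKind j = .O ∨ rowKind j = .S) (hd : d = .d4 ∨ d = .d8)
    (hsign : (rowKind j).sign * d.sign = -1) {x : H} (hx : pairingOp P F x = 0)
    (hx0 : inner ℂ x x * inner ℂ x x + inner ℂ (s.Sigma x) x * inner ℂ (s.Sigma x) x ≠ 0) :
    ∃ q, JoinedIn {q | IsPairing C s j d q.1 q.2} (P, F) q ∧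
      finrank ℂ (pairingOp q.1 q.2).ker < finrank ℂ (pairingOp P F).ker := by
  have hc := h.cell hs
  have hx' := (pairingOp_apply_eq_zero_iff h.projection x).mp hx
  have hperp : ∀ y, P y = y → inner ℂ y (F x) = 0 := fun y hy => by
    rw [← hy, h.projection.inner_apply, hx'.2, inner_zero_right]
  -- The roles of S and Σ are interchanged. The choice z = Fx accounts for the second half of the
  -- commutator FX - XF; x and Σx lie in ran P, to which Fx is orthogonal.
  obtain ⟨X, hX1, hX2, hX3, hX4⟩ := exists_skew_of_antilinear
    (J := C.twist hs.symm_S.unitary) (z := F x)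
    hs.symm_Sigma.unitary (twist_commute_apply hs.symm_Sigma hs.symm_S.unitary hs.comm.symm)
    (units_cast_eq_one_or _) (units_cast_eq_one_or (rowKind j).sign)
    hs.symm_Sigma.apply_apply_complex hs.symm_S.twist_twist hx0 (hperp x hx'.1)
    (hperp _ (by rw [← commute_apply h.comm_Sigma_P, hx'.1]))
  have hgen : IsProjectionGenerator C s j X := by
    refine ⟨hX1, hX2, fun y => ?_, fun k hk => by simp [hj] at hk⟩
    have := hX3 y
    have e : (((rowKind j).sign : ℤ) : ℂ) * ((d.sign : ℤ) : ℂ) = -1 := by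
      rw [← Int.cast_mul, ← Units.val_mul, hsign]
      simp
    rw [e, neg_one_smul, neg_neg] at this
    exact this
  obtain ⟨θ, h1, h2⟩ := hgen.exists_finrank_ker_lt hs h hx (y := F (hc.twist x))
    (hc.twist_mem_coker_of_bar hk hd hx) (by
      rw [inner_unitary h.unitary, ← hc.twist_F_of_bar hd, hc.twist_apply_eq', hc.twist_apply_eq']
      exact hX4)
  exact ⟨_, h1, h2⟩

end EvenRows

/-! ### The entry j = 4, d = 6: a rotation followed by a deformation of the projection. -/

section QuaternionicRotation

variable {H : Type*} [NormedAddCommGroup H] [InnerProductSpace ℂ H] [CompleteSpace H]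

variable {C : Conjugation H} {s : Symmetries H} {j : Fin 8} {d : Column} {P F : H →L[ℂ] H}

theorem finRange_rankTwo (a x : H) (c : ℂ) : FinRange (rankTwo a x c) := by
  have : FiniteDimensional ℂ (Submodule.span ℂ {a, x} : Submodule ℂ H) :=
    FiniteDimensional.span_of_finite ℂ (by simp)
  refine FinRange.of_range_le (V := Submodule.span ℂ {a, x}) fun z => ?_
  rw [rankTwo_apply]
  exact Submodule.sub_mem _ (Submodule.smul_mem _ _ (Submodule.subset_span (by simp)))
    (Submodule.smul_mem _ _ (Submodule.subset_span (by simp)))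

/-- For a generator of finite rank the path stays Fredholm for all parameters, not only small ones;
the rotation below runs up to θ = 1. -/
theorem isFredholm_pairingOp_mul_cayley {X : H →L[ℂ] H} (hX : star X = -X) (hfin : FinRange X)
    (hT : (pairingOp P F).IsFredholm) (θ : ℝ) : (pairingOp P (F * cayley X θ)).IsFredholm := by
  have : pairingOp P (F * cayley X θ) = pairingOp P F +
      (P * F * ((θ : ℂ) • 2)) * (X * (Ring.inverse (1 - (θ : ℂ) • X) * P)) := by
    rw [pairingOp, pairingOp, cayley_eq_one_add hX]
    simp only [mul_add, add_mul, mul_one, mul_smul_comm, smul_mul_assoc, ← mul_assoc]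
    abel
  rw [this]
  exact hT.add_finRange ((hfin.mul_right _).mul_left _)

theorem rankTwo_smul_of_mul_conj {a : ℂ} (ha : a * starRingEnd ℂ a = 1) (u v : H) (c : ℂ) :
    rankTwo (a • u) (a • v) c = rankTwo u v c := by
  ext z
  rw [rankTwo_apply, rankTwo_apply, inner_smul_left, inner_smul_left, smul_smul, smul_smul]
  congr 2
  · linear_combination (c * inner ℂ v z) * ha
  · linear_combination (starRingEnd ℂ c * inner ℂ u z) * ha

theorem unitary_rankTwo_of_eigenvector {S : H →L[ℂ] H} (hS : S ∈ unitary (H →L[ℂ] H)) {a : ℂ}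
    (ha : a * starRingEnd ℂ a = 1) {u v : H} (hu : S u = a • u) (hv : S v = a • v) (c : ℂ) :
    Commute S (rankTwo u v c) := by
  ext z
  change S (rankTwo u v c z) = rankTwo u v c (S z)
  rw [unitary_rankTwo hS, hu, hv, rankTwo_smul_of_mul_conj ha]

theorem inner_eq_zero_of_eigenvector {S : H →L[ℂ] H} (hS : S ∈ unitary (H →L[ℂ] H)) {a : ℂ}
    (ha : a * starRingEnd ℂ a = 1) {u v : H} (hu : S u = a • u) (hv : S v = -a • v) :
    inner ℂ u v = 0 := by
  have h := inner_unitary hS u v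
  rw [hu, hv, inner_smul_left, inner_smul_right] at h
  linear_combination (-1 / 2 : ℂ) * h - (1 / 2 * inner ℂ u v) * ha

theorem mul_conj_eq_one {a : ℂ} (ha : starRingEnd ℂ a = -a) (ha2 : a * a = -1) :
    a * starRingEnd ℂ a = 1 := by
  rw [ha, mul_neg, ha2, neg_neg]

theorem conj_eq_neg {a : ℂ} (ha : a * a = -1) : starRingEnd ℂ a = -a := by
  have h : (a - Complex.I) * (a + Complex.I) = 0 := by
    linear_combination ha - Complex.I_mul_I
  rcases mul_eq_zero.mp h with h | h
  · rw [sub_eq_zero.mp h, Complex.conj_I]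
  · rw [eq_neg_of_add_eq_zero_left h, map_neg, Complex.conj_I]

/-- The functional `v ↦ ⟨w, F v⟩` on a finite-dimensional subspace is represented by a multiple of
a unit vector. -/
theorem exists_unit_vector_of_functional (N : Submodule ℂ H) [FiniteDimensional ℂ N]
    (u : H) {v₀ : H} (hv₀ : v₀ ∈ N) (h : inner ℂ u v₀ ≠ 0) :
    ∃ x ∈ N, inner ℂ x x = 1 ∧ inner ℂ u x ≠ 0 ∧ ∀ v ∈ N, inner ℂ x v = 0 → inner ℂ u v = 0 := by
  set x₀ := N.starProjection u with hx₀
  have hx : ∀ v ∈ N, inner ℂ x₀ v = inner ℂ u v := fun v hv => by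
    rw [hx₀, N.inner_starProjection_left_eq_right, Submodule.starProjection_eq_self_iff.mpr hv]
  have hmem : x₀ ∈ N := N.starProjection_apply_mem u
  have hne : x₀ ≠ 0 := fun h0 => h (by rw [← hx v₀ hv₀, h0, inner_zero_left])
  have hn : ((‖x₀‖ : ℝ) : ℂ) ≠ 0 := by exact_mod_cast norm_ne_zero_iff.mpr hne
  refine ⟨((‖x₀‖ : ℝ) : ℂ)⁻¹ • x₀, N.smul_mem _ hmem, ?_, ?_, fun v hv h0 => ?_⟩
  · rw [inner_self_eq_ofReal, show ‖((‖x₀‖ : ℝ) : ℂ)⁻¹ • x₀‖ = 1 from norm_smul_inv_norm hne]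
    simp
  · rw [inner_smul_right, ← hx x₀ hmem]
    exact mul_ne_zero (inv_ne_zero hn) (inner_self_ne_zero.mpr hne)
  · rw [inner_smul_left] at h0
    rw [← hx v hv]
    exact (mul_eq_zero.mp h0).resolve_left ((map_ne_zero _).mpr (inv_ne_zero hn))

theorem finrank_le_finrank_inf_ker_add_one (N : Submodule ℂ H) [FiniteDimensional ℂ N] (x : H) :
    finrank ℂ N ≤ finrank ℂ (N ⊓ (innerSL ℂ x : H →ₗ[ℂ] ℂ).ker : Submodule ℂ H) + 1 := by
  set f : N →ₗ[ℂ] ℂ := (innerSL ℂ x : H →ₗ[ℂ] ℂ).comp N.subtype with hf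
  have h1 := f.finrank_range_add_finrank_ker
  have h2 : finrank ℂ f.range ≤ 1 := (Submodule.finrank_le _).trans (by simp)
  have h3 : finrank ℂ f.ker ≤
      finrank ℂ (N ⊓ (innerSL ℂ x : H →ₗ[ℂ] ℂ).ker : Submodule ℂ H) := by
    refine LinearMap.finrank_le_finrank_of_injective
      (f := { toFun := fun v => ⟨(v : N), v.1.2, v.2⟩
              map_add' := fun _ _ => rfl
              map_smul' := fun _ _ => rfl }) fun v w h => ?_
    have := congrArg Subtype.val h
    exact Subtype.ext (Subtype.ext this)
  omega

section QuaternionicTranspose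

variable {a b : ℂ} {e : H}

/-- A pairing of the row `j = 4` and the column `d = 6` with odd-dimensional kernel inside an
eigenspace of `S` is deformed to one with even-dimensional kernel by means of an additional vector
`e` on which the pairing is trivial. -/
theorem exists_joinedIn_even_of_eigenvector (hs : s.Admissible C 4 .d6)
    (h : IsPairing C s 4 .d6 P F) (hodd : Odd (finrank ℂ (pairingOp P F).ker))
    (ha2 : a * a = -1) (hb2 : b * b = -1)
    (hker : ∀ x, pairingOp P F x = 0 → s.S x = a • x)
    (he1 : inner ℂ e e = 1) (hPe : P e = e) (hFe : F e = e) (hSe : s.S e = a • e)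
    (hSige : s.Sigma e = b • e) {w v₀ : H} (hPw : P w = 0) (hSw : s.S w = a • w)
    (hSigw : s.Sigma w = -b • w) (hv₀ : pairingOp P F v₀ = 0) (hwv₀ : inner ℂ w (F v₀) ≠ 0) :
    ∃ q, JoinedIn {q | IsPairing C s 4 .d6 q.1 q.2} (P, F) q ∧
      Even (finrank ℂ (pairingOp q.1 q.2).ker) := by
  have hca := conj_eq_neg ha2
  have hcb := conj_eq_neg hb2
  have haa := mul_conj_eq_one hca ha2
  have hbb := mul_conj_eq_one hcb hb2
  have hna : -a * starRingEnd ℂ (-a) = 1 := by rw [map_neg, neg_mul_neg, haa]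
  have hnb : -b * starRingEnd ℂ (-b) = 1 := by rw [map_neg, neg_mul_neg, hbb]
  have ha0 : a ≠ 0 := fun h0 => by simp [h0] at ha2
  have hc := h.cell hs
  have hP := h.projection
  have hSu := hs.symm_S.unitary
  have := h.fredholm.finite_ker
  have hN : ∀ z, pairingOp P F z = 0 ↔ P z = z ∧ P (F z) = 0 := pairingOp_apply_eq_zero_iff hP
  -- The vector x spans the direction of the kernel seen by v ↦ ⟨w, Fv⟩. Kernel vectors orthogonal
  -- to x are mapped by F into the complement of w and will survive both deformations.
  obtain ⟨x, hxN, hx1, hxw, hxperp⟩ := exists_unit_vector_of_functional (pairingOp P F).ker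
    (star F w) hv₀ (by rwa [inner_star_left])
  rw [inner_star_left] at hxw
  simp only [inner_star_left] at hxperp
  change pairingOp P F x = 0 at hxN
  have hx := (hN x).mp hxN
  have hSx := hker x hxN
  -- the antiunitary operators
  have hd : (Column.d6 : Column) = .d2 ∨ Column.d6 = .d6 := Or.inr rfl
  have hrel := (Column.relation_iff_of_transpose hs.symm_Sigma hd F).mp h.rel_Sigma
  have hrel' := (Column.relation_iff_of_transpose hs.symm_Sigma hd _).mp hc.adjoint.rel_Sigma
  rw [star_star] at hrel'
  set JS := C.twist hs.symm_S.unitary with hJS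
  set JT := C.twist hs.symm_Sigma.unitary with hJT
  have hSF := commute_star_of_mem_unitary h.unitary h.comm_S_F
  have hJTS := twist_commute_apply hs.symm_S hs.symm_Sigma.unitary hs.comm
  have hJTT := twist_commute_apply hs.symm_Sigma hs.symm_Sigma.unitary (Commute.refl _)
  have hJSS := twist_commute_apply hs.symm_S hs.symm_S.unitary (Commute.refl _)
  have hJST := twist_commute_apply hs.symm_Sigma hs.symm_S.unitary hs.comm.symm
  have hJTJT : ∀ y, JT (JT y) = -y := fun y => by
    rw [hs.symm_Sigma.twist_twist]
    simp [Column.sign]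
  have hJSJS : ∀ y, JS (JS y) = -y := fun y => by
    rw [hs.symm_S.twist_twist]
    simp [rowKind, Kind.sign]
  have hKP := hc.twist_P_of_preserves (Or.inr rfl)
  have hKJT : ∀ y, hc.twist y = s.S (JT y) := hc.twist_apply_eq
  have hKJS : ∀ y, hc.twist y = s.Sigma (JS y) := hc.twist_apply_eq'
  have hFse : star F e = e := by
    conv_lhs => rw [← hFe]
    exact unitary_star_apply h.unitary e
  set e' := JT e with he'
  set x' := star F (JT x) with hx'
  have hFe' : F e' = e' := by rw [he', ← hrel', hFse]
  have hFse' : star F e' = e' := by rw [he', ← hrel, hFe]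
  have hSe' : s.S e' = -a • e' := by rw [he', ← hJTS, hSe, map_smulₛₗ, hca]
  have hSx' : s.S x' = -a • x' := by
    rw [hx', commute_apply hSF, ← hJTS, hSx, map_smulₛₗ, hca, map_smul]
  have hKe : hc.twist e = -a • e' := by rw [hKJT, ← he', hSe']
  have hPe' : P e' = e' := by
    have := hKP e
    rw [hPe, hKe, map_smul] at this
    exact (smul_right_injective H (neg_ne_zero.mpr ha0) this).symm
  have hJTx : JT x = a • hc.twist x := by
    rw [hKJT, ← hJTS, hSx, map_smulₛₗ, hca, smul_smul, mul_neg, ha2, neg_neg, one_smul]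
  have hcoker : star (pairingOp P F) (hc.twist x) = 0 := by
    rw [← hc.twist_pairingOp (Or.inr rfl) hd, hxN, map_zero]
  rw [star_pairingOp_apply_eq_zero_iff hP] at hcoker
  have hL : ∀ y, star F (JT (star F (JT y))) = -y := fun y => by
    rw [hrel', unitary_star_apply h.unitary, hJTJT]
  -- orthogonality
  have orth : ∀ {u v : H}, s.S u = a • u → s.S v = -a • v → inner ℂ u v = 0 :=
    fun hu hv => inner_eq_zero_of_eigenvector hSu haa hu hv
  have orth' : ∀ {u v : H}, s.S u = -a • u → s.S v = a • v → inner ℂ u v = 0 :=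
    fun hu hv => inner_eq_zero_of_eigenvector hSu hna hu (by rwa [neg_neg])
  have perp : ∀ {u v : H}, P u = u → P v = 0 → inner ℂ u v = 0 := fun hu hv => by
    rw [← hu, hP.inner_apply, hv, inner_zero_right]
  have perp' : ∀ {u v : H}, P u = 0 → P v = v → inner ℂ u v = 0 := fun hu hv =>
    hP.inner_eq_zero hu hv
  have he_ker : ∀ {u v : H}, P u = u → F u = u → P (F v) = 0 → inner ℂ u v = 0 :=
    fun hu hFu hv => by rw [← inner_unitary h.unitary, hFu, perp hu hv]
  have hex : inner ℂ e x = 0 := he_ker hPe hFe hx.2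
  have he'x : inner ℂ e' x = 0 := he_ker hPe' hFe' hx.2
  have hee' : inner ℂ e e' = 0 := orth hSe hSe'
  have hex' : inner ℂ e x' = 0 := orth hSe hSx'
  have hxx' : inner ℂ x x' = 0 := orth hSx hSx'
  have he'x' : inner ℂ e' x' = 0 := by
    rw [← hFse', hx', inner_unitary (Unitary.star_mem h.unitary), he', inner_antilinear,
      inner_eq_zero_symm, hex]
  have he'1 : inner ℂ e' e' = 1 := by rw [he', inner_antilinear, he1]
  have hx'1 : inner ℂ x' x' = 1 := by
    rw [hx', inner_unitary (Unitary.star_mem h.unitary), inner_antilinear, hx1]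
  have sym0 : ∀ {u v : H}, inner ℂ u v = 0 → inner ℂ v u = 0 := fun hu =>
    inner_eq_zero_symm.mp hu
  -- the rotation exchanging `x` and `e`
  set X := rankTwo e x 1 - rankTwo e' x' 1 with hX
  have hXapply : ∀ z, X z = (inner ℂ x z : ℂ) • e - (inner ℂ e z : ℂ) • x -
      ((inner ℂ x' z : ℂ) • e' - (inner ℂ e' z : ℂ) • x') := fun z => by
    change rankTwo e x 1 z - rankTwo e' x' 1 z = _
    simp only [rankTwo_apply, map_one, one_mul]
  have hXstar : star X = -X := by rw [hX, star_sub, star_rankTwo, star_rankTwo]; abel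
  have hgen : IsUnitaryGenerator C s 4 .d6 F X := by
    refine ⟨hXstar, ?_, fun k hk => by simp [rowKindHat] at hk, ?_, fun _ z => ?_⟩
    · exact (unitary_rankTwo_of_eigenvector hSu haa hSe hSx 1).sub_right
        (unitary_rankTwo_of_eigenvector hSu hna hSe' hSx' 1)
    · rintro (hd | hd) <;> cases hd
    · change star F (JT (rankTwo e x 1 z - rankTwo e' x' 1 z)) =
        -(rankTwo e x 1 (star F (JT z)) - rankTwo e' x' 1 (star F (JT z)))
      -- F*ΣC sends (e, x) to (e', x') and (e', x') to (-e, -x). It therefore exchanges the two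
      -- rank-two terms, and the minus sign between them produces the anticommutation.
      have e1 : star F (JT e') = -e := by rw [he', hJTJT, map_neg, hFse]
      have e2 : star F (JT x') = -x := hL x
      have e3 := rankTwo_smul_smul (Or.inr rfl : (-1 : ℂ) = 1 ∨ (-1 : ℂ) = -1) (Or.inr rfl) e x 1
      rw [neg_one_smul, neg_one_smul, neg_mul_neg, one_mul, one_smul] at e3
      rw [map_sub, map_sub, antilinear_rankTwo, antilinear_rankTwo,
        unitary_rankTwo (Unitary.star_mem h.unitary), unitary_rankTwo (Unitary.star_mem h.unitary),
        ← he', hFse', ← hx', e1, e2, map_one, e3, neg_sub]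
  have hXfin : FinRange X := (finRange_rankTwo _ _ _).sub (finRange_rankTwo _ _ _)
  set W := cayley X 1 with hW
  have hWu : W ∈ unitary (H →L[ℂ] H) := cayley_mem_unitary hXstar 1
  have hjoin := hgen.joinedIn hs h (θ := 1)
    fun t _ => isFredholm_pairingOp_mul_cayley hXstar hXfin h.fredholm _
  have h1 : IsPairing C s 4 .d6 P (F * W) := hjoin.target_mem
  have hXx : X x = e := by
    rw [hXapply, hx1, hex, sym0 hxx', he'x]
    simp
  have hXe : X e = -x := by
    rw [hXapply, he1, sym0 hex, sym0 hex', sym0 hee']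
    simp
  have hXe' : X e' = x' := by
    rw [hXapply, he'1, hee', sym0 he'x, sym0 he'x']
    simp
  have hXx' : X x' = -e' := by
    rw [hXapply, hx'1, hex', hxx', he'x']
    simp
  have hWx : W x = e := cayley_one_apply_of_rotation hXstar hXx hXe
  have hWe : W e = -x := cayley_one_apply_of_rotation hXstar hXe (by rw [map_neg, hXx])
  have hWe' : W e' = x' := cayley_one_apply_of_rotation hXstar hXe' hXx'
  have hWx' : W x' = -e' := cayley_one_apply_of_rotation hXstar hXx' (by rw [map_neg, hXe'])
  have hWse : star W e = x := by rw [← hWx, unitary_star_apply hWu]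
  have hWse' : star W e' = -x' := by
    rw [← neg_neg e', ← hWx', map_neg, unitary_star_apply hWu]
  have hWfix : ∀ z, inner ℂ x z = 0 → inner ℂ e z = 0 → inner ℂ x' z = 0 → inner ℂ e' z = 0 →
      W z = z := fun z h1 h2 h3 h4 => cayley_apply_of_apply_eq_zero hXstar 1 (by
    rw [hXapply, h1, h2, h3, h4]
    simp)
  set T₁ := pairingOp P (F * W) with hT₁
  have hN₁ : ∀ z, T₁ z = 0 ↔ P z = z ∧ P (F (W z)) = 0 := pairingOp_apply_eq_zero_iff hP
  have heker : T₁ e = 0 := (hN₁ e).mpr ⟨hPe, by rw [hWe, map_neg, map_neg, hx.2, neg_zero]⟩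
  -- W* embeds the new kernel into the old one. Pairing PFWz = 0 with e and e' shows that z is
  -- orthogonal to x and x'; pairing with the cokernel vector SΣCx kills the component along e'.
  have hdim : finrank ℂ T₁.ker ≤ finrank ℂ (pairingOp P F).ker := by
    have hmaps : ∀ z : T₁.ker, pairingOp P F (star W z) = 0 := by
      rintro ⟨z, hz⟩
      change pairingOp P F (star W z) = 0
      obtain ⟨hPz, hFz⟩ := (hN₁ z).mp hz
      have h2 : inner ℂ x' z = 0 := by
        have := perp hPe' hFz
        rw [← inner_star_left, hFse', ← inner_star_left, hWse', inner_neg_left] at this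
        exact neg_eq_zero.mp this
      have h3 : inner ℂ x z = 0 := by
        have := perp hPe hFz
        rwa [← inner_star_left, hFse, ← inner_star_left, hWse] at this
      set β := (inner ℂ e z : ℂ) with hβ
      set γ := (inner ℂ e' z : ℂ) with hγ
      set z₀ := z - β • e - γ • e' with hz₀
      have hz_eq : z = z₀ + β • e + γ • e' := by rw [hz₀]; abel
      have hz₀W : W z₀ = z₀ := by
        refine hWfix _ ?_ ?_ ?_ ?_
        · rw [hz₀, inner_sub_right, inner_sub_right, inner_smul_right, inner_smul_right, h3,
            sym0 hex, sym0 he'x]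
          ring
        · rw [hz₀, inner_sub_right, inner_sub_right, inner_smul_right, inner_smul_right, ← hβ,
            he1, hee']
          ring
        · rw [hz₀, inner_sub_right, inner_sub_right, inner_smul_right, inner_smul_right, h2,
            sym0 hex', sym0 he'x']
          ring
        · rw [hz₀, inner_sub_right, inner_sub_right, inner_smul_right, inner_smul_right, ← hγ,
            sym0 hee', he'1]
          ring
      have hPz₀ : P z₀ = z₀ := by
        rw [hz₀, map_sub, map_sub, map_smul, map_smul, hPz, hPe, hPe']
      have hWz : W z = z₀ - β • x + γ • x' := by
        conv_lhs => rw [hz_eq]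
        rw [map_add, map_add, map_smul, map_smul, hz₀W, hWe, hWe', smul_neg, ← sub_eq_add_neg]
      have hFx' : F x' = a • hc.twist x := by rw [hx', unitary_apply_star h.unitary, hJTx]
      have hsum : P (F z₀) + (γ * a) • hc.twist x = 0 := by
        rw [hWz, map_add, map_sub, map_smul, map_smul, hFx', map_add, map_sub, map_smul, hx.2,
          smul_zero, sub_zero, smul_smul, map_smul, hcoker.1] at hFz
        exact hFz
      have hγ0 : γ = 0 := by
        have h4 := congrArg (fun v => inner ℂ (hc.twist x) v) hsum
        simp only [inner_add_right, inner_smul_right, inner_zero_right] at h4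
        rw [← hP.inner_apply, hcoker.1, ← inner_star_left, perp' hcoker.2 hPz₀, zero_add,
          inner_antilinear, hx1, mul_one] at h4
        exact (mul_eq_zero.mp h4).resolve_right ha0
      rw [hγ0, zero_mul, zero_smul, add_zero] at hsum
      have hz₀N : pairingOp P F z₀ = 0 := (hN z₀).mpr ⟨hPz₀, hsum⟩
      have : star W z = z₀ + β • x := by
        rw [hz_eq, hγ0, zero_smul, add_zero, map_add, map_smul, hWse]
        conv_lhs => rw [← hz₀W, unitary_star_apply hWu]
      rw [this, map_add, map_smul, hz₀N, hxN, smul_zero, add_zero]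
    refine LinearMap.finrank_le_finrank_of_injective
      (f := { toFun := fun z => ⟨star W z, hmaps z⟩
              map_add' := fun z z' => Subtype.ext (map_add _ _ _)
              map_smul' := fun c z => Subtype.ext (map_smul _ _ _) }) fun z z' hzz' => ?_
    have := congrArg (fun v : (pairingOp P F).ker => W (v : H)) hzz'
    change W (star W z) = W (star W z') at this
    rw [unitary_apply_star hWu, unitary_apply_star hWu] at this
    exact Subtype.ext this
  -- the deformation of the projection
  have hJSe' : JS e' = (a * b) • e := by
    rw [he', hJT, hJS, C.twist_apply, C.twist_apply, hs.symm_Sigma.conj_apply, C.involutive,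
      hSige, map_smul, hSe, smul_smul, mul_comm]
  have hSJSw : s.S (JS w) = -a • JS w := by rw [← hJSS, hSw, map_smulₛₗ, hca]
  have hSige' : s.Sigma e' = -b • e' := by rw [he', ← hJTT, hSige, map_smulₛₗ, hcb]
  have hSigJSe' : s.Sigma (JS e') = b • JS e' := by
    rw [← hJST, hSige', map_smulₛₗ, map_neg, hcb, neg_neg]
  have hSigJSw : s.Sigma (JS w) = b • JS w := by
    rw [← hJST, hSigw, map_smulₛₗ, map_neg, hcb, neg_neg]
  -- Both e' and w belong to the eigenvalue -b of Σ and their conjugates to b, so Y commutes with Σ;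
  -- the conjugate term makes Y commute with SC.
  set Y := rankTwo e' w 1 + rankTwo (JS e') (JS w) 1 with hY
  have hYapply : ∀ z, Y z = (inner ℂ w z : ℂ) • e' - (inner ℂ e' z : ℂ) • w +
      ((inner ℂ (JS w) z : ℂ) • JS e' - (inner ℂ (JS e') z : ℂ) • JS w) := fun z => by
    change rankTwo e' w 1 z + rankTwo (JS e') (JS w) 1 z = _
    simp only [rankTwo_apply, map_one, one_mul]
  have hYstar : star Y = -Y := by rw [hY, star_add, star_rankTwo, star_rankTwo]; abel
  have hYJS : ∀ z, JS (Y z) = Y (JS z) := fun z => by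
    change JS (rankTwo e' w 1 z + rankTwo (JS e') (JS w) 1 z) =
      rankTwo e' w 1 (JS z) + rankTwo (JS e') (JS w) 1 (JS z)
    have e3 := rankTwo_smul_smul (Or.inr rfl : (-1 : ℂ) = 1 ∨ (-1 : ℂ) = -1) (Or.inr rfl) e' w 1
    rw [neg_one_smul, neg_one_smul, neg_mul_neg, one_mul, one_smul] at e3
    rw [map_add, antilinear_rankTwo, antilinear_rankTwo, hJSJS, hJSJS, map_one, e3, add_comm]
  have hYSig : Commute s.Sigma Y :=
    (unitary_rankTwo_of_eigenvector hs.symm_Sigma.unitary hnb hSige' hSigw 1).add_right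
      (unitary_rankTwo_of_eigenvector hs.symm_Sigma.unitary hbb hSigJSe' hSigJSw 1)
  have hgen' : IsProjectionGenerator C s 4 Y :=
    ⟨hYstar, hYSig, hYJS, fun k hk => by simp [rowKindHat] at hk⟩
  have hYK : ∀ z, hc.twist (Y z) = Y (hc.twist z) := fun z => by
    rw [hKJS, hKJS, hYJS, commute_apply hYSig]
  have hYvanish : ∀ z, s.S z = a • z → inner ℂ w z = 0 → inner ℂ e z = 0 → inner ℂ e' z = 0 →
      Y z = 0 := fun z h1 h2 h3 h4 => by
    rw [hYapply, h2, h4, orth' hSJSw h1, hJSe', inner_smul_left, h3]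
    simp
  have hc₁ := h1.cell hs
  -- The kernel vector is e, the cokernel vector SΣCe = -a e'. By symmetry both halves of the
  -- commutator contribute equally, giving a nonzero multiple of ⟨w, Fx⟩.
  obtain ⟨θ, hjoin₂, hlt⟩ := hgen'.exists_finrank_ker_lt hs h1 (y := hc.twist e) heker (by
    have h2 : ∀ z, hc.twist (T₁ z) = star T₁ (hc.twist z) :=
      hc₁.twist_pairingOp (Or.inr rfl) hd
    rw [← h2, heker, map_zero]) (by
    have h2 : ∀ z, hc.twist ((F * W) z) = star (F * W) (hc.twist z) :=
      hc₁.twist_F_of_transpose hd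
    have h3 : (F * W) e = -F x := by
      change F (W e) = _
      rw [hWe, map_neg]
    have hKK : ∀ z, hc.twist (hc.twist z) = z := fun z => by
      rw [hc.twist_twist]
      simp [rowKind, Kind.sign, Column.sign]
    have hYinner : ∀ u v, inner ℂ (Y u) v = -inner ℂ u (Y v) := fun u v => by
      rw [← inner_star_right, hYstar]
      exact inner_neg_right _ _
    have h4 : inner ℂ (hc.twist e) ((F * W) (Y e)) = inner ℂ (hc.twist e) (Y (F x)) := by
      rw [← inner_star_left, ← h2, h3, ← inner_antilinear hc.twist, hKK, hYK, hYinner, map_neg,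
        inner_neg_right, neg_neg]
    rw [h4, h3, map_neg, inner_neg_right, sub_neg_eq_add, ← two_mul, hKe, inner_smul_left]
    have hSFx : s.S (F x) = a • F x := by rw [commute_apply h.comm_S_F, hSx, map_smul]
    have h5 : inner ℂ e' (Y (F x)) = inner ℂ w (F x) := by
      rw [hYapply, orth' hSJSw hSFx, perp hPe' hx.2, hJSe', inner_smul_left, perp hPe hx.2]
      simp only [zero_smul, sub_zero, mul_zero, add_zero, inner_smul_right, he'1, mul_one]
    rw [h5]
    exact mul_ne_zero two_ne_zero (mul_ne_zero ((map_ne_zero _).mpr (neg_ne_zero.mpr ha0)) hxw))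
  set V := cayley Y θ with hV
  refine ⟨_, hjoin.trans hjoin₂, ?_⟩
  have hVfix : ∀ z, Y z = 0 → V z = z := fun z => cayley_apply_of_apply_eq_zero hYstar θ
  have hVu : V ∈ unitary (H →L[ℂ] H) := cayley_mem_unitary hYstar θ
  have hVfix' : ∀ z, Y z = 0 → star V z = z := fun z hz => by
    conv_lhs => rw [← hVfix z hz]
    exact unitary_star_apply hVu z
  -- On an old kernel vector v orthogonal to x nothing changes: Wv = v, and Y annihilates v and Fv.
  have hsub : (pairingOp P F).ker ⊓ (innerSL ℂ x : H →ₗ[ℂ] ℂ).ker ≤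
      (pairingOp (V * P * star V) (F * W)).ker := by
    rintro v ⟨hv, hxv⟩
    change pairingOp P F v = 0 at hv
    change inner ℂ x v = 0 at hxv
    have hv' := (hN v).mp hv
    have hSv := hker v hv
    have hYv : Y v = 0 := hYvanish v hSv (perp' hPw hv'.1) (he_ker hPe hFe hv'.2)
      (he_ker hPe' hFe' hv'.2)
    have hWv : W v = v := hWfix v hxv (he_ker hPe hFe hv'.2) (orth' hSx' hSv)
      (he_ker hPe' hFe' hv'.2)
    have hYFv : Y (F v) = 0 := hYvanish _ (by rw [commute_apply h.comm_S_F, hSv, map_smul])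
      (hxperp v hv hxv) (perp hPe hv'.2) (perp hPe' hv'.2)
    refine (pairingOp_apply_eq_zero_iff (hP.conj_unitary hVu) v).mpr ⟨?_, ?_⟩
    · change V (P (star V v)) = v
      rw [hVfix' v hYv, hv'.1, hVfix v hYv]
    · change V (P (star V (F (W v)))) = 0
      rw [hWv, hVfix' _ hYFv, hv'.2, map_zero]
  have hfr₂ : IsPairing C s 4 .d6 (V * P * star V) (F * W) := hjoin₂.target_mem
  have := hfr₂.fredholm.finite_ker
  have hge := finrank_le_finrank_inf_ker_add_one (pairingOp P F).ker x
  have hle := Submodule.finrank_mono hsub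
  change Even (finrank ℂ (pairingOp (V * P * star V) (F * W)).ker)
  -- With old dimension 2m + 1, at least 2m dimensions survive, while the final dimension is
  -- strictly below that of `T₁`, hence below 2m + 1. It is exactly 2m.
  obtain ⟨m, hm⟩ := hodd
  have hfinal : finrank ℂ (pairingOp (V * P * star V) (F * W)).ker = 2 * m := by
    have : finrank ℂ (pairingOp (V * P * star V) (F * W)).ker < finrank ℂ T₁.ker := hlt
    omega
  rw [hfinal]
  exact even_two_mul m

end QuaternionicTranspose

end QuaternionicRotation

/-! ### The auxiliary plane and the trivialization of the entry j = 4, d = 6. -/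

section QuaternionicPlane

variable {H : Type*} [NormedAddCommGroup H] [InnerProductSpace ℂ H] [CompleteSpace H]

variable {C : Conjugation H} {s : Symmetries H} {P F : H →L[ℂ] H}

section Plane

local notation "𝔼" => EuclideanSpace ℂ (Fin 2)

/-- The rotation by a right angle of `ℂ²`. -/
def quarterTurn : 𝔼 →L[ℂ] 𝔼 := Matrix.toEuclideanCLM (𝕜 := ℂ) !![0, -1; 1, 0]

/-- The exchange of the coordinates of `ℂ²`. -/
def coordSwap : 𝔼 →L[ℂ] 𝔼 := Matrix.toEuclideanCLM (𝕜 := ℂ) !![0, 1; 1, 0]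

theorem quarterTurn_apply (x : 𝔼) : quarterTurn x = !₂[-x 1, x 0] := by
  ext i
  rw [quarterTurn, Matrix.ofLp_toEuclideanCLM]
  fin_cases i <;> simp [Matrix.mulVec, dotProduct]

theorem coordSwap_apply (x : 𝔼) : coordSwap x = !₂[x 1, x 0] := by
  ext i
  rw [coordSwap, Matrix.ofLp_toEuclideanCLM]
  fin_cases i <;> simp [Matrix.mulVec, dotProduct]

theorem star_quarterTurn : star quarterTurn = -quarterTurn := by
  rw [quarterTurn, ← map_star, ← map_neg]
  congr 1
  ext i j
  fin_cases i <;> fin_cases j <;> simp [Matrix.star_apply]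

theorem bar_quarterTurn : (stdConj 2).bar quarterTurn = quarterTurn := by
  ext x i
  rw [Conjugation.bar_apply, quarterTurn_apply, quarterTurn_apply]
  change starRingEnd ℂ (!₂[-starRingEnd ℂ (x 1), starRingEnd ℂ (x 0)] i) = _
  fin_cases i <;> simp

theorem coordSwap_coordSwap (x : 𝔼) : coordSwap (coordSwap x) = x := by
  ext i
  rw [coordSwap_apply, coordSwap_apply]
  fin_cases i <;> simp

theorem quarterTurn_coordSwap (x : 𝔼) :
    quarterTurn (coordSwap x) = -coordSwap (quarterTurn x) := by
  ext i
  simp only [coordSwap_apply, quarterTurn_apply]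
  fin_cases i <;> simp

theorem norm_coordSwap (x : 𝔼) : ‖coordSwap x‖ = ‖x‖ := by
  rw [coordSwap_apply, EuclideanSpace.norm_eq, EuclideanSpace.norm_eq, Fin.sum_univ_two,
    Fin.sum_univ_two, add_comm]
  rfl

/-- The operators `± quarterTurn`. -/
def signedTurn (τ : ℤˣ) : 𝔼 →L[ℂ] 𝔼 := (τ : ℤ) • quarterTurn

theorem signedTurn_cases (τ : ℤˣ) : signedTurn τ = quarterTurn ∨ signedTurn τ = -quarterTurn := by
  rcases Int.units_eq_one_or τ with rfl | rfl
  · exact Or.inl (by simp [signedTurn])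
  · exact Or.inr (by simp [signedTurn])

theorem quarterTurn_quarterTurn (x : 𝔼) : quarterTurn (quarterTurn x) = -x := by
  ext i
  rw [quarterTurn_apply, quarterTurn_apply]
  fin_cases i <;> simp

theorem signedTurn_signedTurn (τ : ℤˣ) (x : 𝔼) : signedTurn τ (signedTurn τ x) = -x := by
  rcases signedTurn_cases τ with h | h <;> rw [h]
  · exact quarterTurn_quarterTurn x
  · change -quarterTurn (-quarterTurn x) = -x
    rw [map_neg, neg_neg, quarterTurn_quarterTurn]

theorem signedTurn_mul_self (τ : ℤˣ) : signedTurn τ * signedTurn τ = -1 := by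
  ext1 x
  exact signedTurn_signedTurn τ x

theorem star_signedTurn_apply (τ : ℤˣ) (x : 𝔼) : star (signedTurn τ) x = -signedTurn τ x := by
  refine ext_inner_left ℂ fun y => ?_
  have hq : ∀ x y : 𝔼, inner ℂ (quarterTurn y) x = -inner ℂ y (quarterTurn x) := fun x y => by
    rw [← inner_star_right, star_quarterTurn]
    exact inner_neg_right _ _
  rw [inner_star_right, inner_neg_right]
  rcases signedTurn_cases τ with h | h <;> rw [h]
  · exact hq x y
  · change inner ℂ (-quarterTurn y) x = -inner ℂ y (-quarterTurn x)
    rw [inner_neg_left, inner_neg_right, hq]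

theorem bar_signedTurn (τ : ℤˣ) : (stdConj 2).bar (signedTurn τ) = signedTurn τ := by
  have hq : ∀ x : 𝔼, (stdConj 2).toIsometry (quarterTurn ((stdConj 2).toIsometry x)) =
      quarterTurn x := fun x => congrArg (fun A : 𝔼 →L[ℂ] 𝔼 => A x) bar_quarterTurn
  ext1 x
  rw [Conjugation.bar_apply]
  rcases signedTurn_cases τ with h | h <;> rw [h]
  · exact hq x
  · change (stdConj 2).toIsometry (-quarterTurn ((stdConj 2).toIsometry x)) = -quarterTurn x
    rw [map_neg, hq]

theorem signedTurn_mem_unitary (τ : ℤˣ) : signedTurn τ ∈ unitary (𝔼 →L[ℂ] 𝔼) := by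
  rw [Unitary.mem_iff]
  constructor <;> ext1 x
  · change star (signedTurn τ) (signedTurn τ x) = x
    rw [star_signedTurn_apply, signedTurn_signedTurn, neg_neg]
  · change signedTurn τ (star (signedTurn τ) x) = x
    rw [star_signedTurn_apply, map_neg, signedTurn_signedTurn, neg_neg]

theorem signedTurn_coordSwap (τ : ℤˣ) (x : 𝔼) :
    signedTurn τ (coordSwap x) = -coordSwap (signedTurn τ x) := by
  rcases signedTurn_cases τ with h | h <;> rw [h] <;> simp [quarterTurn_coordSwap]

/-- `coordSwap` is isometric and anticommutes with the turn, so it exchanges opposite eigenspaces.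
-/
theorem eigenspace_signedTurn (τ : ℤˣ) (μ : ℂ) :
    Nonempty (End.eigenspace (signedTurn τ : 𝔼 →ₗ[ℂ] 𝔼) μ ≃ₗᵢ[ℂ]
      End.eigenspace (signedTurn τ : 𝔼 →ₗ[ℂ] 𝔼) (-μ)) := by
  have hmem : ∀ (μ : ℂ) (x : 𝔼), x ∈ End.eigenspace (signedTurn τ : 𝔼 →ₗ[ℂ] 𝔼) μ →
      coordSwap x ∈ End.eigenspace (signedTurn τ : 𝔼 →ₗ[ℂ] 𝔼) (-μ) := by
    intro μ x hx
    rw [End.mem_eigenspace_iff] at hx ⊢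
    change signedTurn τ x = μ • x at hx
    change signedTurn τ (coordSwap x) = -μ • coordSwap x
    rw [signedTurn_coordSwap, hx, map_smul, neg_smul]
  have hmem' : ∀ x : 𝔼, x ∈ End.eigenspace (signedTurn τ : 𝔼 →ₗ[ℂ] 𝔼) (-μ) →
      coordSwap x ∈ End.eigenspace (signedTurn τ : 𝔼 →ₗ[ℂ] 𝔼) μ := fun x hx => by
    have := hmem (-μ) x hx
    rwa [neg_neg] at this
  exact ⟨⟨{ toFun := fun x => ⟨coordSwap x, hmem μ x x.2⟩
            invFun := fun x => ⟨coordSwap x, hmem' x x.2⟩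
            map_add' := fun x y => Subtype.ext (map_add _ _ _)
            map_smul' := fun c x => Subtype.ext (map_smul _ _ _)
            left_inv := fun x => Subtype.ext (coordSwap_coordSwap _)
            right_inv := fun x => Subtype.ext (coordSwap_coordSwap _) },
    fun x => norm_coordSwap _⟩⟩

theorem eigenspace_signedTurn_equiv (τ : ℤˣ) {μ ν : ℂ} (hμ : μ * μ = -1) (hν : ν * ν = -1) :
    Nonempty (End.eigenspace (signedTurn τ : 𝔼 →ₗ[ℂ] 𝔼) μ ≃ₗᵢ[ℂ]
      End.eigenspace (signedTurn τ : 𝔼 →ₗ[ℂ] 𝔼) ν) := by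
  rcases mul_self_eq_mul_self_iff.mp (hν.trans hμ.symm) with h | h
  · rw [h]
    exact ⟨LinearIsometryEquiv.refl ℂ _⟩
  · rw [h]
    exact eigenspace_signedTurn τ μ

theorem mul_self_of_hasEigenvalue {E : Type*} [NormedAddCommGroup E] [InnerProductSpace ℂ E]
    {S : E →L[ℂ] E} (hS : ∀ x, S (S x) = -x) {μ : ℂ}
    (h : End.HasEigenvalue (S : E →ₗ[ℂ] E) μ) : μ * μ = -1 := by
  obtain ⟨x, hx, hx0⟩ := h.exists_hasEigenvector
  rw [End.mem_eigenspace_iff] at hx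
  change S x = μ • x at hx
  have h1 := hS x
  rw [hx, map_smul, hx, smul_smul, ← neg_one_smul ℂ x] at h1
  exact smul_left_injective ℂ hx0 h1

theorem isSymmetryOperator_signedTurn (τ : ℤˣ) :
    IsSymmetryOperator (stdConj 2) (-1) (signedTurn τ) where
  real := bar_signedTurn τ
  unitary := signedTurn_mem_unitary τ
  sq := by
    rw [signedTurn_mul_self]
    simp
  eigenspaces μ ν hμ hν := by
    exact eigenspace_signedTurn_equiv τ
      (mul_self_of_hasEigenvalue (signedTurn_signedTurn τ) hμ)
      (mul_self_of_hasEigenvalue (signedTurn_signedTurn τ) hν)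

end Plane

/-- Both square roots of `-1` are eigenvalues of an odd symmetry operator on a nonzero space. -/
theorem IsSymmetryOperator.hasEigenvalue {S : H →L[ℂ] H} (hS : IsSymmetryOperator C (-1) S)
    {x : H} (hx : x ≠ 0) {μ : ℂ} (hμ : μ * μ = -1) : End.HasEigenvalue (S : H →ₗ[ℂ] H) μ := by
  have hSS : ∀ y, S (S y) = -y := fun y => by
    rw [hS.apply_apply]
    simp
  -- Up to a factor 2 this is the projection of x to the μ-eigenspace. If it vanishes, x has
  -- eigenvalue -μ, and its conjugate has eigenvalue μ because `S` is real.
  by_cases h : x - μ • S x = 0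
  · have h1 : S x = -μ • x := by
      rw [sub_eq_zero] at h
      conv_rhs => rw [h, smul_smul, neg_mul, hμ, neg_neg, one_smul]
    refine End.hasEigenvalue_of_hasEigenvector (x := C.toIsometry x)
      ⟨End.mem_eigenspace_iff.mpr ?_, fun h0 => hx (antilinear_eq_zero _ h0)⟩
    change S (C.toIsometry x) = μ • C.toIsometry x
    rw [← hS.conj_apply, h1, map_smulₛₗ, map_neg, conj_eq_neg hμ, neg_neg]
  · refine End.hasEigenvalue_of_hasEigenvector (x := x - μ • S x)
      ⟨End.mem_eigenspace_iff.mpr ?_, h⟩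
    change S (x - μ • S x) = μ • (x - μ • S x)
    rw [map_sub, map_smul, hSS, smul_sub, smul_smul, hμ, smul_neg, neg_one_smul]
    abel

/-- On a nonzero space both square roots of -1 already occur as eigenvalues of `S`, so the plane
adds no new eigenvalue. -/
theorem IsSymmetryOperator.directSum_signedTurn {S : H →L[ℂ] H}
    (hS : IsSymmetryOperator C (-1) S) {x : H} (hx : x ≠ 0) (τ : ℤˣ) :
    IsSymmetryOperator (C.augment 2) (-1) (IndexPairing.directSum S (signedTurn τ)) := by
  have hSS : S * S = -1 := by
    rw [hS.sq]
    simp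
  refine hS.directSum (isSymmetryOperator_signedTurn τ) (fun μ hμ => ?_) fun μ ν hμ hν => ?_
  · refine hS.hasEigenvalue hx (mul_self_of_hasEigenvalue (fun y => ?_) hμ)
    have : IndexPairing.directSum S (signedTurn τ) * IndexPairing.directSum S (signedTurn τ) =
        -1 := by
      rw [directSum_mul, hSS, signedTurn_mul_self]
      rfl
    exact congrArg (fun A : Augmented H 2 →L[ℂ] Augmented H 2 => A y) this
  · have h : ∀ y, S (S y) = -y := fun y => congrArg (fun A : H →L[ℂ] H => A y) hSS
    exact eigenspace_signedTurn_equiv τ (mul_self_of_hasEigenvalue h hμ)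
      (mul_self_of_hasEigenvalue h hν)

/-- The only possible eigenvalues are ±a, and the sum of eigenvectors for a and -a is not an
eigenvector. -/
theorem exists_common_eigenvalue (N : Submodule ℂ H) {S : H →L[ℂ] H} (hS : ∀ x, S (S x) = -x)
    (h : ∀ x ∈ N, x ≠ 0 → ∃ a : ℂ, S x = a • x) {v : H} (hv : v ∈ N) (hv0 : v ≠ 0) :
    ∃ a : ℂ, a * a = -1 ∧ ∀ x ∈ N, S x = a • x := by
  have hsq : ∀ {x : H} {a : ℂ}, x ≠ 0 → S x = a • x → a * a = -1 := fun {x a} hx0 hx => by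
    have h1 := hS x
    rw [hx, map_smul, hx, smul_smul, ← neg_one_smul ℂ x] at h1
    exact smul_left_injective ℂ hx0 h1
  obtain ⟨a, ha⟩ := h v hv hv0
  have ha2 := hsq hv0 ha
  have ha0 : a ≠ 0 := fun h0 => by simp [h0] at ha2
  refine ⟨a, ha2, fun x hx => ?_⟩
  by_cases hx0 : x = 0
  · rw [hx0, map_zero, smul_zero]
  obtain ⟨b, hb⟩ := h x hx hx0
  rcases mul_self_eq_mul_self_iff.mp ((hsq hx0 hb).trans ha2.symm) with hab | hab
  · rw [hb, hab]
  exfalso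
  rw [hab] at hb
  have h2a : (2 * a : ℂ) ≠ 0 := mul_ne_zero two_ne_zero ha0
  have hsum : v + x ≠ 0 := fun h0 => by
    have h1 := congrArg S h0
    rw [map_add, ha, hb, map_zero, eq_neg_of_add_eq_zero_right h0, smul_neg, neg_smul, neg_neg,
      ← add_smul, ← two_mul] at h1
    exact hv0 ((smul_eq_zero.mp h1).resolve_left h2a)
  obtain ⟨c, hc⟩ := h (v + x) (N.add_mem hv hx) hsum
  have hc' := hc
  rw [map_add, ha, hb] at hc'
  rcases mul_self_eq_mul_self_iff.mp ((hsq hsum hc).trans ha2.symm) with hac | hac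
  · rw [hac, smul_add, neg_smul] at hc'
    have h1 : (2 * a) • x = 0 := by
      rw [two_mul, add_smul]
      have := add_left_cancel hc'
      nth_rewrite 1 [← this]
      simp
    exact hx0 ((smul_eq_zero.mp h1).resolve_left h2a)
  · rw [hac, smul_add, neg_smul, neg_smul] at hc'
    have h1 : (2 * a) • v = 0 := by
      rw [two_mul, add_smul]
      have := add_right_cancel hc'
      nth_rewrite 1 [this]
      simp
    exact hv0 ((smul_eq_zero.mp h1).resolve_left h2a)

/-- As long as some kernel vector is not an eigenvector of S, the finite-rank deformation of F
lowers the kernel. When this stops at odd dimension, the kernel lies in one eigenspace of S, and a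
plane with trivial pairing provides the vector needed to remove one more dimension. -/
theorem isTrivializable_of_quaternionic_transpose (hs : s.Admissible C 4 .d6)
    (h : IsPairing C s 4 .d6 P F) : IsTrivializable C s 4 .d6 P F := by
  have hSS : ∀ x, s.S (s.S x) = -x := fun x => by
    rw [hs.symm_S.apply_apply]
    simp [rowKind, Kind.sign]
  have hTT : ∀ x, s.Sigma (s.Sigma x) = -x := fun x => by
    rw [hs.symm_Sigma.apply_apply]
    simp [Column.sign]
  -- reduction to kernels consisting of eigenvectors
  obtain ⟨⟨P₁, F₁⟩, hjoin, hgood⟩ := exists_joinedIn_of_forall_exists_lt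
    (C := C) (s := s) (j := 4) (d := .d6)
    (fun q => ∀ x ∈ (pairingOp q.1 q.2).ker, x ≠ 0 → ∃ a : ℂ, s.S x = a • x)
    (fun P F h hne => by
      push Not at hne
      obtain ⟨x, hx, hx0, hne⟩ := hne
      refine exists_finrank_ker_lt_of_even_row hs h rfl
        (Or.inl ⟨Or.inr rfl, Or.inr rfl, rfl⟩) hx fun h0 => ?_
      obtain ⟨a, ha⟩ := exists_apply_eq_smul_of_inner_sq_add hs.symm_S.unitary hx0 h0
      exact hne a ha) h
  simp only at hgood
  by_cases heven : Even (finrank ℂ (pairingOp P₁ F₁).ker)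
  · exact isTrivializable_of_joinedIn hs hjoin heven
  rw [Nat.not_even_iff_odd] at heven
  have h₁ : IsPairing C s 4 .d6 P₁ F₁ := hjoin.target_mem
  have := h₁.fredholm.finite_ker
  have := finrank_pos_iff.mp heven.pos
  obtain ⟨⟨v, hv⟩, hv0⟩ := exists_ne (0 : (pairingOp P₁ F₁).ker)
  replace hv0 : v ≠ 0 := fun h0 => hv0 (Subtype.ext h0)
  obtain ⟨a, ha2, ha⟩ := exists_common_eigenvalue _ hSS hgood hv hv0
  change pairingOp P₁ F₁ v = 0 at hv
  have hv' := (pairingOp_apply_eq_zero_iff h₁.projection v).mp hv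
  have hFv : F₁ v ≠ 0 := fun h0 => hv0 (unitary_apply_eq_zero h₁.unitary h0)
  -- the sign of the additional eigenvalue of `Σ`
  obtain ⟨τ, hτ⟩ : ∃ τ : ℤˣ, F₁ v + (((τ : ℤ) : ℂ) * a) • s.Sigma (F₁ v) ≠ 0 := by
    by_contra! hτ
    have h1 := hτ 1
    have h2 := hτ (-1)
    simp only [Units.val_one, Int.cast_one, one_mul, Units.val_neg, Int.cast_neg, neg_mul,
      neg_smul] at h1 h2
    have h3 : (2 : ℂ) • F₁ v = 0 := by
      rw [two_smul]
      calc F₁ v + F₁ v = (F₁ v + a • s.Sigma (F₁ v)) + (F₁ v + -(a • s.Sigma (F₁ v))) := by abel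
        _ = 0 := by rw [h1, h2, add_zero]
    exact hFv ((smul_eq_zero.mp h3).resolve_left two_ne_zero)
  set b : ℂ := ((τ : ℤ) : ℂ) * a with hb
  have hb2 : b * b = -1 := by
    rcases units_cast_eq_one_or τ with hτ' | hτ' <;> rw [hb, hτ'] <;> linear_combination ha2
  -- Twice the component of F₁v in the (-b)-eigenspace of Σ, nonzero by the choice of τ; therefore
  -- ⟨w, F₁v⟩ = ⟨w, w⟩/2 ≠ 0.
  set w := F₁ v + b • s.Sigma (F₁ v) with hw
  have hPw : P₁ w = 0 := by
    rw [hw, map_add, map_smul, ← commute_apply h₁.comm_Sigma_P, hv'.2, map_zero, smul_zero,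
      add_zero]
  have hSFv : s.S (F₁ v) = a • F₁ v := by rw [commute_apply h₁.comm_S_F, ha v hv, map_smul]
  have hSw : s.S w = a • w := by
    rw [hw, map_add, map_smul, commute_apply hs.comm, hSFv, map_smul, smul_add, smul_comm a b]
  have hTw : s.Sigma w = -b • w := by
    rw [hw, map_add, map_smul, hTT, smul_add, smul_smul, neg_mul, hb2, neg_neg, one_smul, smul_neg,
      neg_smul, add_comm]
  have hwv : inner ℂ w (F₁ v) ≠ 0 := by
    have h1 : inner ℂ w (F₁ v) = b * inner ℂ w (s.Sigma (F₁ v)) := by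
      rw [← inner_unitary hs.symm_Sigma.unitary, hTw, inner_smul_left, map_neg, conj_eq_neg hb2,
        neg_neg]
    have h2 : inner ℂ w w = 2 * inner ℂ w (F₁ v) := by
      nth_rewrite 2 [hw]
      rw [inner_add_right, inner_smul_right, ← h1, two_mul]
    exact fun h0 => hτ (inner_self_eq_zero.mp (h2.trans (by rw [h0, mul_zero])))
  -- the additional plane
  set s' : Symmetries (EuclideanSpace ℂ (Fin 2)) := ⟨signedTurn 1, 1, signedTurn τ⟩ with hs'
  have hcomm : Commute (signedTurn 1) (signedTurn τ) := by
    have h1 : signedTurn 1 = quarterTurn := by simp [signedTurn]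
    rw [h1]
    rcases signedTurn_cases τ with h | h <;> rw [h]
    ext1 x
    exact map_neg quarterTurn (quarterTurn x)
  have hadm : s'.Admissible (stdConj 2) 4 .d6 :=
    ⟨isSymmetryOperator_signedTurn 1, isSymmetryOperator_signedTurn τ, hcomm,
      fun k hk => by simp [rowKindHat] at hk, fun k hk => by simp [rowKindHat] at hk⟩
  have hadm' : (s.augment s').Admissible (C.augment 2) 4 .d6 :=
    ⟨hs.symm_S.directSum_signedTurn hv0 1, hs.symm_Sigma.directSum_signedTurn hv0 τ,
      commute_directSum hs.comm hcomm, fun k hk => by simp [rowKindHat] at hk,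
      fun k hk => by simp [rowKindHat] at hk⟩
  have hpair : IsPairing (stdConj 2) s' 4 .d6 1 1 := by
    refine ⟨IsStarProjection.one _, one_mem _, ?_, fun k hk => by simp [rowKindHat] at hk, ?_,
      Commute.one_right _, fun k hk => by simp [rowKindHat] at hk, Commute.one_right _, ?_⟩
    · change star (signedTurn 1) * (stdConj 2).bar 1 * signedTurn 1 = 1
      rw [Conjugation.bar_one, mul_one, Unitary.star_mul_self_of_mem (signedTurn_mem_unitary 1)]
    · change star (signedTurn τ) * star ((stdConj 2).bar 1) * signedTurn τ = 1
      rw [Conjugation.bar_one, star_one, mul_one,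
        Unitary.star_mul_self_of_mem (signedTurn_mem_unitary τ)]
    · rw [show pairingOp (1 : EuclideanSpace ℂ (Fin 2) →L[ℂ] _) 1 = 1 by simp [pairingOp]]
      exact isFredholm_of_isUnit isUnit_one
  have hc : Continuous fun q : (H →L[ℂ] H) × (H →L[ℂ] H) =>
      (directSum q.1 (1 : EuclideanSpace ℂ (Fin 2) →L[ℂ] _),
        directSum q.2 (1 : EuclideanSpace ℂ (Fin 2) →L[ℂ] _)) :=
    ((continuous_directSum_left _).comp continuous_fst).prodMk
      ((continuous_directSum_left _).comp continuous_snd)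
  have hjoin' := (hjoin.map hc).mono 
    (V := {q | IsPairing (C.augment 2) (s.augment s') 4 .d6 q.1 q.2})
    (by
      rintro _ ⟨q, hq, rfl⟩
      exact IsPairing.augment hq hpair)
  have hker : pairingOp (directSum P₁ (1 : EuclideanSpace ℂ (Fin 2) →L[ℂ] _)) (directSum F₁ 1) =
      directSum (pairingOp P₁ F₁) 1 := by
    rw [pairingOp_directSum]
    congr 1
    simp [pairingOp]
  -- the additional eigenvector
  set e₀ : EuclideanSpace ℂ (Fin 2) := !₂[1, -a] with he₀
  have he₀0 : e₀ ≠ 0 := fun h0 => by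
    have := congrArg (fun z : EuclideanSpace ℂ (Fin 2) => z 0) h0
    simp [he₀] at this
  set e₁ : EuclideanSpace ℂ (Fin 2) := ((‖e₀‖ : ℝ) : ℂ)⁻¹ • e₀ with he₁
  have hturn : quarterTurn e₁ = a • e₁ := by
    rw [he₁, map_smul, smul_comm]
    congr 1
    rw [quarterTurn_apply, he₀]
    ext i
    fin_cases i <;> simp [ha2]
  set e : Augmented H 2 := WithLp.toLp 2 (0, e₁) with he
  have hsmul : ∀ (c : ℂ) (x : H) (y : EuclideanSpace ℂ (Fin 2)),
      (WithLp.toLp 2 (c • x, c • y) : Augmented H 2) = c • WithLp.toLp 2 (x, y) :=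
    fun _ _ _ => rfl
  have hpair' : IsPairing (C.augment 2) (s.augment s') 4 .d6 (directSum P₁ 1) (directSum F₁ 1) :=
    IsPairing.augment h₁ hpair
  obtain ⟨q, hq, hqeven⟩ := exists_joinedIn_even_of_eigenvector (a := a) (b := b) (e := e)
    (w := WithLp.toLp 2 (w, 0)) (v₀ := WithLp.toLp 2 (v, 0)) hadm' hpair'
    (by rw [hker, finrank_ker_directSum_one]; exact heven) ha2 hb2
    (fun z hz => by
      rw [hker] at hz
      have h1 : pairingOp P₁ F₁ z.fst = 0 := congrArg WithLp.fst hz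
      have h2 : z.snd = 0 := congrArg WithLp.snd hz
      refine directSum_apply_eq_smul_iff.mpr ⟨ha _ h1, ?_⟩
      rw [h2, map_zero, smul_zero])
    (by
      rw [inner_self_eq_ofReal, WithLp.prod_norm_eq_of_L2]
      change ((√(‖(0 : H)‖ ^ 2 + ‖e₁‖ ^ 2) ^ 2 : ℝ) : ℂ) = 1
      rw [show ‖e₁‖ = 1 from norm_smul_inv_norm he₀0]
      simp)
    (by rw [directSum_apply, he]; simp)
    (by rw [directSum_apply, he]; simp)
    (directSum_apply_eq_smul_iff.mpr ⟨by simp [he], by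
      change signedTurn 1 e₁ = a • e₁
      rw [← hturn]
      simp [signedTurn]⟩)
    (directSum_apply_eq_smul_iff.mpr ⟨by simp [he], by
      change signedTurn τ e₁ = b • e₁
      rw [hb, mul_smul, ← hturn, Int.cast_smul_eq_zsmul]
      rfl⟩)
    (by
      rw [directSum_apply]
      change WithLp.toLp 2 (P₁ w, (0 : EuclideanSpace ℂ (Fin 2))) = 0
      rw [hPw]
      rfl)
    (directSum_apply_eq_smul_iff.mpr ⟨hSw, by simp⟩)
    (directSum_apply_eq_smul_iff.mpr ⟨hTw, by simp⟩)
    (by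
      rw [hker, directSum_apply]
      change WithLp.toLp 2 (pairingOp P₁ F₁ v, (0 : EuclideanSpace ℂ (Fin 2))) = 0
      rw [hv]
      rfl)
    (by
      rw [directSum_apply, WithLp.prod_inner_apply]
      change inner ℂ w (F₁ v) + inner ℂ (0 : EuclideanSpace ℂ (Fin 2)) 0 ≠ 0
      rwa [inner_zero_right, add_zero])
  exact isTrivializable_of_joinedIn_augment hadm hadm' (hjoin'.trans hq) hqeven

end QuaternionicPlane

/-! ### The entries of the table. -/

section TableEntries

variable {H : Type*} [NormedAddCommGroup H] [InnerProductSpace ℂ H] [CompleteSpace H]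

variable {C : Conjugation H} {s : Symmetries H} {j : Fin 8} {d : Column} {P F : H →L[ℂ] H}

theorem hasIndexType_twoZ (hs : s.Admissible C j d) (h : IsPairing C s j d P F)
    (hkd : (rowKind j = .R ∨ rowKind j = .Q) ∧ (d = .d4 ∨ d = .d8) ∨
      (rowKind j = .O ∨ rowKind j = .S) ∧ (d = .d2 ∨ d = .d6))
    (hsign : (rowKind j).sign * d.sign = -1) :
    HasIndexType C s j d P F (.twoZ (rowKind j)) := by
  obtain ⟨h1, h2⟩ := (h.cell hs).even_noetherIndex hkd hsign
  exact ⟨Or.inl ⟨rfl, hs.symm_S, h.rel_S⟩, h2, h1, isHomotopyInvariantAt_noetherIndex⟩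

theorem hasIndexType_Z2 {k : Kind} {S : H →L[ℂ] H} (hkind : HasKind C s j P k)
    (hcell : ∀ P F, IsPairing C s j d P F → IsCell C k d S s.Sigma P F)
    (h : IsPairing C s j d P F)
    (hkd : (k = .R ∨ k = .Q) ∧ (d = .d2 ∨ d = .d6) ∧ k.sign * d.sign = -1 ∨
      (k = .O ∨ k = .S) ∧ (d = .d4 ∨ d = .d8) ∧ k.sign * d.sign = 1) :
    HasIndexType C s j d P F (.Z2 k) := by
  rcases hkd with ⟨hk, hd, hsign⟩ | ⟨hk, hd, hsign⟩
  · exact ⟨hkind, (hcell P F h).noetherIndex_eq_zero_of_transpose hk hd,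
      isHomotopyInvariantAt_index2_of_preserves hcell hk hd hsign⟩
  · exact ⟨hkind, (hcell P F h).noetherIndex_eq_zero_of_bar hk hd,
      isHomotopyInvariantAt_index2_of_flips hcell hk hd hsign⟩

theorem hasIndexType_Z2_of_row (hs : s.Admissible C j d) (h : IsPairing C s j d P F)
    (hkd : (rowKind j = .R ∨ rowKind j = .Q) ∧ (d = .d2 ∨ d = .d6) ∧
        (rowKind j).sign * d.sign = -1 ∨
      (rowKind j = .O ∨ rowKind j = .S) ∧ (d = .d4 ∨ d = .d8) ∧
        (rowKind j).sign * d.sign = 1) :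
    HasIndexType C s j d P F (.Z2 (rowKind j)) :=
  hasIndexType_Z2 (Or.inl ⟨rfl, hs.symm_S, h.rel_S⟩) (fun _ _ h => h.cell hs) h hkd

theorem hasIndexType_Z2_of_hat (hs : s.Admissible C j d) (h : IsPairing C s j d P F) {k : Kind}
    (hj : rowKindHat j = some k)
    (hkd : (k = .R ∨ k = .Q) ∧ (d = .d2 ∨ d = .d6) ∧ k.sign * d.sign = -1 ∨
      (k = .O ∨ k = .S) ∧ (d = .d4 ∨ d = .d8) ∧ k.sign * d.sign = 1) :
    HasIndexType C s j d P F (.Z2 k) :=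
  hasIndexType_Z2 (Or.inr ⟨hj, hs.symm_Shat k hj, h.rel_Shat k hj⟩)
    (fun _ _ h => h.cell_hat hs hj) h hkd

theorem IsCell.noetherIndex_eq_zero {k : Kind} {S Sigma : H →L[ℂ] H}
    (h : IsCell C k d S Sigma P F)
    (hkd : (k = .R ∨ k = .Q) ∧ (d = .d2 ∨ d = .d6) ∨ (k = .O ∨ k = .S) ∧ (d = .d4 ∨ d = .d8)) :
    noetherIndex (pairingOp P F) = 0 := by
  rcases hkd with ⟨hk, hd⟩ | ⟨hk, hd⟩
  · exact h.noetherIndex_eq_zero_of_transpose hk hd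
  · exact h.noetherIndex_eq_zero_of_bar hk hd

/-- The vanishing entries of the odd rows in which kernels are even-dimensional, because of `S`
or because of `Ŝ`. -/
theorem hasIndexType_zero_of_even (hs : s.Admissible C j d) (h : IsPairing C s j d P F)
    {k k' : Kind} {S S' : H →L[ℂ] H} (h1 : IsCell C k d S s.Sigma P F)
    (h2 : IsCell C k' d S' s.Sigma P F)
    (hk : (k = .R ∨ k = .Q) ∧ (d = .d2 ∨ d = .d6) ∨ (k = .O ∨ k = .S) ∧ (d = .d4 ∨ d = .d8))
    (hk' : (k' = .R ∨ k' = .Q) ∧ (d = .d4 ∨ d = .d8) ∨ (k' = .O ∨ k' = .S) ∧ (d = .d2 ∨ d = .d6))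
    (hsign : k'.sign * d.sign = -1) :
    HasIndexType C s j d P F .zero :=
  ⟨h1.noetherIndex_eq_zero hk, isTrivializable_of_even hs h (h2.even_noetherIndex hk' hsign).1⟩

theorem hasIndexType_zero_of_hat (hs : s.Admissible C j d) (h : IsPairing C s j d P F)
    {k : Kind} (hj : rowKindHat j = some k)
    (hk : (rowKind j = .R ∨ rowKind j = .Q) ∧ (d = .d2 ∨ d = .d6) ∨
      (rowKind j = .O ∨ rowKind j = .S) ∧ (d = .d4 ∨ d = .d8))
    (hkind : (rowKind j = .R ∨ rowKind j = .Q) ∧ (k = .O ∨ k = .S) ∨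
      (rowKind j = .O ∨ rowKind j = .S) ∧ (k = .R ∨ k = .Q))
    (hd : (d = .d2 ∨ d = .d6) ∧ (rowKind j).sign * k.sign = 1 ∨
      (d = .d4 ∨ d = .d8) ∧ (rowKind j).sign * k.sign = -1) :
    HasIndexType C s j d P F .zero :=
  ⟨(h.cell hs).noetherIndex_eq_zero hk, isTrivializable_of_forall_exists_lt hs
    (fun _ _ h _ hx0 hx => exists_finrank_ker_lt_of_hat hs h hj hkind hd hx0 hx) h⟩

/-- Since S² = 1, ⟨x,x⟩² + ⟨Sx,x⟩² never vanishes for x ≠ 0, and moving `F` lowers every nonzero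
kernel. -/
theorem hasIndexType_zero_of_unitary (hs : s.Admissible C j d) (h : IsPairing C s j d P F)
    (hj : rowKindHat j = none) (hS : (rowKind j).sign = 1)
    (hk : rowKind j = .R ∧ d = .d2 ∨ rowKind j = .O ∧ d = .d4) :
    HasIndexType C s j d P F .zero := by
  refine ⟨(h.cell hs).noetherIndex_eq_zero ?_, isTrivializable_of_forall_exists_lt hs
    (fun _ _ h x hx0 hx => exists_finrank_ker_lt_of_even_row hs h hj ?_ hx
      (inner_sq_add_inner_sq_ne_zero hs.symm_S.unitary (fun y => ?_) hx0)) h⟩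
  · rcases hk with ⟨h1, rfl⟩ | ⟨h1, rfl⟩ <;> simp [h1]
  · rcases hk with ⟨h1, rfl⟩ | ⟨h1, rfl⟩ <;> simp [h1, Kind.sign, Column.sign]
  · rw [hs.symm_S.apply_apply, hS]
    simp

/-- Here S² = -1, so moving `F` may be obstructed; but Σ² = 1, and moving `P` is always possible. -/
theorem hasIndexType_zero_of_projection (hs : s.Admissible C j d) (h : IsPairing C s j d P F)
    (hj : rowKindHat j = none) (hk : rowKind j = .S) (hd : d = .d8) :
    HasIndexType C s j d P F .zero := by
  subst hd
  refine ⟨(h.cell hs).noetherIndex_eq_zero (by simp [hk]), isTrivializable_of_forall_exists_lt hs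
    (fun _ _ h x hx0 hx => exists_finrank_ker_lt_of_projection hs h hj (Or.inr hk) (Or.inr rfl)
      (by simp [hk, Kind.sign, Column.sign]) hx
      (inner_sq_add_inner_sq_ne_zero hs.symm_Sigma.unitary (fun y => ?_) hx0)) h⟩
  rw [hs.symm_Sigma.apply_apply]
  simp [Column.sign]

end TableEntries

end

end IndexPairing

theorem theorem1 {H : Type*} [NormedAddCommGroup H] [InnerProductSpace ℂ H] [CompleteSpace H]
    (C : IndexPairing.Conjugation H) (j : Fin 8) (d : IndexPairing.Column)
    (s : IndexPairing.Symmetries H) (hs : s.Admissible C j d)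
    (P F : H →L[ℂ] H) (hPF : IndexPairing.IsPairing C s j d P F) :
    IndexPairing.HasIndexType C s j d P F (IndexPairing.table j d) := by
  open IndexPairing in
  -- Constancy of the integer index requires no symmetry, so it is available for every cell.
  have hZ : HasIndexType C s j d P F .Z := isHomotopyInvariantAt_noetherIndex
  match j, d with
  | 0, .d2 => exact hasIndexType_zero_of_unitary hs hPF rfl rfl (Or.inl ⟨rfl, rfl⟩)
  | 0, .d4 => exact hasIndexType_twoZ hs hPF (by simp [rowKind]) rfl
  | 0, .d6 => exact hasIndexType_Z2_of_row hs hPF (by simp [rowKind, Kind.sign, Column.sign])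
  | 0, .d8 => exact hZ
  | 1, .d2 => exact hasIndexType_zero_of_hat hs hPF (k := .O) rfl (by simp [rowKind])
                (by simp [rowKind]) (by simp [rowKind, Kind.sign])
  | 1, .d4 => exact hasIndexType_zero_of_even hs hPF (hPF.cell_hat hs (k := .O) rfl) (hPF.cell hs)
                (by simp) (by simp [rowKind]) rfl
  | 1, .d6 => exact hasIndexType_zero_of_even hs hPF (hPF.cell hs) (hPF.cell_hat hs (k := .O) rfl)
                (by simp [rowKind]) (by simp) rfl
  | 1, .d8 => exact hasIndexType_Z2_of_hat hs hPF rfl (by simp [Kind.sign, Column.sign])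
  | 2, .d2 => exact hZ
  | 2, .d4 => exact hasIndexType_zero_of_unitary hs hPF rfl rfl (Or.inr ⟨rfl, rfl⟩)
  | 2, .d6 => exact hasIndexType_twoZ hs hPF (by simp [rowKind]) rfl
  | 2, .d8 => exact hasIndexType_Z2_of_row hs hPF (by simp [rowKind, Kind.sign, Column.sign])
  | 3, .d2 => exact hasIndexType_Z2_of_hat hs hPF rfl (by simp [Kind.sign, Column.sign])
  | 3, .d4 => exact hasIndexType_zero_of_hat hs hPF (k := .Q) rfl (by simp [rowKind])
                (by simp [rowKind]) (by simp [rowKind, Kind.sign])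
  | 3, .d6 => exact hasIndexType_zero_of_even hs hPF (hPF.cell_hat hs (k := .Q) rfl) (hPF.cell hs)
                (by simp) (by simp [rowKind]) rfl
  | 3, .d8 => exact hasIndexType_zero_of_even hs hPF (hPF.cell hs) (hPF.cell_hat hs (k := .Q) rfl)
                (by simp [rowKind]) (by simp) rfl
  | 4, .d2 => exact hasIndexType_Z2_of_row hs hPF (by simp [rowKind, Kind.sign, Column.sign])
  | 4, .d4 => exact hZ
  | 4, .d6 => exact ⟨(hPF.cell hs).noetherIndex_eq_zero (by simp [rowKind]),
                isTrivializable_of_quaternionic_transpose hs hPF⟩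
  | 4, .d8 => exact hasIndexType_twoZ hs hPF (by simp [rowKind]) rfl
  | 5, .d2 => exact hasIndexType_zero_of_even hs hPF (hPF.cell hs) (hPF.cell_hat hs (k := .S) rfl)
                (by simp [rowKind]) (by simp) rfl
  | 5, .d4 => exact hasIndexType_Z2_of_hat hs hPF rfl (by simp [Kind.sign, Column.sign])
  | 5, .d6 => exact hasIndexType_zero_of_hat hs hPF (k := .S) rfl (by simp [rowKind])
                (by simp [rowKind]) (by simp [rowKind, Kind.sign])
  | 5, .d8 => exact hasIndexType_zero_of_even hs hPF (hPF.cell_hat hs (k := .S) rfl) (hPF.cell hs)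
                (by simp) (by simp [rowKind]) rfl
  | 6, .d2 => exact hasIndexType_twoZ hs hPF (by simp [rowKind]) rfl
  | 6, .d4 => exact hasIndexType_Z2_of_row hs hPF (by simp [rowKind, Kind.sign, Column.sign])
  | 6, .d6 => exact hZ
  | 6, .d8 => exact hasIndexType_zero_of_projection hs hPF rfl rfl rfl
  | 7, .d2 => exact hasIndexType_zero_of_even hs hPF (hPF.cell_hat hs (k := .R) rfl) (hPF.cell hs)
                (by simp) (by simp [rowKind]) rfl
  | 7, .d4 => exact hasIndexType_zero_of_even hs hPF (hPF.cell hs) (hPF.cell_hat hs (k := .R) rfl)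
                (by simp [rowKind]) (by simp) rfl
  | 7, .d6 => exact hasIndexType_Z2_of_hat hs hPF rfl (by simp [Kind.sign, Column.sign])
  | 7, .d8 => exact hasIndexType_zero_of_hat hs hPF (k := .R) rfl (by simp [rowKind])
                (by simp [rowKind]) (by simp [rowKind, Kind.sign])
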